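/- **Setting.** Let $G$ be an étale groupoid: a topological groupoid, not necessarily Hausdorff, with locally compact Hausdorff unit space $G^0$, whose range map $r:G\to G^0$ is a local homeomorphism ($s$ is the source map). Assume that $G$ is covered by countably many open bisections. Put $G_x=s^{-1}(x)$ and $G^x_x=\{g\in G: s(g)=r(g)=x\}$. * For an étale groupoid $S$, $\mathscr C_c(S)$ is the convolution algebra spanned by the functions that are continuous with compact support on some open bisection and zero elsewhere; for $x\in S^0$, $\lambda_x(f)\psi=f*\psi$ on $\ell^2(S_x)$. The reduced norm is $\|f\|_r=\sup_{x\in S^0}\|\lambda_x(f)\|$ and $C^*_r(S)$ is the completion of $\mathscr C_c(S)$ for it. An element $a\in C^*_r(S)$ is regarded as the function $a(g)=\langle\lambda_{s(g)}(a)\delta_{s(g)},\delta_g\rangle$ on $S$. The *singular ideal* is $J=\{a\in C^*_r(G): s(\{g: a(g)\neq0\})\text{ is meagre in }G^0\}$. * A unit $x\in G^0$ is *extremely dangerous* if there are finitely many $g_1,\dots,g_n\in G^x_x\setminus\{x\}$, open bisections $U_i\ni g_i$ and an open set $U\subseteq G^0$ containing $x$ such that $U\setminus\bigcup_{i=1}^nU_i$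 has empty interior in $G^0$. Let $D_0$ be the set of extremely dangerous points. * Let $C\subseteq G^0$ be the set of units $x$ that can be separated by disjoint open sets from every other $h\in G$. Give the closed subsets of $G$ the Fell topology (generated by $\{A:A\cap K=\emptyset\}$, $K$ compact, and $\{A:A\cap U\ne\emptyset\}$, $U$ open). Let $\tilde G$ be the set of nonempty elements of the closure of $\{\{g\}:g\in G\}$ and $\tilde G^0_{ess}$ the set of nonempty elements of the closure of $\{\{x\}:x\in C\}$. All these sets are cosets of subgroups of isotropy groups; $\tilde G$ is a Hausdorff étale groupoid under the product and inverse of sets, and $\tilde G_{ess}$ is its reduction to $\tilde G^0_{ess}$. For $x\in G^0$ let $\mathcal X_x=\pi_{ess}^{-1}(x)=\{X\in\tilde G^0_{ess}: X\cap G^0=\{x\}\}$, a conjugation-invariant set of subgroups of $G^x_x$. The *coset groupoid* $G^x_x\cdot\mathcal X_x=\{gX: g\in G^x_x,\ X\in\mathcal X_x\}$ is the reduction of $\tilde G_{ess}$ to $\mathcal X_x$. * The norm $r(\mathcal X_x)$ on $C_c(G^x_x\cdot\mathcal X_x)$ is $\|b\|_{r(\mathcal X_x)}=\inf\{\|f\|_r: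 f\in\mathscr C_c(H),\ f|_{G^x_x\cdot\mathcal X_x}=b\}$, where $H$ is an open subgroupoid of $\tilde G_{ess}$ for which $\mathcal X_x$ is invariant and whose reduction to $\mathcal X_x$ is $G^x_x\cdot\mathcal X_x$, and $\|f\|_r$ is the reduced norm of $\mathscr C_c(\tilde G_{ess})\supseteq\mathscr C_c(H)$ (such $H$ exist and the norm does not depend on the choice of $H$). The same symbol denotes the seminorm $a\mapsto\|q_x(a)\|_{r(\mathcal X_x)}$ on $\mathbb C[G^x_x]$, where $q_x(a)(Y)=\sum_{y\in Y}a(y)$. Put $\widehat{r(\mathcal X_x)}=\max\{r(\mathcal X_x),r\}$, with $r$ the reduced norm on $\mathbb C[G^x_x]$. * For a discrete group $\Gamma$ and a set $\mathcal X$ of subgroups, $r\mathcal X$ is the seminorm $a\mapsto\sup_{X\in\mathcal X}\|\lambda_{\Gamma/X}(a)\|$ on $\mathbb C[\Gamma]$, with $\lambda_{\Gamma/X}$ the quasi-regular representation on $\ell^2(\Gamma/X)$; $\hat{\mathcal X}=\mathcal X\cup\{\{e\}\}$; and $J_{\Gamma,\mathcal X}=\ker\big(C^*_{r\hat{\mathcal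 X}}(\Gamma)\to C^*_{r\mathcal X}(\Gamma)\big)$, where $C^*_\rho(\Gamma)$ is the (Hausdorff) completion of $\mathbb C[\Gamma]$ for $\rho$. **Theorem.** 1. Assume that for every $x\in D_0$ the norm $r(\mathcal X_x)$ equals the reduced norm $r$ of the coset groupoid on $C_c(G^x_x\cdot\mathcal X_x)$. Then the following are equivalent: (a) $J=\{0\}$; (b) $J_{G^x_x,\,\mathcal X_x}=\{0\}$ for every $x\in D_0$; (c) the regular representation $\lambda_{G^x_x}$ is weakly contained in $\bigoplus_{X\in\mathcal X_x}\lambda_{G^x_x/X}$ for every $x\in D_0$. Moreover, under this assumption, for each single $x\in D_0$ one has $J_{G^x_x,\,\mathcal X_x}=\{0\}$ if and only if $\lambda_{G^x_x}$ is weakly contained in $\bigoplus_{X\in\mathcal X_x}\lambda_{G^x_x/X}$. 2. If $x\in G^0$ has amenable isotropy group $G^x_x$, then $r(\mathcal X_x)$ equals the reduced norm on $C_c(G^x_x\cdot\mathcal X_x)$. 3. In general (without the assumption in 1), $J=\{0\}$ if and only if $\ker\big(C^*_{\widehat{r(\mathcal X_x)}}(G^x_x)\to C^*_{r(\mathcal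 X_x)}(G^x_x)\big)=\{0\}$ for every $x\in D_0$. -/

import Mathlib

open scoped ENNReal Topology

noncomputable section

/-! ### Groupoids, as sets of arrows -/

/-- A groupoid, presented by its set of arrows `G`; objects are identified with identity arrows.
The product `gmul g h` is meaningful when `src g = rng h`, and only then do the laws constrain it. -/
class GroupoidArrows (G : Type*) where
  src : G → G
  rng : G → G
  ginv : G → G
  gmul : G → G → G
  src_inv : ∀ g, src (ginv g) = rng g
  rng_inv : ∀ g, rng (ginv g) = src g
  src_mul : ∀ g h, src g = rng h → src (gmul g h) = src h
  rng_mul : ∀ g h, src g = rng h → rng (gmul g h) = rng g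
  gmul_assoc : ∀ g h k, src g = rng h → src h = rng k → gmul (gmul g h) k = gmul g (gmul h k)
  ginv_gmul : ∀ g, gmul (ginv g) g = src g
  gmul_ginv : ∀ g, gmul g (ginv g) = rng g
  gmul_src : ∀ g, gmul g (src g) = g
  rng_gmul : ∀ g, gmul (rng g) g = g

open GroupoidArrows

/-- The unit space `G⁰`. -/
def units (G : Type*) [GroupoidArrows G] : Set G := {u | src u = u}

section Algebra

variable {G : Type*} [GroupoidArrows G]

theorem gpd_src_src (g : G) : src (src g) = src g := by
  rw [← ginv_gmul g, src_mul _ _ (src_inv g), ginv_gmul]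

theorem gpd_rng_src (g : G) : rng (src g) = src g := by
  conv_lhs => rw [← ginv_gmul g, rng_mul _ _ (src_inv g), rng_inv]

theorem gpd_rng_rng (g : G) : rng (rng g) = rng g := by
  rw [← gmul_ginv g, rng_mul _ _ (rng_inv g).symm, gmul_ginv]

theorem gpd_src_rng (g : G) : src (rng g) = rng g := by
  conv_lhs => rw [← gmul_ginv g, src_mul _ _ (rng_inv g).symm, src_inv]

theorem gpd_inv_inv (g : G) : ginv (ginv g) = g := by
  have h1 : src (ginv (ginv g)) = rng (ginv g) := src_inv _
  have h2 : gmul (gmul (ginv (ginv g)) (ginv g)) g = gmul (ginv (ginv g)) (gmul (ginv g) g) :=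
    gmul_assoc _ _ _ h1 (src_inv g)
  rw [ginv_gmul, ginv_gmul, src_inv, rng_gmul, ← rng_inv, ← h1, gmul_src] at h2
  exact h2.symm

theorem gpd_inv_cancel_left (g h : G) (e : src g = rng h) : gmul (ginv g) (gmul g h) = h := by
  rw [← gmul_assoc _ _ _ (src_inv g) e, ginv_gmul, e, rng_gmul]

theorem gpd_cancel_inv_left (g h : G) (e : rng g = rng h) : gmul g (gmul (ginv g) h) = h := by
  rw [← gmul_assoc _ _ _ (rng_inv g).symm ((src_inv g).trans e), gmul_ginv, e, rng_gmul]

theorem gpd_mul_inv_rev (g h : G) (e : src g = rng h) :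
    ginv (gmul g h) = gmul (ginv h) (ginv g) := by
  have e1 : src (ginv h) = rng (ginv g) := by rw [src_inv, rng_inv, e]
  have e2 : src (gmul g h) = rng (ginv h) := by rw [src_mul _ _ e, rng_inv]
  have k1 : gmul (gmul g h) (gmul (ginv h) (ginv g)) = rng g := by
    rw [gmul_assoc _ _ _ e (by rw [rng_mul _ _ e1, rng_inv]),
      gpd_cancel_inv_left _ _ (by rw [rng_inv, e]), gmul_ginv]
  have k2 := gpd_inv_cancel_left (gmul g h) (gmul (ginv h) (ginv g))
    (by rw [src_mul _ _ e, rng_mul _ _ e1, rng_inv])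
  rw [k1, ← rng_mul _ _ e, ← src_inv, gmul_src] at k2
  exact k2

end Algebra

/-! ### The isotropy groups -/

/-- The isotropy group `Gˣₓ` at the unit `x`. -/
def Isotropy {G : Type*} [GroupoidArrows G] (x : units G) : Type _ :=
  {g : G // src g = x ∧ rng g = x}

instance {G : Type*} [GroupoidArrows G] (x : units G) : Group (Isotropy x) where
  mul g h := ⟨gmul g.1 h.1, (src_mul _ _ (g.2.1.trans h.2.2.symm)).trans h.2.1,
    (rng_mul _ _ (g.2.1.trans h.2.2.symm)).trans g.2.2⟩
  one := ⟨x.1, x.2, by have h := gpd_rng_src x.1; rwa [show src x.1 = x.1 from x.2] at h⟩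
  inv g := ⟨ginv g.1, (src_inv _).trans g.2.2, (rng_inv _).trans g.2.1⟩
  mul_assoc a b c := Subtype.ext
    (gmul_assoc _ _ _ (a.2.1.trans b.2.2.symm) (b.2.1.trans c.2.2.symm))
  one_mul a := Subtype.ext (by
    have h := rng_gmul a.1
    rwa [a.2.2] at h)
  mul_one a := Subtype.ext (by
    have h := gmul_src a.1
    rwa [a.2.1] at h)
  inv_mul_cancel a := Subtype.ext ((ginv_gmul a.1).trans a.2.1)

/-! ### The groupoid of cosets -/

/-- A coset `gX` of a subgroup `X` of an isotropy group of `G`, described intrinsically: a nonempty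
set of arrows with a common source and a common range that is closed under `a b⁻¹ c`. -/
@[ext]
structure Coset (G : Type*) [GroupoidArrows G] where
  carrier : Set G
  nonempty : carrier.Nonempty
  src_eq : ∀ a ∈ carrier, ∀ b ∈ carrier, src a = src b
  rng_eq : ∀ a ∈ carrier, ∀ b ∈ carrier, rng a = rng b
  closed : ∀ a ∈ carrier, ∀ b ∈ carrier, ∀ c ∈ carrier, gmul (gmul a (ginv b)) c ∈ carrier

namespace Coset

variable {G : Type*} [GroupoidArrows G]

/-- Pointwise inverse `A⁻¹`. -/
def cinv (A : Coset G) : Coset G where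
  carrier := {g | ∃ a ∈ A.carrier, g = ginv a}
  nonempty := let ⟨a, ha⟩ := A.nonempty; ⟨ginv a, a, ha, rfl⟩
  src_eq := by
    rintro _ ⟨a, ha, rfl⟩ _ ⟨b, hb, rfl⟩
    rw [src_inv, src_inv, A.rng_eq a ha b hb]
  rng_eq := by
    rintro _ ⟨a, ha, rfl⟩ _ ⟨b, hb, rfl⟩
    rw [rng_inv, rng_inv, A.src_eq a ha b hb]
  closed := by
    rintro _ ⟨a, ha, rfl⟩ _ ⟨b, hb, rfl⟩ _ ⟨c, hc, rfl⟩
    refine ⟨_, A.closed c hc b hb a ha, ?_⟩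
    have e1 := A.src_eq
    have e2 := A.rng_eq
    rw [gpd_mul_inv_rev, gpd_mul_inv_rev, gmul_assoc]
    all_goals grind [src_inv, rng_inv, src_mul, rng_mul]

/-- The set `A⁻¹A`, which is the subgroup `X` when `A = gX`. -/
def csrc (A : Coset G) : Coset G where
  carrier := {g | ∃ a ∈ A.carrier, ∃ b ∈ A.carrier, g = gmul (ginv a) b}
  nonempty := let ⟨a, ha⟩ := A.nonempty; ⟨_, a, ha, a, ha, rfl⟩
  src_eq := by
    have e1 := A.src_eq
    have e2 := A.rng_eq
    rintro _ ⟨a, ha, b, hb, rfl⟩ _ ⟨c, hc, d, hd, rfl⟩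
    grind [src_inv, src_mul]
  rng_eq := by
    have e1 := A.src_eq
    have e2 := A.rng_eq
    rintro _ ⟨a, ha, b, hb, rfl⟩ _ ⟨c, hc, d, hd, rfl⟩
    grind [src_inv, rng_inv, rng_mul]
  closed := by
    have e1 := A.src_eq
    have e2 := A.rng_eq
    rintro _ ⟨a, ha, b, hb, rfl⟩ _ ⟨c, hc, d, hd, rfl⟩ _ ⟨e, he, f, hf, rfl⟩
    refine ⟨a, ha, _, A.closed _ (A.closed b hb d hd c hc) e he f hf, ?_⟩
    grind [gpd_mul_inv_rev, gpd_inv_inv, gmul_assoc, src_inv, rng_inv, src_mul, rng_mul]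

/-- The set `AA⁻¹`, which is the subgroup `gXg⁻¹` when `A = gX`. -/
def crng (A : Coset G) : Coset G where
  carrier := {g | ∃ a ∈ A.carrier, ∃ b ∈ A.carrier, g = gmul a (ginv b)}
  nonempty := let ⟨a, ha⟩ := A.nonempty; ⟨_, a, ha, a, ha, rfl⟩
  src_eq := by
    have e1 := A.src_eq
    have e2 := A.rng_eq
    rintro _ ⟨a, ha, b, hb, rfl⟩ _ ⟨c, hc, d, hd, rfl⟩
    grind [src_inv, rng_inv, src_mul]
  rng_eq := by
    have e1 := A.src_eq
    have e2 := A.rng_eq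
    rintro _ ⟨a, ha, b, hb, rfl⟩ _ ⟨c, hc, d, hd, rfl⟩
    grind [src_inv, rng_inv, rng_mul]
  closed := by
    have e1 := A.src_eq
    have e2 := A.rng_eq
    rintro _ ⟨a, ha, b, hb, rfl⟩ _ ⟨c, hc, d, hd, rfl⟩ _ ⟨e, he, f, hf, rfl⟩
    refine ⟨_, A.closed _ (A.closed a ha b hb d hd) c hc e he, f, hf, ?_⟩
    grind [gpd_mul_inv_rev, gpd_inv_inv, gmul_assoc, src_inv, rng_inv, src_mul, rng_mul]

theorem src_eq_rng {A B : Coset G} (h : A.csrc = B.crng) {a b : G} (ha : a ∈ A.carrier)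
    (hb : b ∈ B.carrier) : src a = rng b := by
  have h1 : gmul (ginv a) a ∈ B.crng.carrier := h ▸ ⟨a, ha, a, ha, rfl⟩
  obtain ⟨c, hc, d, hd, e⟩ := h1
  have e1 := B.src_eq
  have e2 := B.rng_eq
  grind [src_inv, rng_inv, rng_mul]

theorem exists_left {A B : Coset G} (h : A.csrc = B.crng) {a b c : G} (ha : a ∈ A.carrier)
    (hb : b ∈ B.carrier) (hc : c ∈ B.carrier) :
    gmul a (gmul b (ginv c)) ∈ A.carrier := by
  have h1 : gmul b (ginv c) ∈ A.csrc.carrier := h ▸ ⟨b, hb, c, hc, rfl⟩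
  obtain ⟨d, hd, e, he, k⟩ := h1
  rw [k]
  have e1 := A.src_eq
  have e2 := A.rng_eq
  rw [← gmul_assoc]
  · exact A.closed a ha d hd e he
  all_goals grind [src_inv, rng_inv]

/-- The pointwise product `AB` of composable cosets. -/
def cmulAux (A B : Coset G) (h : A.csrc = B.crng) : Coset G where
  carrier := {g | ∃ a ∈ A.carrier, ∃ b ∈ B.carrier, g = gmul a b}
  nonempty := let ⟨a, ha⟩ := A.nonempty; let ⟨b, hb⟩ := B.nonempty; ⟨_, a, ha, b, hb, rfl⟩
  src_eq := by
    have e2 := B.src_eq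
    rintro _ ⟨a, ha, b, hb, rfl⟩ _ ⟨c, hc, d, hd, rfl⟩
    grind [src_mul, src_eq_rng h ha hb, src_eq_rng h hc hd]
  rng_eq := by
    have e2 := A.rng_eq
    rintro _ ⟨a, ha, b, hb, rfl⟩ _ ⟨c, hc, d, hd, rfl⟩
    grind [rng_mul, src_eq_rng h ha hb, src_eq_rng h hc hd]
  closed := by
    rintro _ ⟨a, ha, b, hb, rfl⟩ _ ⟨c, hc, d, hd, rfl⟩ _ ⟨e, he, f, hf, rfl⟩
    refine ⟨_, A.closed _ (exists_left h ha hb hd) c hc e he, f, hf, ?_⟩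
    have e2 := A.rng_eq c hc e he
    have e3 := B.src_eq b hb d hd
    have k1 := src_eq_rng h ha hb
    have k2 := src_eq_rng h hc hd
    have k3 := src_eq_rng h he hf
    have l1 : src (ginv d) = rng (ginv c) := by rw [src_inv, rng_inv, k2]
    have l2 : src b = rng (ginv d) := by rw [rng_inv, e3]
    have l3 : src (ginv c) = rng e := by rw [src_inv, e2]
    have m1 : src (gmul b (ginv d)) = rng (ginv c) := by rw [src_mul _ _ l2, l1]
    have m2 : src a = rng (gmul b (ginv d)) := by rw [rng_mul _ _ l2, k1]
    rw [gpd_mul_inv_rev _ _ k2, gmul_assoc _ e f (by rw [src_mul _ _ (by rw [src_mul _ _ m2, m1]),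
      l3]) k3, ← gmul_assoc _ (ginv d) (ginv c) (by rw [src_mul _ _ k1, l2]) l1,
      gmul_assoc a b (ginv d) k1 l2]

open Classical in
/-- The product `AB`, with a junk value on pairs that are not composable. -/
def cmul (A B : Coset G) : Coset G :=
  if h : A.csrc = B.crng then cmulAux A B h else A

theorem cmul_of {A B : Coset G} (h : A.csrc = B.crng) : A.cmul B = cmulAux A B h := dif_pos h

theorem csrc_cinv (A : Coset G) : A.cinv.csrc = A.crng := by
  ext g
  constructor
  · rintro ⟨_, ⟨a, ha, rfl⟩, _, ⟨b, hb, rfl⟩, rfl⟩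
    exact ⟨a, ha, b, hb, by rw [gpd_inv_inv]⟩
  · rintro ⟨a, ha, b, hb, rfl⟩
    exact ⟨_, ⟨a, ha, rfl⟩, _, ⟨b, hb, rfl⟩, by rw [gpd_inv_inv]⟩

theorem crng_cinv (A : Coset G) : A.cinv.crng = A.csrc := by
  ext g
  constructor
  · rintro ⟨_, ⟨a, ha, rfl⟩, _, ⟨b, hb, rfl⟩, rfl⟩
    exact ⟨a, ha, b, hb, by rw [gpd_inv_inv]⟩
  · rintro ⟨a, ha, b, hb, rfl⟩
    exact ⟨_, ⟨a, ha, rfl⟩, _, ⟨b, hb, rfl⟩, by rw [gpd_inv_inv]⟩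

theorem crng_csrc (A : Coset G) : A.csrc.crng = A.csrc := by
  have e1 := A.src_eq
  have e2 := A.rng_eq
  ext g
  constructor
  · rintro ⟨_, ⟨a, ha, b, hb, rfl⟩, _, ⟨c, hc, d, hd, rfl⟩, rfl⟩
    refine ⟨a, ha, _, A.closed b hb d hd c hc, ?_⟩
    grind [gpd_mul_inv_rev, gpd_inv_inv, gmul_assoc, src_inv, rng_inv, src_mul, rng_mul]
  · rintro ⟨a, ha, b, hb, rfl⟩
    refine ⟨_, ⟨a, ha, b, hb, rfl⟩, _, ⟨b, hb, b, hb, rfl⟩, ?_⟩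
    have k : ginv (gmul (ginv b) b) = gmul (ginv b) b := by
      rw [gpd_mul_inv_rev _ _ (src_inv b), gpd_inv_inv]
    rw [k, ginv_gmul b, e1 b hb b hb]
    conv_rhs => rw [← src_mul (ginv a) b (by rw [src_inv, e2 a ha b hb])]
    rw [gmul_src]

theorem csrc_crng (A : Coset G) : A.crng.csrc = A.crng := by
  have h := crng_csrc A.cinv
  have k : A.crng.cinv = A.crng := by
    ext g
    have e1 := A.src_eq
    constructor
    · rintro ⟨_, ⟨a, ha, b, hb, rfl⟩, rfl⟩
      exact ⟨b, hb, a, ha, by rw [gpd_mul_inv_rev _ _ (by rw [rng_inv, e1 a ha b hb]),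
        gpd_inv_inv]⟩
    · rintro ⟨a, ha, b, hb, rfl⟩
      exact ⟨_, ⟨b, hb, a, ha, rfl⟩, by rw [gpd_mul_inv_rev _ _ (by rw [rng_inv, e1 a ha b hb]),
        gpd_inv_inv]⟩
  rw [csrc_cinv] at h
  rw [← crng_cinv, k, h]

theorem csrc_cmulAux (A B : Coset G) (h : A.csrc = B.crng) : (cmulAux A B h).csrc = B.csrc := by
  ext g
  constructor
  · rintro ⟨_, ⟨a, ha, b, hb, rfl⟩, _, ⟨c, hc, d, hd, rfl⟩, rfl⟩
    have h1 : gmul (ginv a) c ∈ B.crng.carrier := h ▸ ⟨a, ha, c, hc, rfl⟩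
    obtain ⟨e, he, f, hf, k⟩ := h1
    refine ⟨b, hb, _, B.closed e he f hf d hd, ?_⟩
    have e1 := A.src_eq
    have e2 := A.rng_eq
    have k1 := src_eq_rng h ha hb
    have k2 := src_eq_rng h hc hd
    rw [← k, gpd_mul_inv_rev _ _ k1]
    grind [gmul_assoc, src_inv, rng_inv, src_mul, rng_mul]
  · rintro ⟨b, hb, d, hd, rfl⟩
    obtain ⟨a, ha⟩ := A.nonempty
    refine ⟨_, ⟨a, ha, b, hb, rfl⟩, _, ⟨a, ha, d, hd, rfl⟩, ?_⟩
    have k1 := src_eq_rng h ha hb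
    have k2 := src_eq_rng h ha hd
    rw [gpd_mul_inv_rev _ _ k1, gmul_assoc _ _ _ (by rw [src_inv, rng_inv, k1])
      (by rw [src_inv, rng_mul _ _ k2]), gpd_inv_cancel_left _ _ k2]

theorem crng_cmulAux (A B : Coset G) (h : A.csrc = B.crng) : (cmulAux A B h).crng = A.crng := by
  have e1 := A.src_eq
  have e2 := A.rng_eq
  have e3 := B.src_eq
  have e4 := B.rng_eq
  ext g
  constructor
  · rintro ⟨_, ⟨a, ha, b, hb, rfl⟩, _, ⟨c, hc, d, hd, rfl⟩, rfl⟩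
    refine ⟨_, exists_left h ha hb hd, c, hc, ?_⟩
    have k1 := src_eq_rng h ha hb
    have k2 := src_eq_rng h hc hd
    rw [gpd_mul_inv_rev _ _ k2]
    grind [gmul_assoc, src_inv, rng_inv, src_mul, rng_mul]
  · rintro ⟨a, ha, c, hc, rfl⟩
    obtain ⟨b, hb⟩ := B.nonempty
    refine ⟨_, ⟨a, ha, b, hb, rfl⟩, _, ⟨c, hc, b, hb, rfl⟩, ?_⟩
    have k1 := src_eq_rng h ha hb
    have k2 := src_eq_rng h hc hb
    rw [gpd_mul_inv_rev _ _ k2, gmul_assoc _ _ _ k1 (by rw [rng_mul _ _ (by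
      rw [src_inv, rng_inv, k2]), rng_inv]), gpd_cancel_inv_left _ _ (by rw [rng_inv, k2])]

/-- The groupoid of all cosets of subgroups of isotropy groups, with pointwise operations. -/
instance : GroupoidArrows (Coset G) where
  src := csrc
  rng := crng
  ginv := cinv
  gmul := cmul
  src_inv := csrc_cinv
  rng_inv := crng_cinv
  src_mul A B h := by rw [cmul, dif_pos h, csrc_cmulAux]
  rng_mul A B h := by rw [cmul, dif_pos h, crng_cmulAux]
  gmul_assoc A B C h k := by
    have h1 : (cmulAux A B h).csrc = C.crng := by rw [csrc_cmulAux, k]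
    have h2 : A.csrc = (cmulAux B C k).crng := by rw [crng_cmulAux, h]
    rw [cmul_of h, cmul_of k, cmul_of h1, cmul_of h2]
    ext g
    constructor
    · rintro ⟨_, ⟨a, ha, b, hb, rfl⟩, c, hc, rfl⟩
      exact ⟨a, ha, _, ⟨b, hb, c, hc, rfl⟩,
        gmul_assoc _ _ _ (src_eq_rng h ha hb) (src_eq_rng k hb hc)⟩
    · rintro ⟨a, ha, _, ⟨b, hb, c, hc, rfl⟩, rfl⟩
      exact ⟨_, ⟨a, ha, b, hb, rfl⟩, c, hc,
        (gmul_assoc _ _ _ (src_eq_rng h ha hb) (src_eq_rng k hb hc)).symm⟩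
  ginv_gmul A := by
    rw [cmul, dif_pos (csrc_cinv A)]
    ext g
    constructor
    · rintro ⟨_, ⟨a, ha, rfl⟩, b, hb, rfl⟩
      exact ⟨a, ha, b, hb, rfl⟩
    · rintro ⟨a, ha, b, hb, rfl⟩
      exact ⟨_, ⟨a, ha, rfl⟩, b, hb, rfl⟩
  gmul_ginv A := by
    rw [cmul, dif_pos (crng_cinv A).symm]
    ext g
    constructor
    · rintro ⟨a, ha, _, ⟨b, hb, rfl⟩, rfl⟩
      exact ⟨a, ha, b, hb, rfl⟩
    · rintro ⟨a, ha, b, hb, rfl⟩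
      exact ⟨a, ha, _, ⟨b, hb, rfl⟩, rfl⟩
  gmul_src A := by
    rw [cmul, dif_pos (crng_csrc A).symm]
    have e1 := A.src_eq
    have e2 := A.rng_eq
    ext g
    constructor
    · rintro ⟨a, ha, _, ⟨b, hb, c, hc, rfl⟩, rfl⟩
      rw [← gmul_assoc _ _ _ (by rw [rng_inv, e1 a ha b hb]) (by rw [src_inv, e2 b hb c hc])]
      exact A.closed a ha b hb c hc
    · intro hg
      exact ⟨g, hg, _, ⟨g, hg, g, hg, rfl⟩, by rw [ginv_gmul, gmul_src]⟩
  rng_gmul A := by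
    rw [cmul, dif_pos (csrc_crng A)]
    ext g
    constructor
    · rintro ⟨_, ⟨a, ha, b, hb, rfl⟩, c, hc, rfl⟩
      exact A.closed a ha b hb c hc
    · intro hg
      exact ⟨_, ⟨g, hg, g, hg, rfl⟩, g, hg, by rw [gmul_ginv, rng_gmul]⟩

end Coset

/-! ### Étale groupoids -/

/-- An étale groupoid: a topological groupoid with locally compact Hausdorff unit space whose range
map is a local homeomorphism onto the unit space. The space `G` itself need not be Hausdorff. -/
class IsEtaleGroupoid (G : Type*) [TopologicalSpace G] [GroupoidArrows G] : Prop where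
  continuousOn_mul : ContinuousOn (fun p : G × G => gmul p.1 p.2) {p | src p.1 = rng p.2}
  continuous_inv : Continuous (ginv : G → G)
  t2_units : T2Space (units G)
  locallyCompact_units : LocallyCompactSpace (units G)
  isLocalHomeomorph_rng :
    IsLocalHomeomorph (fun g => ⟨rng g, gpd_src_rng g⟩ : G → units G)

section Convolution

variable {G : Type*} [TopologicalSpace G] [GroupoidArrows G]

/-- `U` is an open bisection of the subgroupoid `S` (with its subspace topology). -/
def IsOpenBisection (S U : Set G) : Prop :=
  (∃ V, IsOpen V ∧ U = V ∩ S) ∧ Set.InjOn src U ∧ Set.InjOn rng U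

/-- `𝒞_c(S)`: the span of the functions, extended by zero, that are continuous and compactly
supported on an open bisection of the subgroupoid `S`. -/
def convolutionAlgebra (S : Set G) : Submodule ℂ (G → ℂ) :=
  Submodule.span ℂ {f | ∃ U, IsOpenBisection S U ∧ ContinuousOn f U ∧
    ∃ K ⊆ U, IsCompact K ∧ ∀ g ∉ K, f g = 0}

/-- The Hilbert space `ℓ²(ι)`. -/
abbrev Ell2 (ι : Type*) : Type _ := lp (fun _ : ι => ℂ) 2

/-- The convolution `(f * ψ)(g) = ∑_{h ∈ S, s(h) = s(g)} f(g h⁻¹) ψ(h)`. -/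
def convolve (S : Set G) (f : G → ℂ) (ψ : S → ℂ) (g : S) : ℂ :=
  ∑' h : {h : S // src (h : G) = src (g : G)}, f (gmul g (ginv (h.1 : G))) * ψ h.1

open Classical in
/-- The operator `ψ ↦ f * ψ` on `ℓ²(S)`, bounded for `f ∈ 𝒞_c(S)`. Since `ℓ²(S)` is the Hilbert sum
of the spaces `ℓ²(S_x)`, `x ∈ S⁰`, this is the direct sum of the regular representations `λ_x`. -/
def leftRegular (S : Set G) (f : G → ℂ) : Ell2 S →L[ℂ] Ell2 S :=
  if h : ∃ T : Ell2 S →L[ℂ] Ell2 S, ∀ ψ : Ell2 S, ∀ g, T ψ g = convolve S f ψ g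
  then h.choose else 0

/-- The reduced norm `‖f‖_r = sup_x ‖λ_x(f)‖ = ‖⨁_x λ_x(f)‖` on `𝒞_c(S)`. -/
def reducedNorm (S : Set G) (f : G → ℂ) : ℝ := ‖leftRegular S f‖

/-- The reduction `S|_X` of `S` to a set `X` of units. -/
def reduction (S X : Set G) : Set G := {g ∈ S | src g ∈ X ∧ rng g ∈ X}

/-- `H` is a local groupoid about `S|_X`: an open subgroupoid of `S` for which `X` is invariant and
such that `H|_X = S|_X`. -/
structure IsLocalGroupoid (S X H : Set G) : Prop where
  isOpen : ∃ V, IsOpen V ∧ H = V ∩ S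
  inv_mem : ∀ g ∈ H, ginv g ∈ H
  mul_mem : ∀ g ∈ H, ∀ h ∈ H, src g = rng h → gmul g h ∈ H
  invariant : ∀ g ∈ H, src g ∈ X ↔ rng g ∈ X
  reduction_eq : reduction H X = reduction S X

/-- The largest local groupoid about `S|_X`. For a closed locally invariant set `X` of units of an
étale groupoid `S` it is the interior of `{g ∈ S | s(g) ∈ X ↔ r(g) ∈ X}`. -/
def localGroupoid (S X : Set G) : Set G := ⋃₀ {H | IsLocalGroupoid S X H}

/-- The norm `‖b‖_{r(X)}` on `𝒞_c(S|_X)`: the quotient norm for the restriction map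
`𝒞_c(H) → 𝒞_c(S|_X)`, where `H` is a local groupoid about `S|_X` and `𝒞_c(H) ⊆ 𝒞_c(S)` has the
reduced norm of `S`. (All local groupoids give the same norm.) -/
def restrictedNorm (S X : Set G) (b : G → ℂ) : ℝ :=
  sInf {t | ∃ f ∈ convolutionAlgebra (localGroupoid S X),
    Set.EqOn f b (reduction S X) ∧ t = reducedNorm S f}

end Convolution

/-! ### The reduced C*-algebra and the singular ideal -/

section Singular

variable (G : Type*) [TopologicalSpace G] [GroupoidArrows G]

/-- The reduced C*-algebra `C*_r(G)`: the norm closure of the convolution operators of `𝒞_c(G)` on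
`ℓ²(G) = ⨁_x ℓ²(G_x)`. -/
def reducedCStarAlgebra : Set (Ell2 (Set.univ : Set G) →L[ℂ] Ell2 (Set.univ : Set G)) :=
  closure (leftRegular Set.univ '' (convolutionAlgebra (Set.univ : Set G) : Set (G → ℂ)))

variable {G}

open Classical in
/-- An element `a` of `C*_r(G)` viewed as the function `g ↦ ⟨λ_{s(g)}(a) δ_{s(g)}, δ_g⟩` on `G`. -/
def toFunctionOnArrows (a : Ell2 (Set.univ : Set G) →L[ℂ] Ell2 (Set.univ : Set G)) (g : G) : ℂ :=
  a (lp.single 2 (⟨src g, trivial⟩ : (Set.univ : Set G)) (1 : ℂ)) ⟨g, trivial⟩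

variable (G)

/-- The singular ideal `J`: those `a ∈ C*_r(G)` for which `s({g | a(g) ≠ 0})` is meagre in `G⁰`. -/
def singularIdeal : Set (Ell2 (Set.univ : Set G) →L[ℂ] Ell2 (Set.univ : Set G)) :=
  {a ∈ reducedCStarAlgebra G |
    IsMeagre {u : units G | ∃ g : G, src g = u ∧ toFunctionOnArrows a g ≠ 0}}

/-- The set `D₀` of extremely dangerous points. -/
def extremelyDangerous : Set (units G) :=
  {x | ∃ (n : ℕ) (g : Fin n → G) (U : Fin n → Set G),
    (∀ i, src (g i) = x ∧ rng (g i) = x ∧ g i ≠ x ∧ IsOpenBisection Set.univ (U i) ∧ g i ∈ U i) ∧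
    ∃ V : Set (units G), IsOpen V ∧ x ∈ V ∧
      interior (V \ ⋃ i, ((↑) : units G → G) ⁻¹' U i) = ∅}

end Singular

/-! ### The essential Hausdorff cover -/

section Cover

variable {G : Type*} [TopologicalSpace G] [GroupoidArrows G]

/-- The Fell topology. In an étale groupoid every coset is a closed set of arrows, and conversely
every nonempty closed set in the Fell closure of the singletons is a coset. -/
instance : TopologicalSpace (Coset G) :=
  TopologicalSpace.generateFrom
    ({W | ∃ K : Set G, IsCompact K ∧ W = {A : Coset G | A.carrier ∩ K = ∅}} ∪
      {W | ∃ U : Set G, IsOpen U ∧ W = {A : Coset G | (A.carrier ∩ U).Nonempty}})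

variable (G)

/-- The Hausdorff units `C ⊆ G⁰`. -/
def hausdorffUnits : Set G := {x ∈ units G | ∀ h, h ≠ x → Disjoint (𝓝 x) (𝓝 h)}

/-- The Hausdorff cover `G̃`: the Fell closure of the singletons. -/
def hausdorffCover : Set (Coset G) := closure {A | ∃ g : G, A.carrier = {g}}

/-- The unit space `G̃⁰_ess` of the essential Hausdorff cover: the Fell closure of the singletons of
Hausdorff units. -/
def essUnits : Set (Coset G) := closure {A | ∃ x ∈ hausdorffUnits G, A.carrier = {x}}

/-- The essential Hausdorff cover `G̃_ess`, the reduction of `G̃` to `G̃⁰_ess`. -/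
def essCover : Set (Coset G) := reduction (hausdorffCover G) (essUnits G)

variable {G}

/-- The fibre `π_ess⁻¹(x)`, where `π(X)` is the unique element of `X ∩ G⁰`. -/
def essFibre (x : units G) : Set (Coset G) := {A ∈ essUnits G | A.carrier ∩ units G = {(x : G)}}

/-- The coset groupoid `Gˣₓ · π_ess⁻¹(x)`: the reduction of `G̃_ess` to `π_ess⁻¹(x)`, which consists
of the cosets `gX` with `g ∈ Gˣₓ` and `X ∈ π_ess⁻¹(x)`. -/
def cosetGroupoid (x : units G) : Set (Coset G) := reduction (essCover G) (essFibre x)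

/-- The fibre `π_ess⁻¹(x)` as a set of subgroups of `Gˣₓ`. -/
def essSubgroups (x : units G) : Set (Subgroup (Isotropy x)) :=
  {X | ∃ A ∈ essFibre x, A.carrier = Subtype.val '' (X : Set (Isotropy x))}

/-- The norms `r(π_ess⁻¹(x))` and `r` agree on `C_c(Gˣₓ · π_ess⁻¹(x))`. -/
def FibreNormIsReduced (x : units G) : Prop :=
  ∀ b ∈ convolutionAlgebra (cosetGroupoid x),
    restrictedNorm (essCover G) (essFibre x) b = reducedNorm (cosetGroupoid x) b

open Classical in
/-- The function `q(a)(Y) = ∑_{y ∈ Y} a(y)` on cosets, for `a ∈ ℂ[Gˣₓ]`. -/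
def cosetSum {x : units G} (a : MonoidAlgebra ℂ (Isotropy x)) (Y : Coset G) : ℂ :=
  a.coeff.sum fun g c => if g.1 ∈ Y.carrier then c else 0

end Cover

/-! ### Seminorms on group algebras and their completions -/

section Completion

variable {A : Type*} [AddCommGroup A] [Module ℂ A]

open Classical in
/-- A function satisfying the axioms of a seminorm, as a `Seminorm` (and `0` for other functions). -/
def seminormOfFun (N : A → ℝ) : Seminorm ℂ A :=
  if h : (∀ a b, N (a + b) ≤ N a + N b) ∧ ∀ (c : ℂ) a, N (c • a) = ‖c‖ * N a
  then Seminorm.of N h.1 h.2 else 0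

/-- The space `A` equipped with the seminorm `p`. -/
def WithSeminorm (_p : Seminorm ℂ A) : Type _ := A

instance (p : Seminorm ℂ A) : AddCommGroup (WithSeminorm p) := inferInstanceAs (AddCommGroup A)

instance (p : Seminorm ℂ A) : SeminormedAddCommGroup (WithSeminorm p) :=
  AddGroupSeminorm.toSeminormedAddCommGroup (E := WithSeminorm p) p.toAddGroupSeminorm

/-- The Hausdorff completion `C*_p` of `A` for the seminorm `p`. -/
abbrev SeminormCompletion (p : Seminorm ℂ A) : Type _ := UniformSpace.Completion (WithSeminorm p)

/-- For `q ≤ p`, the canonical map `C*_p → C*_q` extending the identity of `A`. -/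
def completionMap (p q : Seminorm ℂ A) : SeminormCompletion p → SeminormCompletion q :=
  UniformSpace.Completion.map (fun a : WithSeminorm p => (show WithSeminorm q from (a : A)))

/-- For `q ≤ p`, the kernel of the canonical map `C*_p → C*_q`. -/
def completionKernel (p q : Seminorm ℂ A) : Set (SeminormCompletion p) :=
  {z | completionMap p q z = 0}

end Completion

/-! ### Unitary representations -/

section Representations

theorem memℓp_comp_equiv {Ω : Type*} (e : Ω ≃ Ω) (ψ : Ell2 Ω) :
    Memℓp (fun ω => (ψ : Ω → ℂ) (e ω)) 2 := by
  have h : Summable fun ω => ‖(ψ : Ω → ℂ) ω‖ ^ (2 : ℝ≥0∞).toReal :=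
    (lp.memℓp ψ).summable (by norm_num)
  exact memℓp_gen (h.comp_injective e.injective)

/-- The unitary `ψ ↦ ψ ∘ e` of `ℓ²(Ω)` for a permutation `e` of `Ω`. -/
def ell2Perm {Ω : Type*} (e : Ω ≃ Ω) : Ell2 Ω ≃ₗᵢ[ℂ] Ell2 Ω where
  toFun ψ := ⟨fun ω => (ψ : Ω → ℂ) (e ω), memℓp_comp_equiv e ψ⟩
  invFun ψ := ⟨fun ω => (ψ : Ω → ℂ) (e.symm ω), memℓp_comp_equiv e.symm ψ⟩
  map_add' _ _ := rfl
  map_smul' _ _ := rfl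
  left_inv ψ := lp.ext (funext fun ω => congrArg (ψ : Ω → ℂ) (e.apply_symm_apply ω))
  right_inv ψ := lp.ext (funext fun ω => congrArg (ψ : Ω → ℂ) (e.symm_apply_apply ω))
  norm_map' ψ := by
    rw [lp.norm_eq_tsum_rpow (by norm_num), lp.norm_eq_tsum_rpow (by norm_num)]
    exact congrArg (fun t : ℝ => t ^ (1 / (2 : ℝ≥0∞).toReal))
      (e.tsum_eq (fun ω => ‖(ψ : Ω → ℂ) ω‖ ^ (2 : ℝ≥0∞).toReal))

/-- The unitary representation of `Γ` on `ℓ²(Ω)` given by an action on `Ω`: it maps `δ_ω` to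
`δ_{γω}`, that is, `(γψ)(ω) = ψ(γ⁻¹ω)`. -/
def permutationRep (Γ Ω : Type*) [Group Γ] [MulAction Γ Ω] : Γ →* (Ell2 Ω ≃ₗᵢ[ℂ] Ell2 Ω) where
  toFun γ := ell2Perm (MulAction.toPerm γ⁻¹)
  map_one' := LinearIsometryEquiv.ext fun ψ => lp.ext (funext fun ω =>
    congrArg (ψ : Ω → ℂ) (show (1 : Γ)⁻¹ • ω = ω by rw [inv_one, one_smul]))
  map_mul' γ δ := LinearIsometryEquiv.ext fun ψ => lp.ext (funext fun ω =>
    congrArg (ψ : Ω → ℂ) (show (γ * δ)⁻¹ • ω = δ⁻¹ • γ⁻¹ • ω by rw [mul_inv_rev, mul_smul]))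

/-- The Hilbert direct sum of unitary representations. -/
def directSumRep {Γ : Type*} [Group Γ] {I : Type*} {H : I → Type*}
    [∀ i, NormedAddCommGroup (H i)] [∀ i, InnerProductSpace ℂ (H i)]
    (ρ : ∀ i, Γ →* (H i ≃ₗᵢ[ℂ] H i)) : Γ →* (lp H 2 ≃ₗᵢ[ℂ] lp H 2) where
  toFun γ :=
    { toFun := fun ψ => ⟨fun i => ρ i γ (ψ i), memℓp_gen
        (by simpa only [LinearIsometryEquiv.norm_map] using ψ.2.summable (by norm_num))⟩
      invFun := fun ψ => ⟨fun i => ρ i γ⁻¹ (ψ i), memℓp_gen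
        (by simpa only [LinearIsometryEquiv.norm_map] using ψ.2.summable (by norm_num))⟩
      map_add' := fun φ ψ => lp.ext (funext fun i => map_add (ρ i γ) (φ i) (ψ i))
      map_smul' := fun c ψ => lp.ext (funext fun i => map_smul (ρ i γ) c (ψ i))
      left_inv := fun ψ => lp.ext (funext fun i => by
        change (ρ i γ⁻¹ * ρ i γ) (ψ i) = ψ i
        rw [← map_mul, inv_mul_cancel, map_one]; rfl)
      right_inv := fun ψ => lp.ext (funext fun i => by
        change (ρ i γ * ρ i γ⁻¹) (ψ i) = ψ i
        rw [← map_mul, mul_inv_cancel, map_one]; rfl)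
      norm_map' := fun ψ => by
        rw [lp.norm_eq_tsum_rpow (by norm_num), lp.norm_eq_tsum_rpow (by norm_num)]
        exact congrArg (fun t : I → ℝ => (∑' i, t i) ^ _) (funext fun i =>
          congrArg (· ^ _) ((ρ i γ).norm_map (ψ i))) }
  map_one' := LinearIsometryEquiv.ext fun ψ => lp.ext (funext fun i =>
    congrArg (fun T : H i ≃ₗᵢ[ℂ] H i => T (ψ i)) (map_one (ρ i)))
  map_mul' γ δ := LinearIsometryEquiv.ext fun ψ => lp.ext (funext fun i =>
    congrArg (fun T : H i ≃ₗᵢ[ℂ] H i => T (ψ i)) (map_mul (ρ i) γ δ))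

variable {Γ : Type*} [Group Γ]

/-- Weak containment `π ≺ ρ` of unitary representations of a discrete group: on finite sets, every
function of positive type associated with `π` is a uniform limit of finite sums of functions of
positive type associated with `ρ`. -/
def WeaklyContained {H K : Type*} [NormedAddCommGroup H] [InnerProductSpace ℂ H]
    [NormedAddCommGroup K] [InnerProductSpace ℂ K]
    (π : Γ →* (H ≃ₗᵢ[ℂ] H)) (ρ : Γ →* (K ≃ₗᵢ[ℂ] K)) : Prop :=
  ∀ (ξ : H) (Q : Finset Γ) (ε : ℝ), 0 < ε → ∃ (n : ℕ) (η : Fin n → K),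
    ∀ γ ∈ Q, ‖inner ℂ ξ (π γ ξ) - ∑ i, inner ℂ (η i) (ρ γ (η i))‖ < ε

/-- The left regular representation `λ_Γ` on `ℓ²(Γ)`. -/
def regularRep (Γ : Type*) [Group Γ] : Γ →* (Ell2 Γ ≃ₗᵢ[ℂ] Ell2 Γ) := permutationRep Γ Γ

/-- The quasi-regular representation `λ_{Γ/X}` on `ℓ²(Γ/X)`. -/
def quasiRegularRep (X : Subgroup Γ) : Γ →* (Ell2 (Γ ⧸ X) ≃ₗᵢ[ℂ] Ell2 (Γ ⧸ X)) :=
  permutationRep Γ (Γ ⧸ X)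

/-- The seminorm `a ↦ ‖π(a)‖` on `ℂ[Γ]`. -/
def repSeminorm {H : Type*} [NormedAddCommGroup H] [InnerProductSpace ℂ H]
    (π : Γ →* (H ≃ₗᵢ[ℂ] H)) : Seminorm ℂ (MonoidAlgebra ℂ Γ) :=
  (normSeminorm ℂ (H →L[ℂ] H)).comp (MonoidAlgebra.lift ℂ (H →L[ℂ] H) Γ
    { toFun := fun γ => ((π γ).toContinuousLinearEquiv : H →L[ℂ] H)
      map_one' := by rw [map_one]; rfl
      map_mul' := fun γ δ => by rw [map_mul]; rfl }).toLinearMap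

/-- The reduced norm `r` on `ℂ[Γ]`. -/
def groupReducedNorm (Γ : Type*) [Group Γ] : Seminorm ℂ (MonoidAlgebra ℂ Γ) :=
  repSeminorm (regularRep Γ)

/-- The seminorm `r𝒳` on `ℂ[Γ]`: the supremum of the norms `‖λ_{Γ/X}(a)‖`, `X ∈ 𝒳`. -/
def cosetSeminorm (𝒳 : Set (Subgroup Γ)) : Seminorm ℂ (MonoidAlgebra ℂ Γ) :=
  ⨆ X : 𝒳, repSeminorm (quasiRegularRep X.1)

/-- The ideal `J_{Γ,𝒳}`: the kernel of `C*_{r𝒳̂}(Γ) → C*_{r𝒳}(Γ)`, where `𝒳̂ = 𝒳 ∪ {{e}}`. -/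
def groupIdeal (𝒳 : Set (Subgroup Γ)) : Set (SeminormCompletion (cosetSeminorm (insert ⊥ 𝒳))) :=
  completionKernel (cosetSeminorm (insert ⊥ 𝒳)) (cosetSeminorm 𝒳)

open Classical in
/-- Amenability of a discrete group, in the form of the Følner condition. -/
def IsAmenableGroup (Γ : Type*) [Group Γ] : Prop :=
  ∀ (K : Finset Γ) (ε : ℝ), 0 < ε → ∃ F : Finset Γ, F.Nonempty ∧
    ∀ k ∈ K, ((symmDiff (F.image (k * ·)) F).card : ℝ) ≤ ε * F.card

end Representations

/-! ### The isotropy fibres -/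

section Fibres

variable {G : Type*} [TopologicalSpace G] [GroupoidArrows G]

/-- The seminorm `r(𝒳)` on `ℂ[Gˣₓ]`, `𝒳 = π_ess⁻¹(x)`: it is `a ↦ ‖q(a)‖_{r(𝒳)}`. -/
def fibreSeminorm (x : units G) : Seminorm ℂ (MonoidAlgebra ℂ (Isotropy x)) :=
  seminormOfFun fun a => restrictedNorm (essCover G) (essFibre x) (cosetSum a)

/-- The norm `max (r(𝒳), r)` on `ℂ[Gˣₓ]`. -/
def fibreSeminormHat (x : units G) : Seminorm ℂ (MonoidAlgebra ℂ (Isotropy x)) :=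
  fibreSeminorm x ⊔ groupReducedNorm (Isotropy x)

/-- The kernel of the canonical map from the completion of `ℂ[Gˣₓ]` for `max (r(𝒳), r)` to the
completion for `r(𝒳)`. -/
def fibreKernel (x : units G) : Set (SeminormCompletion (fibreSeminormHat x)) :=
  completionKernel (fibreSeminormHat x) (fibreSeminorm x)

/-- The representation `⨁_{X ∈ π_ess⁻¹(x)} λ_{Gˣₓ/X}`. -/
def fibreRep (x : units G) : Isotropy x →*
    (lp (fun X : essSubgroups x => Ell2 (Isotropy x ⧸ X.1)) 2 ≃ₗᵢ[ℂ]
      lp (fun X : essSubgroups x => Ell2 (Isotropy x ⧸ X.1)) 2) :=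
  directSumRep fun X : essSubgroups x => quasiRegularRep X.1

end Fibres

end

/-!
The norms involved are all norms of matrices: `𝒞_c` of an étale groupoid acts on `ℓ²` by the
matrices `f(g h⁻¹)`, and `KerBound` expresses a bound for such a matrix through its finite blocks.
Two facts carry the proof. Since finite blocks pass to limits, the reduced norm of the essential
Hausdorff cover is computed by the regular representations of `G` at the Hausdorff units, which are
dense in its unit space (`kerBound_essCover`, `reducedNorm_essLift`; `Coset.sing` embeds the arrows
of `G` in the space of cosets). And a function on the cover that vanishes on the fibre over `x`
becomes small in norm when it is cut off near `x` (`exists_nhds_kerBound_cut`), so that `r(𝒳_x)` is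
a limit of norms of cut-off functions.

*The singular ideal.* As `G` is covered by countably many bisections, the non-Hausdorff units are
meagre, and by Baire category the singular elements are those that vanish on all arrows with
Hausdorff source (`mem_singularIdeal_iff`). If
`J = 0`, the representation of `C*_r(G)` at the Hausdorff units is injective, hence isometric; on
functions cut off near `x` this says that the reduced norm of `ℂ[Gˣₓ]` is dominated by `r(𝒳_x)`
(`groupReducedNorm_le_fibreSeminorm`), and the kernel at `x` is the kernel of an identity map. If
`J ≠ 0`, some singular `b` is nonzero at a unit `x`, which is then extremely dangerous
(`mem_extremelyDangerous_of_singularIdeal`); functions in `𝒞_c(G)` approximating `b` restrict to a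
sequence in `ℂ[Gˣₓ]` that is Cauchy for `max (r(𝒳_x), r)`, null for `r(𝒳_x)`, and has coefficients at
the identity tending to `b(x) ≠ 0`: the kernel at `x` is not zero. Together these give
`singularIdeal_eq_iff_fibreKernel`.

*Groups.* The reduced norm of the coset groupoid, transported to `ℂ[Gˣₓ]`, is the supremum of the
norms in the quasi-regular representations (`reducedNorm_cosetGroupoid`), so if it equals
`r(𝒳_x)` the kernel at `x` is `J_{Gˣₓ, 𝒳_x}`. This ideal vanishes if and only if the reduced norm is
dominated by the norm in `⨁ λ_{Γ/X}`, because a star homomorphism with zero kernel is isometric, and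
domination of norms is weak containment, by a Hahn–Banach separation in a finite-dimensional space
(`groupIdeal_eq_iff_weaklyContained`).

*Amenability.* Let `f` on `G̃_ess` extend `b` on the coset groupoid. The block of the matrix of `f` on
a fixed finite number of bisections through arrows of `Gˣₓ`, at Hausdorff units close to `x`, is
almost a block of the matrix of `b` (`eventually_kerBound_block`), but the whole matrix of a cut-off
of `f` is not a limit of finite blocks of bounded size. A Følner set of `Gˣₓ` provides a slowly
varying partition into blocks of bounded size (`KerBound.overlap_mul`, `abs_one_sub_overlap_le`),
with the group replaced by local sections through its elements. Hence `r(𝒳_x)` is at most the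
reduced norm (`fibreNormIsReduced_of_isAmenable`); the converse inequality always holds, the fibre
being a closed invariant set of units for a local groupoid.
-/

noncomputable section

open GroupoidArrows

/-! ### Norms of infinite matrices -/

/-- The matrix `k`, restricted to rows and columns in `S`, has norm at most `c` on `ℓ²`; this is
tested on finitely supported vectors. -/
def KerBound {ι : Type*} (k : ι → ι → ℂ) (S : Set ι) (c : ℝ) : Prop :=
  ∀ F : Finset ι, (F : Set ι) ⊆ S → ∀ u v : ι → ℂ,
    ‖∑ i ∈ F, ∑ j ∈ F, u i * k i j * v j‖ ≤ c * √(∑ i ∈ F, ‖u i‖ ^ 2) * √(∑ i ∈ F, ‖v i‖ ^ 2)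

namespace KerBound

variable {ι κ : Type*} {k k₁ k₂ : ι → ι → ℂ} {S : Set ι} {c d : ℝ}

theorem congr (h : KerBound k₁ S c) (e : ∀ i ∈ S, ∀ j ∈ S, k₂ i j = k₁ i j) : KerBound k₂ S c := by
  intro F hF u v
  have : ∑ i ∈ F, ∑ j ∈ F, u i * k₂ i j * v j = ∑ i ∈ F, ∑ j ∈ F, u i * k₁ i j * v j :=
    Finset.sum_congr rfl fun i hi => Finset.sum_congr rfl fun j hj => by rw [e i (hF hi) j (hF hj)]
  rw [this]
  exact h F hF u v

theorem mono (h : KerBound k S c) {T : Set ι} (hT : T ⊆ S) : KerBound k T c :=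
  fun F hF => h F (hF.trans hT)

theorem mono_const (h : KerBound k S c) (hd : c ≤ d) : KerBound k S d := fun F hF u v =>
  (h F hF u v).trans (by gcongr)

theorem add (h₁ : KerBound k₁ S c) (h₂ : KerBound k₂ S d) :
    KerBound (fun i j => k₁ i j + k₂ i j) S (c + d) := by
  intro F hF u v
  have : ∑ i ∈ F, ∑ j ∈ F, u i * (k₁ i j + k₂ i j) * v j
      = ∑ i ∈ F, ∑ j ∈ F, u i * k₁ i j * v j + ∑ i ∈ F, ∑ j ∈ F, u i * k₂ i j * v j := by
    rw [← Finset.sum_add_distrib]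
    refine Finset.sum_congr rfl fun i _ => ?_
    rw [← Finset.sum_add_distrib]
    exact Finset.sum_congr rfl fun j _ => by ring
  rw [this, add_mul, add_mul]
  exact (norm_add_le _ _).trans (add_le_add (h₁ F hF u v) (h₂ F hF u v))

theorem zero (hc : 0 ≤ c) : KerBound (fun _ _ : ι => (0 : ℂ)) S c := by
  intro F _ u v
  simp only [mul_zero, zero_mul, Finset.sum_const_zero, norm_zero]
  positivity

theorem sum {n : ℕ} {k : Fin n → ι → ι → ℂ} (h : ∀ m, KerBound (k m) S c) :
    KerBound (fun i j => ∑ m, k m i j) S (n * c) := by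
  induction n with
  | zero => simpa using zero (S := S) (le_refl (0 : ℝ))
  | succ n ih =>
    simp_rw [Fin.sum_univ_castSucc]
    push_cast
    rw [add_mul, one_mul]
    exact (ih fun m => h _).add (h _)

theorem entry_le (h : KerBound k S c) {i : ι} (hi : i ∈ S) : ‖k i i‖ ≤ c := by
  simpa using h {i} (by simpa using hi) 1 1

theorem mul_diag (h : KerBound k S c) (hc : 0 ≤ c) {a b : ι → ℂ} (ha : ∀ i, ‖a i‖ ≤ 1)
    (hb : ∀ i, ‖b i‖ ≤ 1) : KerBound (fun i j => a i * k i j * b j) S c := by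
  intro F hF u v
  have := h F hF (fun i => u i * a i) (fun j => b j * v j)
  simp only [mul_assoc] at this ⊢
  refine this.trans ?_
  gcongr with i _ i _
  · rw [norm_mul]; exact mul_le_of_le_one_right (norm_nonneg _) (ha i)
  · rw [norm_mul]; exact mul_le_of_le_one_left (norm_nonneg _) (hb i)

theorem of_forall_pos (h : ∀ ε > 0, KerBound k S (c + ε)) : KerBound k S c := by
  intro F hF u v
  refine le_of_forall_pos_le_add fun δ hδ => ?_
  set a := √(∑ i ∈ F, ‖u i‖ ^ 2)
  set b := √(∑ i ∈ F, ‖v i‖ ^ 2)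
  have ha : 0 ≤ a := Real.sqrt_nonneg _
  have hb : 0 ≤ b := Real.sqrt_nonneg _
  have hab : 0 < a * b + 1 := by positivity
  refine (h (δ / (a * b + 1)) (by positivity) F hF u v).trans ?_
  have : δ / (a * b + 1) * (a * b) ≤ δ := by
    rw [div_mul_eq_mul_div, div_le_iff₀ hab]
    nlinarith
  nlinarith

/-- If a finite block of `k` is within `η` of the block of `k'` given by an injection of the index
set, its norm exceeds the bound for `k'` by at most `η` times its size. -/
theorem block_le {k' : κ → κ → ℂ} {S' : Set κ} (h : KerBound k' S' c) {F : Finset ι} {η : ℝ}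
    (σ : ι → κ) (hσ : Set.InjOn σ F) (hS : ∀ i ∈ F, σ i ∈ S')
    (hη : ∀ i ∈ F, ∀ j ∈ F, ‖k i j - k' (σ i) (σ j)‖ ≤ η) (u v : ι → ℂ) :
    ‖∑ i ∈ F, ∑ j ∈ F, u i * k i j * v j‖ ≤
      (c + F.card * η) * √(∑ i ∈ F, ‖u i‖ ^ 2) * √(∑ i ∈ F, ‖v i‖ ^ 2) := by
  classical
  rcases isEmpty_or_nonempty ι with hι | hι
  · simp [Finset.eq_empty_of_isEmpty F]
  set τ := Function.invFunOn σ (F : Set ι)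
  have hτ : ∀ i ∈ F, τ (σ i) = i := fun i hi => hσ.leftInvOn_invFunOn hi
  have h1 := h (F.image σ) (by
    intro x hx
    obtain ⟨i, hi, rfl⟩ := Finset.mem_image.1 (Finset.mem_coe.1 hx)
    exact hS i hi) (u ∘ τ) (v ∘ τ)
  have r : ∀ f : κ → ℂ, ∑ p ∈ F.image σ, f p = ∑ i ∈ F, f (σ i) := fun f => Finset.sum_image hσ
  have r' : ∀ f : κ → ℝ, ∑ p ∈ F.image σ, f p = ∑ i ∈ F, f (σ i) := fun f => Finset.sum_image hσ
  have e1 : ∀ w : ι → ℂ, ∑ i ∈ F, ‖w (τ (σ i))‖ ^ 2 = ∑ i ∈ F, ‖w i‖ ^ 2 := fun w =>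
    Finset.sum_congr rfl fun i hi => by rw [hτ i hi]
  have e2 : ∑ i ∈ F, ∑ j ∈ F, u (τ (σ i)) * k' (σ i) (σ j) * v (τ (σ j))
      = ∑ i ∈ F, ∑ j ∈ F, u i * k' (σ i) (σ j) * v j :=
    Finset.sum_congr rfl fun i hi => Finset.sum_congr rfl fun j hj => by rw [hτ i hi, hτ j hj]
  simp only [r, r', Function.comp_apply, e1, e2] at h1
  have e3 : ∑ i ∈ F, ∑ j ∈ F, u i * k i j * v j =
      ∑ i ∈ F, ∑ j ∈ F, u i * k' (σ i) (σ j) * v j +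
      ∑ i ∈ F, ∑ j ∈ F, u i * (k i j - k' (σ i) (σ j)) * v j := by
    rw [← Finset.sum_add_distrib]
    refine Finset.sum_congr rfl fun i _ => ?_
    rw [← Finset.sum_add_distrib]
    exact Finset.sum_congr rfl fun j _ => by ring
  have cs : ∀ w : ι → ℂ, ∑ i ∈ F, ‖w i‖ ≤ √F.card * √(∑ i ∈ F, ‖w i‖ ^ 2) := by
    intro w
    have := Real.sum_sqrt_mul_sqrt_le F (f := fun _ => (1 : ℝ)) (g := fun i => ‖w i‖ ^ 2)
      (fun _ => zero_le_one) (fun _ => by positivity)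
    simpa [Real.sqrt_sq (norm_nonneg _)] using this
  rcases F.eq_empty_or_nonempty with rfl | ⟨i₀, hi₀⟩
  · simp
  have hη0 : 0 ≤ η := (norm_nonneg _).trans (hη i₀ hi₀ i₀ hi₀)
  have h2 : ‖∑ i ∈ F, ∑ j ∈ F, u i * (k i j - k' (σ i) (σ j)) * v j‖ ≤
      F.card * η * √(∑ i ∈ F, ‖u i‖ ^ 2) * √(∑ i ∈ F, ‖v i‖ ^ 2) := by
    calc _ ≤ ∑ i ∈ F, ∑ j ∈ F, ‖u i‖ * η * ‖v j‖ := by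
          refine (norm_sum_le _ _).trans (Finset.sum_le_sum fun i hi => ?_)
          refine (norm_sum_le _ _).trans (Finset.sum_le_sum fun j hj => ?_)
          rw [norm_mul, norm_mul]
          gcongr
          exact hη i hi j hj
      _ = η * (∑ i ∈ F, ‖u i‖) * ∑ j ∈ F, ‖v j‖ := by
          rw [mul_assoc, Finset.sum_mul, Finset.mul_sum]
          refine Finset.sum_congr rfl fun i _ => ?_
          rw [Finset.mul_sum, Finset.mul_sum]
          exact Finset.sum_congr rfl fun j _ => by ring
      _ ≤ η * (√F.card * √(∑ i ∈ F, ‖u i‖ ^ 2)) * (√F.card * √(∑ i ∈ F, ‖v i‖ ^ 2)) := by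
          gcongr
          · exact cs u
          · exact cs v
      _ = (√F.card * √F.card) * η * √(∑ i ∈ F, ‖u i‖ ^ 2) * √(∑ i ∈ F, ‖v i‖ ^ 2) := by ring
      _ = _ := by rw [Real.mul_self_sqrt (Nat.cast_nonneg _)]
  rw [e3, add_mul, add_mul]
  exact (norm_add_le _ _).trans (add_le_add h1 h2)

theorem of_embedding {k' : κ → κ → ℂ} {S' : Set κ} (h : KerBound k' S' c) (σ : ι → κ)
    (hσ : Set.InjOn σ S) (hS : Set.MapsTo σ S S')
    (hk : ∀ i ∈ S, ∀ j ∈ S, k i j = k' (σ i) (σ j)) : KerBound k S c := by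
  intro F hF u v
  have := h.block_le (k := k) (η := 0) σ (hσ.mono hF) (fun i hi => hS (hF hi))
    (fun i hi j hj => by rw [hk i (hF hi) j (hF hj)]; simp) u v
  simpa using this

/-- The norm of a matrix that is block diagonal for the partition by `l` is bounded by a common
bound for its blocks. -/
theorem of_fibres {τ : Type*} (l : ι → τ) (hl : ∀ i ∈ S, ∀ j ∈ S, l i ≠ l j → k i j = 0)
    (hc : 0 ≤ c) (h : ∀ t, KerBound k {i ∈ S | l i = t} c) : KerBound k S c := by
  classical
  intro F hF u v
  have e1 : ∑ i ∈ F, ∑ j ∈ F, u i * k i j * v j =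
      ∑ t ∈ F.image l, ∑ i ∈ F with l i = t, ∑ j ∈ F with l j = t, u i * k i j * v j := by
    rw [← Finset.sum_fiberwise_of_maps_to (s := F) (t := F.image l) (g := l)
      (fun i hi => Finset.mem_image_of_mem l hi)]
    refine Finset.sum_congr rfl fun t _ => Finset.sum_congr rfl fun i hi => ?_
    rw [Finset.mem_filter] at hi
    symm
    refine Finset.sum_subset (Finset.filter_subset _ _) fun j hj hj' => ?_
    rw [Finset.mem_filter, not_and] at hj'
    rw [hl i (hF hi.1) j (hF hj) (by rw [hi.2]; exact fun e => hj' hj e.symm), mul_zero, zero_mul]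
  have e2 : ∀ w : ι → ℂ, ∑ i ∈ F, ‖w i‖ ^ 2 =
      ∑ t ∈ F.image l, ∑ i ∈ F with l i = t, ‖w i‖ ^ 2 := fun w =>
    (Finset.sum_fiberwise_of_maps_to (fun i hi => Finset.mem_image_of_mem l hi) _).symm
  rw [e1, e2 u, e2 v]
  calc _ ≤ ∑ t ∈ F.image l, c * √(∑ i ∈ F with l i = t, ‖u i‖ ^ 2) *
        √(∑ i ∈ F with l i = t, ‖v i‖ ^ 2) := by
        refine (norm_sum_le _ _).trans (Finset.sum_le_sum fun t _ => ?_)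
        refine h t _ (fun i hi => ?_) u v
        rw [Finset.mem_coe, Finset.mem_filter] at hi
        exact ⟨hF hi.1, hi.2⟩
    _ = c * ∑ t ∈ F.image l, √(∑ i ∈ F with l i = t, ‖u i‖ ^ 2) *
        √(∑ i ∈ F with l i = t, ‖v i‖ ^ 2) := by
        rw [Finset.mul_sum]
        exact Finset.sum_congr rfl fun _ _ => by ring
    _ ≤ _ := by
        rw [mul_assoc]
        gcongr
        exact Real.sum_sqrt_mul_sqrt_le _ (fun _ => by positivity) (fun _ => by positivity)

/-- A matrix with at most one nonzero entry in each row and each column has the supremum of the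
norms of its entries as norm. -/
theorem of_partialInjection (hc : 0 ≤ c) (hk : ∀ i ∈ S, ∀ j ∈ S, ‖k i j‖ ≤ c)
    (h₁ : ∀ i ∈ S, ∀ j ∈ S, ∀ j' ∈ S, k i j ≠ 0 → k i j' ≠ 0 → j = j')
    (h₂ : ∀ i ∈ S, ∀ i' ∈ S, ∀ j ∈ S, k i j ≠ 0 → k i' j ≠ 0 → i = i') : KerBound k S c := by
  classical
  intro F hF u v
  set R := (F ×ˢ F).filter fun p => k p.1 p.2 ≠ 0
  have hR : ∀ p ∈ R, p.1 ∈ F ∧ p.2 ∈ F ∧ k p.1 p.2 ≠ 0 := fun p hp => by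
    simpa [R, and_assoc] using hp
  have b1 : ∀ w : ι → ℂ, ∑ p ∈ R, ‖w p.1‖ ^ 2 ≤ ∑ i ∈ F, ‖w i‖ ^ 2 := by
    intro w
    have inj : Set.InjOn Prod.fst (R : Set (ι × ι)) := by
      rintro ⟨i, j⟩ hp ⟨i', j'⟩ hq (rfl : i = i')
      obtain ⟨a, b, e⟩ := hR _ hp
      obtain ⟨a', b', e'⟩ := hR _ hq
      exact Prod.ext rfl (h₁ _ (hF a) _ (hF b) _ (hF b') e e')
    rw [← Finset.sum_image (f := fun i => ‖w i‖ ^ 2) inj]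
    refine Finset.sum_le_sum_of_subset_of_nonneg (fun i hi => ?_) fun _ _ _ => by positivity
    obtain ⟨p, hp, rfl⟩ := Finset.mem_image.1 hi
    exact (hR p hp).1
  have b2 : ∀ w : ι → ℂ, ∑ p ∈ R, ‖w p.2‖ ^ 2 ≤ ∑ i ∈ F, ‖w i‖ ^ 2 := by
    intro w
    have inj : Set.InjOn Prod.snd (R : Set (ι × ι)) := by
      rintro ⟨i, j⟩ hp ⟨i', j'⟩ hq (rfl : j = j')
      obtain ⟨a, b, e⟩ := hR _ hp
      obtain ⟨a', b', e'⟩ := hR _ hq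
      exact Prod.ext (h₂ _ (hF a) _ (hF a') _ (hF b) e e') rfl
    rw [← Finset.sum_image (f := fun i => ‖w i‖ ^ 2) inj]
    refine Finset.sum_le_sum_of_subset_of_nonneg (fun i hi => ?_) fun _ _ _ => by positivity
    obtain ⟨p, hp, rfl⟩ := Finset.mem_image.1 hi
    exact (hR p hp).2.1
  have e1 : ∑ i ∈ F, ∑ j ∈ F, u i * k i j * v j = ∑ p ∈ R, u p.1 * k p.1 p.2 * v p.2 := by
    rw [← Finset.sum_product', Finset.sum_filter_of_ne]
    intro p _ hp h0
    exact hp (by rw [h0, mul_zero, zero_mul])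
  rw [e1]
  calc _ ≤ ∑ p ∈ R, c * (√(‖u p.1‖ ^ 2) * √(‖v p.2‖ ^ 2)) := by
        refine (norm_sum_le _ _).trans (Finset.sum_le_sum fun p hp => ?_)
        obtain ⟨a, b, -⟩ := hR p hp
        rw [norm_mul, norm_mul, Real.sqrt_sq (norm_nonneg _), Real.sqrt_sq (norm_nonneg _)]
        have := hk _ (hF a) _ (hF b)
        calc _ ≤ ‖u p.1‖ * c * ‖v p.2‖ := by gcongr
          _ = _ := by ring
    _ = c * ∑ p ∈ R, √(‖u p.1‖ ^ 2) * √(‖v p.2‖ ^ 2) := by rw [Finset.mul_sum]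
    _ ≤ c * (√(∑ p ∈ R, ‖u p.1‖ ^ 2) * √(∑ p ∈ R, ‖v p.2‖ ^ 2)) := by
        gcongr
        exact Real.sum_sqrt_mul_sqrt_le _ (fun _ => by positivity) (fun _ => by positivity)
    _ ≤ _ := by
        rw [mul_assoc]
        gcongr
        · exact b1 u
        · exact b2 v

/-- Multiplying `k` entrywise by the Gram matrix of vectors `ξ i` of norm at most one does not
increase the norm beyond that of the blocks of `k` on the sets `{i | ξ i p ≠ 0}`: with `ξ` viewed as
an isometry `δ_i ↦ ∑ ξ i p δ_i ⊗ δ_p`, the product is a compression of the direct sum of the blocks. -/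
theorem of_patches (hc : 0 ≤ c) (ξ : ι → κ → ℝ) {k' : ι → ι → ℂ}
    (hξ : ∀ F : Finset ι, (F : Set ι) ⊆ S → ∃ P : Finset κ, (∀ i ∈ F, ∑ p ∈ P, ξ i p ^ 2 ≤ 1) ∧
      ∀ i ∈ F, ∀ j ∈ F, k' i j = (∑ p ∈ P, ξ i p * ξ j p : ℝ) * k i j)
    (h : ∀ p, KerBound k {i ∈ S | ξ i p ≠ 0} c) : KerBound k' S c := by
  classical
  intro F hF u v
  obtain ⟨P, hP, hk⟩ := hξ F hF
  have b : ∀ w : ι → ℂ, ∑ p ∈ P, ∑ i ∈ F, ‖w i * ξ i p‖ ^ 2 ≤ ∑ i ∈ F, ‖w i‖ ^ 2 := by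
    intro w
    rw [Finset.sum_comm]
    refine Finset.sum_le_sum fun i hi => ?_
    simp_rw [norm_mul, mul_pow, ← Finset.mul_sum]
    refine mul_le_of_le_one_right (by positivity) ?_
    simpa using hP i hi
  have e1 : ∑ i ∈ F, ∑ j ∈ F, u i * k' i j * v j =
      ∑ p ∈ P, ∑ i ∈ F, ∑ j ∈ F, (u i * ξ i p) * k i j * (v j * ξ j p) := by
    rw [Finset.sum_comm (s := P)]
    refine Finset.sum_congr rfl fun i hi => ?_
    rw [Finset.sum_comm (s := P)]
    refine Finset.sum_congr rfl fun j hj => ?_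
    rw [hk i hi j hj]
    push_cast
    rw [Finset.sum_mul, Finset.mul_sum, Finset.sum_mul]
    exact Finset.sum_congr rfl fun p _ => by ring
  rw [e1]
  calc ‖∑ p ∈ P, ∑ i ∈ F, ∑ j ∈ F, (u i * ξ i p) * k i j * (v j * ξ j p)‖
      ≤ ∑ p ∈ P, c * (√(∑ i ∈ F, ‖u i * ξ i p‖ ^ 2) * √(∑ i ∈ F, ‖v i * ξ i p‖ ^ 2)) := by
        refine (norm_sum_le _ _).trans (Finset.sum_le_sum fun p _ => ?_)
        have hp := h p (F.filter fun i => ξ i p ≠ 0) (fun i hi => by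
          rw [Finset.mem_coe, Finset.mem_filter] at hi
          exact ⟨hF hi.1, hi.2⟩) (fun i => u i * ξ i p) (fun i => v i * ξ i p)
        have z : ∀ (w : ι → ℂ), ∑ i ∈ F with ξ i p ≠ 0, ‖w i * ξ i p‖ ^ 2 =
            ∑ i ∈ F, ‖w i * ξ i p‖ ^ 2 := fun w => by
          refine Finset.sum_filter_of_ne fun i _ hi h0 => hi ?_
          simp [h0]
        have z2 : ∑ i ∈ F with ξ i p ≠ 0, ∑ j ∈ F with ξ j p ≠ 0,
            (u i * ξ i p) * k i j * (v j * ξ j p) =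
            ∑ i ∈ F, ∑ j ∈ F, (u i * ξ i p) * k i j * (v j * ξ j p) := by
          rw [Finset.sum_filter_of_ne]
          · refine Finset.sum_congr rfl fun i _ => Finset.sum_filter_of_ne fun j _ hj h0 => hj ?_
            simp [h0]
          · intro i _ hi h0
            exact hi (by simp [h0])
        rw [z u, z v, z2] at hp
        rwa [← mul_assoc]
    _ = c * ∑ p ∈ P, √(∑ i ∈ F, ‖u i * ξ i p‖ ^ 2) * √(∑ i ∈ F, ‖v i * ξ i p‖ ^ 2) := by
        rw [Finset.mul_sum]
    _ ≤ c * (√(∑ p ∈ P, ∑ i ∈ F, ‖u i * ξ i p‖ ^ 2) * √(∑ p ∈ P, ∑ i ∈ F, ‖v i * ξ i p‖ ^ 2)) := by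
        gcongr
        exact Real.sum_sqrt_mul_sqrt_le _ (fun _ => by positivity) (fun _ => by positivity)
    _ ≤ _ := by
        rw [mul_assoc]
        gcongr
        · exact b u
        · exact b v

end KerBound

/-! ### Operators on `ℓ²` with given matrices -/

section Operators

variable {ι : Type*} {k : ι → ι → ℂ} {c : ℝ}

theorem ell2_sum_sq_le (ψ : Ell2 ι) (F : Finset ι) :
    ∑ i ∈ F, ‖(ψ : ι → ℂ) i‖ ^ 2 ≤ ‖ψ‖ ^ 2 := by
  have := lp.sum_rpow_le_norm_rpow (p := 2) (by norm_num) ψ F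
  simpa using this

theorem sum_sq_le_of_kerBound (h : KerBound k Set.univ c) (hc : 0 ≤ c) (F' F : Finset ι)
    (φ : ι → ℂ) (ψ : Ell2 ι) (hφ : ∀ i ∈ F', φ i = ∑ j ∈ F, k i j * (ψ : ι → ℂ) j) :
    ∑ i ∈ F', ‖φ i‖ ^ 2 ≤ (c * ‖ψ‖) ^ 2 := by
  classical
  have h1 := h (F' ∪ F) (Set.subset_univ _) (fun i => if i ∈ F' then star (φ i) else 0)
    (fun j => if j ∈ F then (ψ : ι → ℂ) j else 0)
  set s := ∑ i ∈ F', ‖φ i‖ ^ 2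
  have hs : 0 ≤ s := Finset.sum_nonneg fun _ _ => by positivity
  have e1 : ∑ i ∈ F' ∪ F, ∑ j ∈ F' ∪ F, (if i ∈ F' then star (φ i) else 0) * k i j *
      (if j ∈ F then (ψ : ι → ℂ) j else 0) = (s : ℂ) := by
    have : ∀ i, ∑ j ∈ F' ∪ F, (if i ∈ F' then star (φ i) else 0) * k i j *
        (if j ∈ F then (ψ : ι → ℂ) j else 0) =
        if i ∈ F' then star (φ i) * ∑ j ∈ F, k i j * (ψ : ι → ℂ) j else 0 := by
      intro i
      split_ifs with hi
      · simp only [mul_ite, mul_zero, Finset.sum_ite_mem, Finset.mul_sum]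
        rw [Finset.inter_eq_right.2 Finset.subset_union_right]
        exact Finset.sum_congr rfl fun j _ => by ring
      · simp
    simp_rw [this]
    rw [Finset.sum_ite_mem, Finset.inter_eq_right.2 Finset.subset_union_left]
    push_cast [s]
    refine Finset.sum_congr rfl fun i hi => ?_
    rw [← hφ i hi]
    exact RCLike.conj_mul _
  have e2 : ∑ i ∈ F' ∪ F, ‖if i ∈ F' then star (φ i) else 0‖ ^ 2 = s := by
    have : ∀ i, ‖if i ∈ F' then star (φ i) else 0‖ ^ 2 = if i ∈ F' then ‖φ i‖ ^ 2 else 0 := by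
      intro i; split_ifs <;> simp
    simp_rw [this]
    rw [Finset.sum_ite_mem, Finset.inter_eq_right.2 Finset.subset_union_left]
  have e3 : ∑ i ∈ F' ∪ F, ‖if i ∈ F then (ψ : ι → ℂ) i else 0‖ ^ 2 ≤ ‖ψ‖ ^ 2 := by
    have : ∀ i, ‖if i ∈ F then (ψ : ι → ℂ) i else 0‖ ^ 2 =
        if i ∈ F then ‖(ψ : ι → ℂ) i‖ ^ 2 else 0 := by
      intro i; split_ifs <;> simp
    simp_rw [this]
    rw [Finset.sum_ite_mem, Finset.inter_eq_right.2 Finset.subset_union_right]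
    exact ell2_sum_sq_le ψ F
  rw [e1, e2, Complex.norm_real, Real.norm_of_nonneg hs] at h1
  have h2 : s ≤ c * √s * ‖ψ‖ := h1.trans (by
    gcongr
    exact Real.sqrt_le_iff.2 ⟨norm_nonneg _, e3⟩)
  have h3 : √s ≤ c * ‖ψ‖ := by
    rcases eq_or_lt_of_le (Real.sqrt_nonneg s) with h0 | h0
    · rw [← h0]; positivity
    · refine le_of_mul_le_mul_right ?_ h0
      rw [Real.mul_self_sqrt hs]
      linarith
  calc s = √s ^ 2 := (Real.sq_sqrt hs).symm
    _ ≤ _ := by gcongr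

theorem ell2_norm_le_of_kerBound [DecidableEq ι] {T : Ell2 ι →L[ℂ] Ell2 ι}
    (hT : ∀ i j, (T (lp.single 2 j (1 : ℂ)) : ι → ℂ) i = k i j) (hc : 0 ≤ c)
    (h : KerBound k Set.univ c) : ‖T‖ ≤ c := by
  refine T.opNorm_le_bound hc fun ψ => ?_
  have hs : HasSum (fun i => lp.single 2 i ((ψ : ι → ℂ) i)) ψ := lp.hasSum_single (by norm_num) ψ
  refine le_of_tendsto ((T.continuous.tendsto ψ).comp hs).norm (Filter.Eventually.of_forall ?_)
  intro F
  refine lp.norm_le_of_forall_sum_le (by norm_num) (by positivity) fun F' => ?_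
  have key := sum_sq_le_of_kerBound h hc F' F
    ((T (∑ i ∈ F, lp.single 2 i ((ψ : ι → ℂ) i)) : Ell2 ι) : ι → ℂ) ψ (by
      intro i _
      rw [map_sum, lp.coeFn_sum, Finset.sum_apply]
      refine Finset.sum_congr rfl fun j _ => ?_
      have : lp.single (E := fun _ : ι => ℂ) 2 j ((ψ : ι → ℂ) j) =
          (ψ : ι → ℂ) j • lp.single (E := fun _ : ι => ℂ) 2 j 1 := by
        rw [← lp.single_smul, smul_eq_mul, mul_one]
      rw [this, map_smul, lp.coeFn_smul, Pi.smul_apply, hT, smul_eq_mul, mul_comm])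
  simpa using key

theorem kerBound_of_operator [DecidableEq ι] {T : Ell2 ι →L[ℂ] Ell2 ι}
    (hT : ∀ i j, (T (lp.single 2 j (1 : ℂ)) : ι → ℂ) i = k i j) :
    KerBound k Set.univ ‖T‖ := by
  intro F _ u v
  set ψ : Ell2 ι := ∑ j ∈ F, v j • lp.single (E := fun _ : ι => ℂ) 2 j 1
  have hψ : ‖ψ‖ = √(∑ i ∈ F, ‖v i‖ ^ 2) := by
    have e : ψ = ∑ j ∈ F, lp.single (E := fun _ : ι => ℂ) 2 j (v j) :=
      Finset.sum_congr rfl fun j _ => by rw [← lp.single_smul, smul_eq_mul, mul_one]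
    have := lp.norm_sum_single (E := fun _ : ι => ℂ) (p := 2) (by norm_num) v F
    rw [e, eq_comm, Real.sqrt_eq_iff_mul_self_eq (by positivity) (norm_nonneg _), ← sq]
    simpa using this.symm
  have e1 : ∑ i ∈ F, ∑ j ∈ F, u i * k i j * v j = ∑ i ∈ F, u i * (T ψ : ι → ℂ) i := by
    refine Finset.sum_congr rfl fun i _ => ?_
    simp only [ψ]
    rw [map_sum, lp.coeFn_sum, Finset.sum_apply, Finset.mul_sum]
    refine Finset.sum_congr rfl fun j _ => ?_
    rw [map_smul, lp.coeFn_smul, Pi.smul_apply, hT, smul_eq_mul]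
    ring
  rw [e1]
  calc _ ≤ ∑ i ∈ F, √(‖u i‖ ^ 2) * √(‖(T ψ : ι → ℂ) i‖ ^ 2) := by
        refine (norm_sum_le _ _).trans (Finset.sum_le_sum fun i _ => ?_)
        rw [norm_mul, Real.sqrt_sq (norm_nonneg _), Real.sqrt_sq (norm_nonneg _)]
    _ ≤ √(∑ i ∈ F, ‖u i‖ ^ 2) * √(∑ i ∈ F, ‖(T ψ : ι → ℂ) i‖ ^ 2) :=
        Real.sum_sqrt_mul_sqrt_le _ (fun _ => by positivity) (fun _ => by positivity)
    _ ≤ √(∑ i ∈ F, ‖u i‖ ^ 2) * (‖T‖ * ‖ψ‖) := by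
        gcongr
        refine Real.sqrt_le_iff.2 ⟨by positivity, (ell2_sum_sq_le _ F).trans ?_⟩
        gcongr
        exact T.le_opNorm ψ
    _ = _ := by rw [hψ]; ring

theorem exists_operator (hk : ∀ i, (Function.support (k i)).Finite) (hc : 0 ≤ c)
    (h : KerBound k Set.univ c) :
    ∃ T : Ell2 ι →L[ℂ] Ell2 ι, ∀ (ψ : Ell2 ι) i, (T ψ : ι → ℂ) i = ∑' j, k i j * (ψ : ι → ℂ) j := by
  classical
  set R : ι → Finset ι := fun i => (hk i).toFinset
  have hR : ∀ (i : ι) (F : Finset ι), R i ⊆ F → ∀ ψ : Ell2 ι,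
      ∑' j, k i j * (ψ : ι → ℂ) j = ∑ j ∈ F, k i j * (ψ : ι → ℂ) j := by
    intro i F hF ψ
    refine tsum_eq_sum fun j hj => ?_
    have : k i j = 0 := by
      by_contra h0
      exact hj (hF (by simpa [R] using h0))
    rw [this, zero_mul]
  have b : ∀ (ψ : Ell2 ι) (F' : Finset ι),
      ∑ i ∈ F', ‖∑' j, k i j * (ψ : ι → ℂ) j‖ ^ 2 ≤ (c * ‖ψ‖) ^ 2 := fun ψ F' =>
    sum_sq_le_of_kerBound h hc F' (F'.biUnion R) (fun i => ∑' j, k i j * (ψ : ι → ℂ) j) ψ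
      fun i hi => hR i _ (Finset.subset_biUnion_of_mem R hi) ψ
  have mem : ∀ ψ : Ell2 ι, Memℓp (fun i => ∑' j, k i j * (ψ : ι → ℂ) j) 2 := fun ψ =>
    memℓp_gen' (C := (c * ‖ψ‖) ^ 2) fun F' => by simpa using b ψ F'
  refine ⟨LinearMap.mkContinuous
    { toFun := fun ψ => ⟨fun i => ∑' j, k i j * (ψ : ι → ℂ) j, mem ψ⟩
      map_add' := fun φ ψ => lp.ext (funext fun i => ?_)
      map_smul' := fun z ψ => lp.ext (funext fun i => ?_) } c fun ψ => ?_, fun ψ i => rfl⟩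
  · change ∑' j, k i j * ((φ + ψ : Ell2 ι) : ι → ℂ) j =
      ∑' j, k i j * (φ : ι → ℂ) j + ∑' j, k i j * (ψ : ι → ℂ) j
    rw [hR i _ subset_rfl, hR i _ subset_rfl, hR i _ subset_rfl, ← Finset.sum_add_distrib]
    exact Finset.sum_congr rfl fun j _ => by rw [lp.coeFn_add, Pi.add_apply, mul_add]
  · change ∑' j, k i j * ((z • ψ : Ell2 ι) : ι → ℂ) j = z * ∑' j, k i j * (ψ : ι → ℂ) j
    rw [hR i _ subset_rfl, hR i _ subset_rfl, Finset.mul_sum]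
    refine Finset.sum_congr rfl fun j _ => ?_
    rw [lp.coeFn_smul, Pi.smul_apply, smul_eq_mul]
    ring
  · refine lp.norm_le_of_forall_sum_le (by norm_num) (by positivity) fun F' => ?_
    simpa using b ψ F'

end Operators

/-! ### Convolution kernels and the reduced norm -/

theorem KerBound.subtype_iff {ι : Type*} {k : ι → ι → ℂ} {S : Set ι} {c : ℝ} :
    KerBound (fun i j : S => k i j) Set.univ c ↔ KerBound k S c := by
  classical
  constructor
  · intro h
    rcases S.eq_empty_or_nonempty with rfl | ⟨s, hs⟩
    · intro F hF u v
      have : F = ∅ := by simpa using hF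
      simp [this]
    · refine h.of_embedding (fun i => if hi : i ∈ S then ⟨i, hi⟩ else ⟨s, hs⟩) ?_
        (Set.mapsTo_univ _ _) ?_
      · intro i hi j hj e
        simpa [hi, hj] using e
      · intro i hi j hj
        simp [hi, hj]
  · intro h
    exact h.of_embedding Subtype.val Subtype.val_injective.injOn (fun i _ => i.2) fun _ _ _ _ => rfl

section Kernel

variable {E : Type*} [GroupoidArrows E]

theorem gpd_mul_left_cancel {g h k : E} (e : src g = rng h) (e' : src g = rng k)
    (q : gmul g h = gmul g k) : h = k := by
  rw [← gpd_inv_cancel_left g h e, q, gpd_inv_cancel_left g k e']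

theorem gpd_inv_injective {g h : E} (q : ginv g = ginv h) : g = h := by
  rw [← gpd_inv_inv g, q, gpd_inv_inv]

theorem gpd_mul_inv_cancel_right (g h : E) (e : src g = rng h) : gmul (gmul g h) (ginv h) = g := by
  rw [gmul_assoc _ _ _ e (rng_inv h).symm, gmul_ginv, ← e, gmul_src]

theorem gpd_inv_mul_cancel_right (g h : E) (e : src g = src h) : gmul (gmul g (ginv h)) h = g := by
  rw [gmul_assoc _ _ _ (by rw [rng_inv, e]) (src_inv h), ginv_gmul, ← e, gmul_src]

theorem gpd_mul_right_cancel {g h k : E} (e : src g = rng k) (e' : src h = rng k)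
    (q : gmul g k = gmul h k) : g = h := by
  rw [← gpd_mul_inv_cancel_right g k e, q, gpd_mul_inv_cancel_right h k e']

theorem src_div {g h : E} (e : src h = src g) : src (gmul g (ginv h)) = rng h := by
  rw [src_mul _ _ (by rw [rng_inv, e]), src_inv]

theorem rng_div {g h : E} (e : src h = src g) : rng (gmul g (ginv h)) = rng g :=
  rng_mul _ _ (by rw [rng_inv, e])

theorem div_div_div {g h k : E} (e : src h = src g) (e' : src k = src g) :
    gmul (gmul g (ginv k)) (ginv (gmul h (ginv k))) = gmul g (ginv h) := by
  rw [gpd_mul_inv_rev _ _ (by rw [rng_inv, e, e']), gpd_inv_inv, ← gmul_assoc _ _ _ (src_div e')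
    (by rw [rng_inv, e, e']), gpd_inv_mul_cancel_right _ _ e'.symm]

open Classical in
/-- The matrix of the convolution operator `ψ ↦ f * ψ`. -/
def kern (f : E → ℂ) (g h : E) : ℂ := if src h = src g then f (gmul g (ginv h)) else 0

theorem kern_of_eq (f : E → ℂ) {g h : E} (e : src h = src g) : kern f g h = f (gmul g (ginv h)) :=
  if_pos e

theorem kern_of_ne (f : E → ℂ) {g h : E} (e : src h ≠ src g) : kern f g h = 0 := if_neg e

theorem kern_add (f f' : E → ℂ) (g h : E) : kern (f + f') g h = kern f g h + kern f' g h := by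
  unfold kern; split_ifs <;> simp

theorem kern_smul (c : ℂ) (f : E → ℂ) (g h : E) : kern (c • f) g h = c * kern f g h := by
  unfold kern; split_ifs <;> simp

/-- If the arrows `g h⁻¹` of the nonzero entries lie in `n` bisections, the matrix is a sum of `n`
matrices with at most one nonzero entry in each row and each column. -/
theorem kerBound_of_bisection_cover {k : E → E → ℂ} {n : ℕ} {U : Fin n → Set E} {c : ℝ} {S : Set E}
    (hc : 0 ≤ c) (hU : ∀ m, Set.InjOn src (U m) ∧ Set.InjOn rng (U m))
    (hk : ∀ g ∈ S, ∀ h ∈ S, k g h ≠ 0 → src h = src g ∧ ∃ m, gmul g (ginv h) ∈ U m)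
    (hb : ∀ g ∈ S, ∀ h ∈ S, ‖k g h‖ ≤ c) : KerBound k S (n * c) := by
  classical
  -- Each nonzero entry is attributed to the first bisection that contains its arrow.
  set P : Fin n → E → E → Prop := fun m g h => k g h ≠ 0 ∧ gmul g (ginv h) ∈ U m ∧
    ∀ m' < m, gmul g (ginv h) ∉ U m'
  have e1 : ∀ g ∈ S, ∀ h ∈ S, k g h = ∑ m, if P m g h then k g h else 0 := by
    intro g hg h hh
    by_cases h0 : k g h = 0
    · simp [h0]
    obtain ⟨-, ⟨m, hm⟩⟩ := hk g hg h hh h0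
    have hex : ∃ m : Fin n, gmul g (ginv h) ∈ U m := ⟨m, hm⟩
    obtain ⟨m₀, hm₀, hmin⟩ := WellFounded.has_min (wellFounded_lt (α := Fin n))
      {m | gmul g (ginv h) ∈ U m} hex
    rw [Finset.sum_eq_single m₀]
    · rw [if_pos ⟨h0, hm₀, fun m' hm' hU' => hmin m' hU' hm'⟩]
    · intro m' _ hne
      rw [if_neg]
      rintro ⟨-, h1, h2⟩
      rcases lt_trichotomy m' m₀ with hlt | heq | hgt
      · exact hmin m' h1 hlt
      · exact hne heq
      · exact h2 m₀ hgt hm₀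
    · simp
  refine KerBound.congr (KerBound.sum (k := fun m g h => if P m g h then k g h else 0)
    fun m => ?_) e1
  have hne : ∀ g h, (if P m g h then k g h else 0) ≠ 0 → P m g h := fun g h h0 => by
    by_contra hP
    exact h0 (if_neg hP)
  refine KerBound.of_partialInjection hc ?_ ?_ ?_
  · intro g hg h hh
    split_ifs
    · exact hb g hg h hh
    · simpa using hc
  · intro g hg h hh h' hh' h1 h2
    obtain ⟨a1, b1, -⟩ := hne _ _ h1
    obtain ⟨a2, b2, -⟩ := hne _ _ h2
    have s1 := (hk _ hg _ hh a1).1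
    have s2 := (hk _ hg _ hh' a2).1
    have := (hU m).2 b1 b2 (by rw [rng_div s1, rng_div s2])
    exact gpd_inv_injective (gpd_mul_left_cancel (by rw [rng_inv, s1]) (by rw [rng_inv, s2]) this)
  · intro g hg g' hg' h hh h1 h2
    obtain ⟨a1, b1, -⟩ := hne _ _ h1
    obtain ⟨a2, b2, -⟩ := hne _ _ h2
    have s1 := (hk _ hg _ hh a1).1
    have s2 := (hk _ hg' _ hh a2).1
    have := (hU m).1 b1 b2 (by rw [src_div s1, src_div s2])
    exact gpd_mul_right_cancel (by rw [rng_inv, s1]) (by rw [rng_inv, s2]) this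

/-- A bounded function supported on finitely many (not necessarily open) bisections. -/
def BisectionBounded (f : E → ℂ) : Prop :=
  ∃ (n : ℕ) (U : Fin n → Set E) (c : ℝ), 0 ≤ c ∧
    (∀ m, Set.InjOn src (U m) ∧ Set.InjOn rng (U m)) ∧
    (∀ g, f g ≠ 0 → ∃ m, g ∈ U m) ∧ ∀ g, ‖f g‖ ≤ c

theorem kerBound_kern_of_cover {f : E → ℂ} {n : ℕ} {U : Fin n → Set E} {c : ℝ} (S : Set E)
    (hc : 0 ≤ c) (hU : ∀ m, Set.InjOn src (U m) ∧ Set.InjOn rng (U m))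
    (hf : ∀ g, f g ≠ 0 → ∃ m, g ∈ U m) (hb : ∀ g, ‖f g‖ ≤ c) : KerBound (kern f) S (n * c) := by
  refine kerBound_of_bisection_cover hc hU ?_ ?_
  · intro g _ h _ h0
    by_cases e : src h = src g
    · rw [kern_of_eq f e] at h0
      exact ⟨e, hf _ h0⟩
    · exact absurd (kern_of_ne f e) h0
  · intro g _ h _
    unfold kern
    split_ifs
    · exact hb _
    · simpa using hc

namespace BisectionBounded

variable {f f' : E → ℂ}

theorem add (h : BisectionBounded f) (h' : BisectionBounded f') : BisectionBounded (f + f') := by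
  obtain ⟨n, U, c, hc, hU, hf, hb⟩ := h
  obtain ⟨n', U', c', hc', hU', hf', hb'⟩ := h'
  refine ⟨n + n', Fin.append U U', c + c', by positivity, ?_, ?_, ?_⟩
  · intro m
    refine Fin.addCases (fun i => ?_) (fun i => ?_) m
    · simpa using hU i
    · simpa using hU' i
  · intro g hg
    by_cases h0 : f g = 0
    · obtain ⟨m, hm⟩ := hf' g (fun h1 => hg (by simp [h0, h1]))
      exact ⟨Fin.natAdd n m, by simpa using hm⟩
    · obtain ⟨m, hm⟩ := hf g h0
      exact ⟨Fin.castAdd n' m, by simpa using hm⟩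
  · intro g
    exact (norm_add_le _ _).trans (add_le_add (hb g) (hb' g))

theorem smul (h : BisectionBounded f) (z : ℂ) : BisectionBounded (z • f) := by
  obtain ⟨n, U, c, hc, hU, hf, hb⟩ := h
  refine ⟨n, U, ‖z‖ * c, by positivity, hU, fun g hg => hf g fun h0 => hg (by simp [h0]), ?_⟩
  intro g
  rw [Pi.smul_apply, smul_eq_mul, norm_mul]
  gcongr
  exact hb g

theorem zero : BisectionBounded (0 : E → ℂ) :=
  ⟨0, fun _ => ∅, 0, le_rfl, fun m => m.elim0, fun g hg => absurd rfl hg, fun g => by simp⟩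

theorem exists_kerBound (h : BisectionBounded f) : ∃ c, 0 ≤ c ∧ ∀ S, KerBound (kern f) S c := by
  obtain ⟨n, U, c, hc, hU, hf, hb⟩ := h
  exact ⟨n * c, by positivity, fun S => kerBound_kern_of_cover S hc hU hf hb⟩

theorem of_norm_le (h : BisectionBounded f) (hle : ∀ g, ‖f' g‖ ≤ ‖f g‖) : BisectionBounded f' := by
  obtain ⟨n, U, c, hc, hU, hf, hb⟩ := h
  refine ⟨n, U, c, hc, hU, fun g hg => hf g fun h0 => hg ?_, fun g => (hle g).trans (hb g)⟩
  have := hle g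
  rw [h0, norm_zero] at this
  exact norm_le_zero_iff.1 this

theorem finite_row (h : BisectionBounded f) (g : E) : (Function.support (kern f g)).Finite := by
  obtain ⟨n, U, c, hc, hU, hf, hb⟩ := h
  have : Function.support (kern f g) ⊆
      ⋃ m, {h | src h = src g ∧ gmul g (ginv h) ∈ U m} := by
    intro h hh
    rw [Function.mem_support] at hh
    by_cases e : src h = src g
    · rw [kern_of_eq f e] at hh
      obtain ⟨m, hm⟩ := hf _ hh
      exact Set.mem_iUnion.2 ⟨m, e, hm⟩
    · exact absurd (kern_of_ne f e) hh
  refine (Set.finite_iUnion fun m => Set.Subsingleton.finite ?_).subset this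
  rintro h ⟨s1, b1⟩ h' ⟨s2, b2⟩
  have := (hU m).2 b1 b2 (by rw [rng_div s1, rng_div s2])
  exact gpd_inv_injective (gpd_mul_left_cancel (by rw [rng_inv, s1]) (by rw [rng_inv, s2]) this)

end BisectionBounded

theorem convolve_eq_tsum_kern (S : Set E) (f : E → ℂ) (ψ : S → ℂ) (g : S) :
    convolve S f ψ g = ∑' h : S, kern f g h * ψ h := by
  classical
  unfold convolve
  have := tsum_subtype {h : S | src (h : E) = src (g : E)}
    (fun h : S => f (gmul g (ginv (h : E))) * ψ h)
  refine this.trans (tsum_congr fun h => ?_)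
  unfold kern Set.indicator
  simp only [Set.mem_ofPred_eq]
  split_ifs <;> simp

theorem leftRegular_apply {f : E → ℂ} (hf : BisectionBounded f) (S : Set E) (ψ : Ell2 S) (g : S) :
    leftRegular S f ψ g = ∑' h : S, kern f g h * (ψ : S → ℂ) h := by
  classical
  obtain ⟨c, hc, hb⟩ := hf.exists_kerBound
  obtain ⟨T, hT⟩ := exists_operator (k := fun g h : S => kern f g h)
    (fun g => (hf.finite_row g).preimage Subtype.val_injective.injOn) hc
    (KerBound.subtype_iff.2 (hb S))
  have hex : ∃ T : Ell2 S →L[ℂ] Ell2 S, ∀ ψ : Ell2 S, ∀ g, T ψ g = convolve S f ψ g :=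
    ⟨T, fun ψ g => (hT ψ g).trans (convolve_eq_tsum_kern S f ψ g).symm⟩
  rw [leftRegular, dif_pos hex, hex.choose_spec, convolve_eq_tsum_kern]

theorem leftRegular_single {f : E → ℂ} (hf : BisectionBounded f) (S : Set E) [DecidableEq S] (g h : S) :
    (leftRegular S f (lp.single 2 h (1 : ℂ)) : S → ℂ) g = kern f g h := by
  rw [leftRegular_apply hf, tsum_eq_single h]
  · rw [lp.single_apply_self, mul_one]
  · intro h' hne
    rw [lp.single_apply_ne _ _ _ hne, mul_zero]

theorem reducedNorm_nonneg (S : Set E) (f : E → ℂ) : 0 ≤ reducedNorm S f := norm_nonneg _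

theorem reducedNorm_le {f : E → ℂ} (hf : BisectionBounded f) {S : Set E} {c : ℝ} (hc : 0 ≤ c)
    (h : KerBound (kern f) S c) : reducedNorm S f ≤ c := by
  classical
  exact ell2_norm_le_of_kerBound (leftRegular_single hf S) hc
    (KerBound.subtype_iff.2 h)

theorem kerBound_reducedNorm {f : E → ℂ} (hf : BisectionBounded f) (S : Set E) :
    KerBound (kern f) S (reducedNorm S f) := by
  classical
  exact KerBound.subtype_iff.1
    (kerBound_of_operator (leftRegular_single hf S))

theorem ell2_operator_ext {ι : Type*} {T T' : Ell2 ι →L[ℂ] Ell2 ι}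
    (h : ∀ (ψ : Ell2 ι) i, (T ψ : ι → ℂ) i = (T' ψ : ι → ℂ) i) : T = T' :=
  ContinuousLinearMap.ext fun ψ => lp.ext (funext (h ψ))

theorem leftRegular_add {f f' : E → ℂ} (hf : BisectionBounded f) (hf' : BisectionBounded f')
    (S : Set E) : leftRegular S (f + f') = leftRegular S f + leftRegular S f' := by
  refine ell2_operator_ext fun ψ g => ?_
  rw [leftRegular_apply (hf.add hf'), add_apply, lp.coeFn_add, Pi.add_apply,
    leftRegular_apply hf, leftRegular_apply hf']
  have fin : ∀ {f : E → ℂ}, BisectionBounded f →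
      Summable fun h : S => kern f g h * (ψ : S → ℂ) h := fun hf =>
    summable_of_hasFiniteSupport (((hf.finite_row g).preimage Subtype.val_injective.injOn).subset
      fun h hh h0 => hh (by simp [h0]))
  rw [← (fin hf).tsum_add (fin hf')]
  exact tsum_congr fun h => by rw [kern_add, add_mul]

theorem leftRegular_smul {f : E → ℂ} (hf : BisectionBounded f) (z : ℂ) (S : Set E) :
    leftRegular S (z • f) = z • leftRegular S f := by
  refine ell2_operator_ext fun ψ g => ?_
  rw [leftRegular_apply (hf.smul z), smul_apply, lp.coeFn_smul, Pi.smul_apply,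
    leftRegular_apply hf, smul_eq_mul, ← tsum_mul_left]
  exact tsum_congr fun h => by rw [kern_smul, mul_assoc]

theorem reducedNorm_add_le {f f' : E → ℂ} (hf : BisectionBounded f) (hf' : BisectionBounded f')
    (S : Set E) : reducedNorm S (f + f') ≤ reducedNorm S f + reducedNorm S f' := by
  unfold reducedNorm
  rw [leftRegular_add hf hf']
  exact norm_add_le _ _

theorem reducedNorm_smul {f : E → ℂ} (hf : BisectionBounded f) (z : ℂ) (S : Set E) :
    reducedNorm S (z • f) = ‖z‖ * reducedNorm S f := by
  unfold reducedNorm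
  rw [leftRegular_smul hf, norm_smul]

end Kernel

/-! ### Étale groupoids -/

section Units

variable {G : Type*} [GroupoidArrows G]

theorem src_eq_self {u : G} (hu : u ∈ units G) : src u = u := hu

theorem rng_eq_self {u : G} (hu : u ∈ units G) : rng u = u := by
  have h := gpd_rng_src u
  rwa [src_eq_self hu] at h

theorem ginv_eq_self {u : G} (hu : u ∈ units G) : ginv u = u := by
  have h := gmul_src (ginv u)
  rw [src_inv, rng_eq_self hu] at h
  have h' := ginv_gmul u
  rwa [h, src_eq_self hu] at h'

theorem unit_gmul {g u : G} (e : rng g = u) : gmul u g = g := by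
  rw [← e, rng_gmul]

theorem src_mem_units (g : G) : src g ∈ units G := gpd_src_src g

theorem rng_mem_units (g : G) : rng g ∈ units G := gpd_src_rng g

/-- The source of an arrow as a point of the unit space. -/
def srcUnit (g : G) : units G := ⟨src g, gpd_src_src g⟩

/-- The range of an arrow as a point of the unit space. -/
def rngUnit (g : G) : units G := ⟨rng g, gpd_src_rng g⟩

theorem srcUnit_coe (u : units G) : srcUnit (u : G) = u := Subtype.ext (src_eq_self u.2)

theorem rngUnit_coe (u : units G) : rngUnit (u : G) = u := Subtype.ext (rng_eq_self u.2)

theorem rngUnit_inv (g : G) : rngUnit (ginv g) = srcUnit g := Subtype.ext (rng_inv g)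

theorem srcUnit_inv (g : G) : srcUnit (ginv g) = rngUnit g := Subtype.ext (src_inv g)

theorem eq_of_inv_mul_mem_units {g h : G} (e : rng g = rng h) (hu : gmul (ginv g) h ∈ units G) :
    g = h := by
  have e' : src (ginv g) = rng h := by rw [src_inv, e]
  have h1 := rng_eq_self hu
  rw [rng_mul _ _ e', rng_inv] at h1
  have h2 := gpd_cancel_inv_left g h e
  rw [← h1, gmul_src] at h2
  exact h2

end Units

section Etale

variable {G : Type*} [TopologicalSpace G] [GroupoidArrows G] [IsEtaleGroupoid G]

instance : T2Space (units G) := IsEtaleGroupoid.t2_units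

instance : LocallyCompactSpace (units G) := IsEtaleGroupoid.locallyCompact_units

theorem isLocalHomeomorph_rngUnit : IsLocalHomeomorph (rngUnit : G → units G) :=
  IsEtaleGroupoid.isLocalHomeomorph_rng

theorem continuous_ginv : Continuous (ginv : G → G) := IsEtaleGroupoid.continuous_inv

theorem continuous_rngUnit : Continuous (rngUnit : G → units G) :=
  isLocalHomeomorph_rngUnit.continuous

theorem continuous_srcUnit : Continuous (srcUnit : G → units G) := by
  have : (srcUnit : G → units G) = rngUnit ∘ ginv := funext fun g => (rngUnit_inv g).symm
  rw [this]
  exact continuous_rngUnit.comp continuous_ginv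

theorem continuous_rng : Continuous (rng : G → G) := continuous_subtype_val.comp continuous_rngUnit

theorem isOpenMap_ginv : IsOpenMap (ginv : G → G) := by
  intro U hU
  have : ginv '' U = ginv ⁻¹' U := by
    ext g
    exact ⟨by rintro ⟨h, hh, rfl⟩; simpa [gpd_inv_inv] using hh,
      fun hg => ⟨ginv g, hg, gpd_inv_inv g⟩⟩
  rw [this]
  exact hU.preimage continuous_ginv

theorem isOpenMap_rngUnit : IsOpenMap (rngUnit : G → units G) := isLocalHomeomorph_rngUnit.isOpenMap

theorem isOpenMap_srcUnit : IsOpenMap (srcUnit : G → units G) := by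
  have : (srcUnit : G → units G) = rngUnit ∘ ginv := funext fun g => (rngUnit_inv g).symm
  rw [this]
  exact isOpenMap_rngUnit.comp isOpenMap_ginv

theorem tendsto_gmul {ι : Type*} {l : Filter ι} {a b : ι → G} {g h : G}
    (ha : Filter.Tendsto a l (𝓝 g)) (hb : Filter.Tendsto b l (𝓝 h)) (e : src g = rng h)
    (hab : ∀ᶠ i in l, src (a i) = rng (b i)) :
    Filter.Tendsto (fun i => gmul (a i) (b i)) l (𝓝 (gmul g h)) := by
  have h1 : Filter.Tendsto (fun p : G × G => gmul p.1 p.2) (𝓝[{p | src p.1 = rng p.2}] (g, h))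
      (𝓝 (gmul g h)) := IsEtaleGroupoid.continuousOn_mul (g, h) e
  exact h1.comp (tendsto_nhdsWithin_iff.2 ⟨ha.prodMk_nhds hb, hab⟩)

theorem rngUnit_eq_of_tendsto {ι : Type*} {l : Filter ι} [l.NeBot] {a : ι → G} {g h : G}
    (ha : Filter.Tendsto a l (𝓝 g)) (hb : Filter.Tendsto a l (𝓝 h)) : rngUnit g = rngUnit h :=
  tendsto_nhds_unique ((continuous_rngUnit.tendsto g).comp ha)
    ((continuous_rngUnit.tendsto h).comp hb)

theorem srcUnit_eq_of_tendsto {ι : Type*} {l : Filter ι} [l.NeBot] {a : ι → G} {g h : G}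
    (ha : Filter.Tendsto a l (𝓝 g)) (hb : Filter.Tendsto a l (𝓝 h)) : srcUnit g = srcUnit h :=
  tendsto_nhds_unique ((continuous_srcUnit.tendsto g).comp ha)
    ((continuous_srcUnit.tendsto h).comp hb)

theorem isOpen_units : IsOpen (units G) := by
  rw [isOpen_iff_mem_nhds]
  intro u hu
  obtain ⟨e, heu, he⟩ := isLocalHomeomorph_rngUnit u
  have h1 : e.source ∈ 𝓝 u := e.open_source.mem_nhds heu
  have h2 : rng ⁻¹' e.source ∈ 𝓝 u := by
    refine continuous_rng.continuousAt ?_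
    rwa [rng_eq_self hu]
  filter_upwards [h1, h2] with g hg1 hg2
  have : rng g = g := by
    refine e.injOn hg2 hg1 ?_
    rw [← he]
    exact Subtype.ext (gpd_rng_rng g)
  rw [← this]
  exact rng_mem_units g

/-- A local section of the range map through a given arrow. -/
theorem exists_rng_section (g : G) : ∃ σ : units G → G,
    Filter.Tendsto σ (𝓝 (rngUnit g)) (𝓝 g) ∧ σ (rngUnit g) = g ∧
      ∀ᶠ u in 𝓝 (rngUnit g), rngUnit (σ u) = u := by
  obtain ⟨e, heg, he⟩ := isLocalHomeomorph_rngUnit g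
  refine ⟨e.symm, ?_, ?_, ?_⟩
  · rw [he]
    exact e.tendsto_symm heg
  · rw [he]
    exact e.left_inv heg
  · rw [he]
    exact e.eventually_right_inverse (e.map_source heg)

/-- A local section of the source map through a given arrow. -/
theorem exists_src_section (g : G) : ∃ σ : units G → G,
    Filter.Tendsto σ (𝓝 (srcUnit g)) (𝓝 g) ∧ σ (srcUnit g) = g ∧
      ∀ᶠ u in 𝓝 (srcUnit g), srcUnit (σ u) = u := by
  obtain ⟨σ, h1, h2, h3⟩ := exists_rng_section (ginv g)
  rw [rngUnit_inv] at h1 h2 h3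
  refine ⟨fun u => ginv (σ u), ?_, by simp only [h2, gpd_inv_inv], ?_⟩
  · have := (continuous_ginv.tendsto (ginv g)).comp h1
    rwa [gpd_inv_inv] at this
  · filter_upwards [h3] with u hu
    rw [srcUnit_inv, hu]

theorem exists_open_bisection (g : G) {N : Set G} (hN : N ∈ 𝓝 g) :
    ∃ U, IsOpen U ∧ g ∈ U ∧ U ⊆ N ∧ Set.InjOn src U ∧ Set.InjOn rng U := by
  obtain ⟨e, heg, he⟩ := isLocalHomeomorph_rngUnit g
  obtain ⟨e', heg', he'⟩ := isLocalHomeomorph_rngUnit (ginv g)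
  obtain ⟨W, hWN, hW, hgW⟩ := mem_nhds_iff.1 hN
  refine ⟨W ∩ (e.source ∩ ginv ⁻¹' e'.source), hW.inter (e.open_source.inter
    (e'.open_source.preimage continuous_ginv)), ⟨hgW, heg, heg'⟩, fun x hx => hWN hx.1, ?_, ?_⟩
  · rintro a ⟨-, -, ha⟩ b ⟨-, -, hb⟩ hab
    refine gpd_inv_injective (e'.injOn ha hb ?_)
    rw [← he']
    exact Subtype.ext (by simpa [rngUnit, rng_inv] using hab)
  · rintro a ⟨-, ha, -⟩ b ⟨-, hb, -⟩ hab
    refine e.injOn ha hb ?_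
    rw [← he]
    exact Subtype.ext hab

theorem isOpen_setMul {U V : Set G} (hU : IsOpen U) (hV : IsOpen V) :
    IsOpen {g | ∃ a ∈ U, ∃ b ∈ V, src a = rng b ∧ g = gmul a b} := by
  rw [isOpen_iff_mem_nhds]
  rintro _ ⟨a, ha, b, hb, e, rfl⟩
  obtain ⟨σ, h1, h2, h3⟩ := exists_rng_section a
  have hr : rngUnit (gmul a b) = rngUnit a := Subtype.ext (rng_mul a b e)
  have ht : Filter.Tendsto (rngUnit : G → units G) (𝓝 (gmul a b)) (𝓝 (rngUnit a)) := by
    rw [← hr]; exact continuous_rngUnit.tendsto _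
  have t1 := h1.comp ht
  have t2 : ∀ᶠ p in 𝓝 (gmul a b), rng (σ (rngUnit p)) = rng p := by
    filter_upwards [ht.eventually h3] with p hp
    exact congrArg Subtype.val hp
  have t3 : Filter.Tendsto (fun p => gmul (ginv (σ (rngUnit p))) p) (𝓝 (gmul a b)) (𝓝 b) := by
    have := tendsto_gmul ((continuous_ginv.tendsto a).comp t1) Filter.tendsto_id
      (by rw [src_inv]; exact (congrArg Subtype.val hr).symm)
      (by filter_upwards [t2] with p hp; simpa [src_inv] using hp)
    rwa [gpd_inv_cancel_left _ _ e] at this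
  filter_upwards [t1 (hU.mem_nhds ha), t3 (hV.mem_nhds hb), t2] with p p1 p2 p3
  exact ⟨_, p1, _, p2, by rw [rng_mul _ _ (by rw [src_inv, p3]), rng_inv]; rfl,
    (gpd_cancel_inv_left _ _ p3).symm⟩

/-! ### Hausdorff units -/

/-- An arrow whose source is a Hausdorff unit can be separated from every other arrow. -/
theorem disjoint_nhds_of_src {g k : G} (hg : src g ∈ hausdorffUnits G) (hne : k ≠ g) :
    Disjoint (𝓝 g) (𝓝 k) := by
  by_contra hd
  have : (𝓝 g ⊓ 𝓝 k).NeBot := Filter.neBot_iff.2 (disjoint_iff.not.1 hd)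
  have t1 : Filter.Tendsto id (𝓝 g ⊓ 𝓝 k) (𝓝 g) := inf_le_left
  have t2 : Filter.Tendsto id (𝓝 g ⊓ 𝓝 k) (𝓝 k) := inf_le_right
  have er : rng g = rng k := congrArg Subtype.val (rngUnit_eq_of_tendsto t1 t2)
  have s1 : Filter.Tendsto (fun p => gmul (ginv p) p) (𝓝 g ⊓ 𝓝 k) (𝓝 (gmul (ginv g) g)) :=
    tendsto_gmul ((continuous_ginv.tendsto g).comp t1) t1 (src_inv g)
      (Filter.Eventually.of_forall fun p => src_inv p)
  have s2 : Filter.Tendsto (fun p => gmul (ginv p) p) (𝓝 g ⊓ 𝓝 k) (𝓝 (gmul (ginv g) k)) :=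
    tendsto_gmul ((continuous_ginv.tendsto g).comp t1) t2 (by rw [src_inv, er])
      (Filter.Eventually.of_forall fun p => src_inv p)
  rw [ginv_gmul] at s1
  by_cases h : gmul (ginv g) k = src g
  · exact hne (eq_of_inv_mul_mem_units er (h ▸ src_mem_units g)).symm
  · have hd' := hg.2 _ h
    have := Filter.map_neBot_iff (fun p : G => gmul (ginv p) p) |>.2 this
    exact this.ne (le_bot_iff.1 (hd' s1 s2))

/-- The set of Hausdorff units is invariant. -/
theorem rng_mem_hausdorffUnits {g : G} (hg : src g ∈ hausdorffUnits G) :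
    rng g ∈ hausdorffUnits G := by
  refine ⟨rng_mem_units g, fun h hne => ?_⟩
  by_contra hd
  have : (𝓝 (rng g) ⊓ 𝓝 h).NeBot := Filter.neBot_iff.2 (disjoint_iff.not.1 hd)
  have t1 : Filter.Tendsto id (𝓝 (rng g) ⊓ 𝓝 h) (𝓝 (rng g)) := inf_le_left
  have t2 : Filter.Tendsto id (𝓝 (rng g) ⊓ 𝓝 h) (𝓝 h) := inf_le_right
  have es : rng g = src h := by
    have := congrArg Subtype.val (srcUnit_eq_of_tendsto t1 t2)
    simpa [srcUnit, gpd_src_rng] using this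
  obtain ⟨σ, h1, h2, h3⟩ := exists_rng_section g
  have hs : Filter.Tendsto (srcUnit : G → units G) (𝓝 (rng g) ⊓ 𝓝 h) (𝓝 (rngUnit g)) := by
    have := (continuous_srcUnit.tendsto (rng g)).comp t1
    rwa [show srcUnit (rng g) = rngUnit g from Subtype.ext (gpd_src_rng g)] at this
  have u1 := h1.comp hs
  have ev : ∀ᶠ q in 𝓝 (rng g) ⊓ 𝓝 h, src q = rng (σ (srcUnit q)) := by
    filter_upwards [hs.eventually h3] with q hq
    exact (congrArg Subtype.val hq).symm
  have u2 : Filter.Tendsto (fun q => gmul q (σ (srcUnit q))) (𝓝 (rng g) ⊓ 𝓝 h)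
      (𝓝 (gmul h g)) := tendsto_gmul t2 u1 es.symm ev
  have ev2 : (fun q => gmul q (σ (srcUnit q))) =ᶠ[𝓝 (rng g) ⊓ 𝓝 h] fun q => σ (srcUnit q) := by
    filter_upwards [ev, Filter.mem_inf_of_left (isOpen_units.mem_nhds (rng_mem_units g))] with q h1 h2
    exact unit_gmul (by rw [← h1, src_eq_self h2])
  have u3 := u2.congr' ev2
  by_cases hh : gmul h g = g
  · refine hne ?_
    rw [← gpd_mul_inv_cancel_right h g es.symm, hh, gmul_ginv]
  · have hd' := disjoint_nhds_of_src hg hh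
    have := Filter.map_neBot_iff (fun q : G => σ (srcUnit q)) |>.2 this
    exact this.ne (le_bot_iff.1 (hd' u1 u3))

/-- A unit fails to be Hausdorff only at the boundary in `G⁰` of one of the countably many open
bisections covering `G`. -/
theorem isMeagre_compl_hausdorffUnits
    (hcover : ∃ U : ℕ → Set G, (∀ n, IsOpenBisection Set.univ (U n)) ∧ ⋃ n, U n = Set.univ) :
    IsMeagre {u : units G | (u : G) ∉ hausdorffUnits G} := by
  obtain ⟨U, hU, hcov⟩ := hcover
  have hUo : ∀ n, IsOpen (U n) := fun n => by
    obtain ⟨⟨V, hV, e⟩, -⟩ := hU n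
    rw [e, Set.inter_univ]; exact hV
  have hsub : {u : units G | (u : G) ∉ hausdorffUnits G} ⊆
      ⋃ n, frontier ((↑) ⁻¹' U n : Set (units G)) := by
    intro x hx
    obtain ⟨h, hne, hd⟩ : ∃ h, h ≠ (x : G) ∧ ¬ Disjoint (𝓝 (x : G)) (𝓝 h) := by
      by_contra! hcon
      exact hx ⟨x.2, hcon⟩
    have : (𝓝 (x : G) ⊓ 𝓝 h).NeBot := Filter.neBot_iff.2 (disjoint_iff.not.1 hd)
    have t1 : Filter.Tendsto id (𝓝 (x : G) ⊓ 𝓝 h) (𝓝 (x : G)) := inf_le_left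
    have t2 : Filter.Tendsto id (𝓝 (x : G) ⊓ 𝓝 h) (𝓝 h) := inf_le_right
    have es := srcUnit_eq_of_tendsto t1 t2
    obtain ⟨n, hn⟩ := Set.mem_iUnion.1 (hcov ▸ Set.mem_univ h)
    refine Set.mem_iUnion.2 ⟨n, ?_⟩
    rw [((hUo n).preimage continuous_subtype_val).frontier_eq]
    refine ⟨?_, fun hxn => hne ?_⟩
    · have t3 : Filter.Tendsto (srcUnit : G → units G) (𝓝 (x : G) ⊓ 𝓝 h) (𝓝 x) := by
        have := (continuous_srcUnit.tendsto (x : G)).comp t1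
        rwa [srcUnit_coe] at this
      refine mem_closure_of_tendsto t3 ?_
      filter_upwards [t2 ((hUo n).mem_nhds hn), t1 (isOpen_units.mem_nhds x.2)] with q h1 h2
      change src q ∈ U n
      rw [src_eq_self h2]
      exact h1
    · exact (hU n).2.1 hn hxn (congrArg Subtype.val es).symm
  refine IsMeagre.mono hsub (isMeagre_iUnion fun n => ?_)
  exact (IsClosed.isNowhereDense_iff isClosed_frontier |>.2
    (by rw [← frontier_compl]
        exact interior_frontier ((hUo n).preimage continuous_subtype_val).isClosed_compl)).isMeagre

theorem dense_hausdorffUnits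
    (hcover : ∃ U : ℕ → Set G, (∀ n, IsOpenBisection Set.univ (U n)) ∧ ⋃ n, U n = Set.univ) :
    Dense {u : units G | (u : G) ∈ hausdorffUnits G} := by
  have h := isMeagre_compl_hausdorffUnits hcover
  refine dense_of_mem_residual ?_
  rw [IsMeagre] at h
  convert h using 1
  ext u
  simp

end Etale

/-! ### The space of cosets -/

namespace Coset

section Algebra

variable {G : Type*} [GroupoidArrows G]

/-- An arrow as a coset of the trivial group. -/
def sing (g : G) : Coset G where
  carrier := {g}
  nonempty := Set.singleton_nonempty g
  src_eq := by rintro _ rfl _ rfl; rfl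
  rng_eq := by rintro _ rfl _ rfl; rfl
  closed := by
    rintro _ rfl _ rfl _ rfl
    rw [gmul_ginv, rng_gmul]
    rfl

theorem mem_sing {g h : G} : h ∈ (sing g).carrier ↔ h = g := Iff.rfl

theorem sing_injective : Function.Injective (sing : G → Coset G) := fun g h e => by
  have : g ∈ (sing h).carrier := e ▸ mem_sing.2 rfl
  exact this

theorem eq_sing_iff {A : Coset G} {g : G} : A = sing g ↔ A.carrier = {g} :=
  ⟨fun h => h ▸ rfl, fun h => Coset.ext h⟩

theorem csrc_sing (g : G) : (sing g).csrc = sing (src g) := by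
  ext h
  constructor
  · rintro ⟨a, rfl, b, rfl, rfl⟩
    exact ginv_gmul _
  · rintro rfl
    exact ⟨g, rfl, g, rfl, (ginv_gmul g).symm⟩

theorem cinv_sing (g : G) : (sing g).cinv = sing (ginv g) := by
  ext h
  constructor
  · rintro ⟨a, rfl, rfl⟩
    rfl
  · rintro rfl
    exact ⟨g, rfl, rfl⟩

theorem crng_sing (g : G) : (sing g).crng = sing (rng g) := by
  rw [← csrc_cinv, cinv_sing, csrc_sing, src_inv]

theorem gmul_sing {g h : G} (e : src g = rng h) : gmul (sing g) (sing h) = sing (gmul g h) := by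
  change cmul _ _ = _
  rw [cmul_of (by rw [csrc_sing, crng_sing, e])]
  ext k
  constructor
  · rintro ⟨a, rfl, b, rfl, rfl⟩
    rfl
  · rintro rfl
    exact ⟨g, rfl, h, rfl, rfl⟩

theorem mem_csrc {A : Coset G} {a b : G} (ha : a ∈ A.carrier) (hb : b ∈ A.carrier) :
    gmul (ginv a) b ∈ A.csrc.carrier := ⟨a, ha, b, hb, rfl⟩

theorem mul_csrc_mem {A : Coset G} {a x : G} (ha : a ∈ A.carrier) (hx : x ∈ A.csrc.carrier) :
    gmul a x ∈ A.carrier := by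
  obtain ⟨b, hb, c, hc, rfl⟩ := hx
  rw [← gmul_assoc _ _ _ (by rw [rng_inv, A.src_eq a ha b hb])
    (by rw [src_inv, A.rng_eq b hb c hc])]
  exact A.closed a ha b hb c hc

theorem src_mem_csrc {A : Coset G} {a : G} (ha : a ∈ A.carrier) : src a ∈ A.csrc.carrier :=
  ⟨a, ha, a, ha, (ginv_gmul a).symm⟩

theorem src_of_mem_csrc {A : Coset G} {a x : G} (ha : a ∈ A.carrier) (hx : x ∈ A.csrc.carrier) :
    src x = src a ∧ rng x = src a := by
  obtain ⟨b, hb, c, hc, rfl⟩ := hx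
  have e : src (ginv b) = rng c := by rw [src_inv, A.rng_eq b hb c hc]
  exact ⟨by rw [src_mul _ _ e, A.src_eq c hc a ha],
    by rw [rng_mul _ _ e, rng_inv, A.src_eq b hb a ha]⟩

theorem ext_of_mem {A B : Coset G} {a : G} (ha : a ∈ A.carrier) (hb : a ∈ B.carrier)
    (e : A.csrc = B.csrc) : A = B := by
  have key : ∀ {A B : Coset G}, a ∈ A.carrier → a ∈ B.carrier → A.csrc = B.csrc →
      A.carrier ⊆ B.carrier := by
    intro A B ha hb e g hg
    have h1 := mul_csrc_mem hb (e ▸ mem_csrc ha hg)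
    rwa [gpd_cancel_inv_left _ _ (A.rng_eq a ha g hg)] at h1
  exact Coset.ext (Set.Subset.antisymm (key ha hb e) (key hb ha e.symm))

theorem cinv_cinv (A : Coset G) : A.cinv.cinv = A := gpd_inv_inv A

theorem mem_cinv {A : Coset G} {g : G} : g ∈ A.cinv.carrier ↔ ginv g ∈ A.carrier := by
  constructor
  · rintro ⟨a, ha, rfl⟩
    rwa [gpd_inv_inv]
  · intro h
    exact ⟨_, h, (gpd_inv_inv g).symm⟩

theorem ext_of_mem_rng {A B : Coset G} {a : G} (ha : a ∈ A.carrier) (hb : a ∈ B.carrier)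
    (e : A.crng = B.crng) : A = B := by
  have : A.cinv = B.cinv := ext_of_mem (a := ginv a) ⟨a, ha, rfl⟩ ⟨a, hb, rfl⟩
    (by rw [csrc_cinv, csrc_cinv, e])
  rw [← cinv_cinv A, this, cinv_cinv]

/-- The unit of `G` at which the coset starts. -/
def srcPt (A : Coset G) : units G := srcUnit A.nonempty.choose

/-- The unit of `G` at which the coset ends. -/
def rngPt (A : Coset G) : units G := rngUnit A.nonempty.choose

theorem srcUnit_of_mem {A : Coset G} {a : G} (ha : a ∈ A.carrier) : srcUnit a = A.srcPt :=
  Subtype.ext (A.src_eq a ha _ A.nonempty.choose_spec)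

theorem rngUnit_of_mem {A : Coset G} {a : G} (ha : a ∈ A.carrier) : rngUnit a = A.rngPt :=
  Subtype.ext (A.rng_eq a ha _ A.nonempty.choose_spec)

theorem src_of_mem {A : Coset G} {a : G} (ha : a ∈ A.carrier) : src a = A.srcPt :=
  congrArg Subtype.val (srcUnit_of_mem ha)

theorem rng_of_mem {A : Coset G} {a : G} (ha : a ∈ A.carrier) : rng a = A.rngPt :=
  congrArg Subtype.val (rngUnit_of_mem ha)

theorem srcPt_sing (g : G) : (sing g).srcPt = srcUnit g := (srcUnit_of_mem (mem_sing.2 rfl)).symm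

theorem rngPt_sing (g : G) : (sing g).rngPt = rngUnit g := (rngUnit_of_mem (mem_sing.2 rfl)).symm

theorem srcPt_csrc (A : Coset G) : A.csrc.srcPt = A.srcPt := by
  obtain ⟨a, ha⟩ := A.nonempty
  rw [← srcUnit_of_mem (src_mem_csrc ha), ← srcUnit_of_mem ha]
  exact Subtype.ext (gpd_src_src a)

theorem rngPt_cinv (A : Coset G) : A.cinv.rngPt = A.srcPt := by
  obtain ⟨a, ha⟩ := A.nonempty
  rw [← rngUnit_of_mem (A := A.cinv) ⟨a, ha, rfl⟩, ← srcUnit_of_mem ha, rngUnit_inv]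

theorem srcPt_cinv (A : Coset G) : A.cinv.srcPt = A.rngPt := by
  rw [← rngPt_cinv, cinv_cinv]

theorem srcPt_crng (A : Coset G) : A.crng.srcPt = A.rngPt := by
  rw [← csrc_cinv, srcPt_csrc, srcPt_cinv]

/-- The quotient `A B⁻¹` of two cosets with the same source group, in terms of representatives. -/
theorem mem_div_iff {A B : Coset G} (e : A.csrc = B.csrc) {b k : G} (hb : b ∈ B.carrier) :
    k ∈ (gmul A (ginv B)).carrier ↔ src k = rng b ∧ gmul k b ∈ A.carrier := by
  have hc : A.csrc = B.cinv.crng := by rw [crng_cinv, e]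
  change k ∈ (cmul A (cinv B)).carrier ↔ _
  rw [cmul_of hc]
  constructor
  · rintro ⟨a, ha, _, ⟨b', hb', rfl⟩, rfl⟩
    have h1 := src_eq_rng hc ha (b := ginv b') ⟨b', hb', rfl⟩
    have h2 : src (ginv b') = rng b := by rw [src_inv, B.rng_eq b' hb' b hb]
    refine ⟨by rw [src_mul _ _ h1, h2], ?_⟩
    rw [gmul_assoc _ _ _ h1 h2]
    exact mul_csrc_mem ha (e ▸ mem_csrc hb' hb)
  · rintro ⟨h1, h2⟩
    exact ⟨_, h2, _, ⟨b, hb, rfl⟩, (gpd_mul_inv_cancel_right k b h1).symm⟩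

theorem csrc_div {A B : Coset G} (e : A.csrc = B.csrc) : (gmul A (ginv B)).csrc = B.crng :=
  src_div (g := A) (h := B) e.symm

theorem crng_div {A B : Coset G} (e : A.csrc = B.csrc) : (gmul A (ginv B)).crng = A.crng :=
  rng_div (g := A) (h := B) e.symm

end Algebra

section Topology

variable {G : Type*} [TopologicalSpace G] [GroupoidArrows G]

theorem isOpen_meets {U : Set G} (hU : IsOpen U) :
    IsOpen {A : Coset G | (A.carrier ∩ U).Nonempty} :=
  TopologicalSpace.isOpen_generateFrom_of_mem (Or.inr ⟨U, hU, rfl⟩)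

theorem isOpen_misses {K : Set G} (hK : IsCompact K) :
    IsOpen {A : Coset G | A.carrier ∩ K = ∅} :=
  TopologicalSpace.isOpen_generateFrom_of_mem (Or.inl ⟨K, hK, rfl⟩)

/-- `a` is a limit of elements of the cosets `Φ i`. -/
def IsLimPt {ι : Type*} (Φ : ι → Coset G) (l : Filter ι) (a : G) : Prop :=
  ∃ φ : ι → G, Filter.Tendsto φ l (𝓝 a) ∧ ∀ᶠ i in l, φ i ∈ (Φ i).carrier

/-- Fell convergence along an ultrafilter is pointwise convergence to the set of limit points. -/
theorem tendsto_of_forall_isLimPt {ι : Type*} {Φ : ι → Coset G} {l : Ultrafilter ι} {A : Coset G}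
    (h : ∀ k, k ∈ A.carrier ↔ IsLimPt Φ l k) : Filter.Tendsto Φ l (𝓝 A) := by
  rw [TopologicalSpace.tendsto_nhds_generateFrom_iff]
  rintro W (⟨K, hK, rfl⟩ | ⟨U, hU, rfl⟩) hAW
  · by_contra hcon
    have h1 : ∀ᶠ i in (l : Filter ι), ((Φ i).carrier ∩ K).Nonempty := by
      have := Ultrafilter.compl_mem_iff_notMem.2 hcon
      filter_upwards [this] with i hi
      exact Set.nonempty_iff_ne_empty.2 hi
    obtain ⟨i₀, hi₀⟩ := h1.exists
    classical
    set φ : ι → G := fun i => if hi : ((Φ i).carrier ∩ K).Nonempty then hi.choose else hi₀.choose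
    have hφ : ∀ᶠ i in (l : Filter ι), φ i ∈ (Φ i).carrier ∧ φ i ∈ K := by
      filter_upwards [h1] with i hi
      simp only [φ, dif_pos hi]
      exact hi.choose_spec
    obtain ⟨k, hkK, hk⟩ := hK.ultrafilter_le_nhds (l.map φ)
      (Filter.le_principal_iff.2 (hφ.mono fun i hi => hi.2))
    have : k ∈ A.carrier := (h k).2 ⟨φ, hk, hφ.mono fun i hi => hi.1⟩
    have hmem : k ∈ A.carrier ∩ K := ⟨this, hkK⟩
    rw [show A.carrier ∩ K = ∅ from hAW] at hmem
    exact hmem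
  · obtain ⟨k, hkA, hkU⟩ := hAW
    obtain ⟨φ, h1, h2⟩ := (h k).1 hkA
    filter_upwards [h1 (hU.mem_nhds hkU), h2] with i h3 h4
    exact ⟨φ i, h4, h3⟩

variable [IsEtaleGroupoid G]

theorem isLimPt_iff {ι : Type*} {Φ : ι → Coset G} {l : Filter ι} {a : G} :
    IsLimPt Φ l a ↔ ∀ U : Set G, IsOpen U → a ∈ U → ∀ᶠ i in l, ((Φ i).carrier ∩ U).Nonempty := by
  constructor
  · rintro ⟨φ, h1, h2⟩ U hU ha
    filter_upwards [h1 (hU.mem_nhds ha), h2] with i h3 h4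
    exact ⟨φ i, h4, h3⟩
  · intro h
    obtain ⟨U, hU, haU, -, hinj, -⟩ := exists_open_bisection a Filter.univ_mem
    classical
    -- On a bisection the selection is forced, hence convergent.
    refine ⟨fun i => if hi : ((Φ i).carrier ∩ U).Nonempty then hi.choose else a, ?_, ?_⟩
    · rw [tendsto_nhds]
      intro N hN haN
      filter_upwards [h U hU haU, h (U ∩ N) (hU.inter hN) ⟨haU, haN⟩] with i hi hi'
      simp only [Set.mem_preimage, dif_pos hi]
      obtain ⟨b, hb, hbU, hbN⟩ := hi'
      rwa [hinj hi.choose_spec.2 hbU ((Φ i).src_eq _ hi.choose_spec.1 _ hb)]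
    · filter_upwards [h U hU haU] with i hi
      simp only [dif_pos hi]
      exact hi.choose_spec.1

theorem isLimPt_of_mem {ι : Type*} {Φ : ι → Coset G} {l : Filter ι} {A : Coset G}
    (h : Filter.Tendsto Φ l (𝓝 A)) {a : G} (ha : a ∈ A.carrier) : IsLimPt Φ l a :=
  isLimPt_iff.2 fun _ hU haU => h ((isOpen_meets hU).mem_nhds ⟨a, ha, haU⟩)

theorem exists_compact_nhds (g : G) {N : Set G} (hN : N ∈ 𝓝 g) : ∃ K ∈ 𝓝 g, K ⊆ N ∧ IsCompact K := by
  obtain ⟨e, heg, -⟩ := isLocalHomeomorph_rngUnit g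
  have h1 : e.target ∩ e.symm ⁻¹' N ∈ 𝓝 (e g) := Filter.inter_mem
    (e.open_target.mem_nhds (e.map_source heg)) (e.tendsto_symm heg hN)
  obtain ⟨L, hL, hLs, hLc⟩ := local_compact_nhds h1
  refine ⟨e.symm '' L, ?_, ?_, hLc.image_of_continuousOn
    (e.continuousOn_symm.mono fun u hu => (hLs hu).1)⟩
  · have := e.symm.image_mem_nhds (e.map_source heg) hL
    rwa [e.left_inv heg] at this
  · rintro _ ⟨u, hu, rfl⟩
    exact (hLs hu).2

theorem isClosed_carrier (A : Coset G) : IsClosed A.carrier := by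
  rw [← isOpen_compl_iff, isOpen_iff_mem_nhds]
  intro g hg
  by_cases e : rngUnit g = A.rngPt
  · obtain ⟨U, hU, hgU, -, -, hinj⟩ := exists_open_bisection g Filter.univ_mem
    filter_upwards [hU.mem_nhds hgU] with h hh hA
    have := hinj hh hgU ((rng_of_mem hA).trans (congrArg Subtype.val e).symm)
    exact hg (this ▸ hA)
  · have : {u : units G | u ≠ A.rngPt} ∈ 𝓝 (rngUnit g) := isOpen_ne.mem_nhds e
    filter_upwards [continuous_rngUnit.continuousAt this] with h hh hA
    exact hh (rngUnit_of_mem hA)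

theorem exists_compact_nhds_misses {A : Coset G} {g : G} (hg : g ∉ A.carrier) :
    ∃ K ∈ 𝓝 g, IsCompact K ∧ A.carrier ∩ K = ∅ := by
  obtain ⟨K, hK, hKs, hKc⟩ := exists_compact_nhds g (A.isClosed_carrier.isOpen_compl.mem_nhds hg)
  exact ⟨K, hK, hKc, Set.disjoint_iff_inter_eq_empty.1 (Set.disjoint_left.2 fun a ha hK => hKs hK ha)⟩

theorem mem_of_isLimPt {ι : Type*} {Φ : ι → Coset G} {l : Filter ι} [l.NeBot] {A : Coset G}
    (h : Filter.Tendsto Φ l (𝓝 A)) {a : G} (ha : IsLimPt Φ l a) : a ∈ A.carrier := by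
  by_contra hcon
  obtain ⟨K, hK, hKc, hAK⟩ := exists_compact_nhds_misses hcon
  obtain ⟨φ, h1, h2⟩ := ha
  obtain ⟨i, h3, h4, h5⟩ := (h.eventually ((isOpen_misses hKc).mem_nhds hAK)
    |>.and (h2.and (h1 hK))).exists
  have : φ i ∈ (Φ i).carrier ∩ K := ⟨h4, h5⟩
  rw [show (Φ i).carrier ∩ K = ∅ from h3] at this
  exact this

instance : T2Space (Coset G) := by
  have key : ∀ A B : Coset G, ¬ A.carrier ⊆ B.carrier → Disjoint (𝓝 A) (𝓝 B) := by
    intro A B h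
    obtain ⟨g, hgA, hgB⟩ := Set.not_subset.1 h
    obtain ⟨K, hK, hKc, hBK⟩ := exists_compact_nhds_misses hgB
    refine Filter.disjoint_iff.2 ⟨_, (isOpen_meets isOpen_interior).mem_nhds
      ⟨g, hgA, mem_interior_iff_mem_nhds.2 hK⟩, _, (isOpen_misses hKc).mem_nhds hBK, ?_⟩
    refine Set.disjoint_left.2 ?_
    rintro X ⟨x, hxX, hxK⟩ hX
    have : x ∈ X.carrier ∩ K := ⟨hxX, interior_subset hxK⟩
    rw [show X.carrier ∩ K = ∅ from hX] at this
    exact this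
  refine t2Space_iff_disjoint_nhds.2 fun A B hne => ?_
  by_cases h : A.carrier ⊆ B.carrier
  · exact (key B A fun h' => hne (Coset.ext (Set.Subset.antisymm h h'))).symm
  · exact key A B h

/-- Along an ultrafilter of cosets that meet a compact set, the limits of their elements form a
coset, to which the ultrafilter converges. -/
theorem isCompact_meets {K : Set G} (hK : IsCompact K) :
    IsCompact {A : Coset G | (A.carrier ∩ K).Nonempty} := by
  rw [isCompact_iff_ultrafilter_le_nhds]
  intro l hl
  have hl' : ∀ᶠ A in (l : Filter (Coset G)), (A.carrier ∩ K).Nonempty := Filter.le_principal_iff.1 hl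
  have hsrc : ∀ a b, IsLimPt id (l : Filter (Coset G)) a → IsLimPt id (l : Filter (Coset G)) b →
      src a = src b ∧ rng a = rng b := by
    rintro a b ⟨φ, h1, h2⟩ ⟨ψ, h3, h4⟩
    constructor
    · refine congrArg Subtype.val (tendsto_nhds_unique ((continuous_srcUnit.tendsto a).comp h1)
        (((continuous_srcUnit.tendsto b).comp h3).congr' ?_))
      filter_upwards [h2, h4] with A h5 h6
      exact (srcUnit_of_mem h6).trans (srcUnit_of_mem h5).symm
    · refine congrArg Subtype.val (tendsto_nhds_unique ((continuous_rngUnit.tendsto a).comp h1)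
        (((continuous_rngUnit.tendsto b).comp h3).congr' ?_))
      filter_upwards [h2, h4] with A h5 h6
      exact (rngUnit_of_mem h6).trans (rngUnit_of_mem h5).symm
  obtain ⟨k, hkK, hk⟩ : ∃ k ∈ K, IsLimPt id (l : Filter (Coset G)) k := by
    classical
    set φ : Coset G → G := fun A =>
      if hA : (A.carrier ∩ K).Nonempty then hA.choose else A.nonempty.choose
    have hφ : ∀ᶠ A in (l : Filter (Coset G)), φ A ∈ A.carrier ∧ φ A ∈ K := by
      filter_upwards [hl'] with A hA
      simp only [φ, dif_pos hA]
      exact hA.choose_spec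
    obtain ⟨k, hkK, hk⟩ := hK.ultrafilter_le_nhds (l.map φ)
      (Filter.le_principal_iff.2 (hφ.mono fun i hi => hi.2))
    exact ⟨k, hkK, φ, hk, hφ.mono fun i hi => hi.1⟩
  let A₀ : Coset G :=
    { carrier := {a | IsLimPt id (l : Filter (Coset G)) a}
      nonempty := ⟨k, hk⟩
      src_eq := fun a ha b hb => (hsrc a b ha hb).1
      rng_eq := fun a ha b hb => (hsrc a b ha hb).2
      closed := by
        intro a ha b hb c hc
        have e1 := (hsrc a b ha hb).1
        have e2 := (hsrc b c hb hc).2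
        obtain ⟨φ, h1, h2⟩ := ha
        obtain ⟨ψ, h3, h4⟩ := hb
        obtain ⟨χ, h5, h6⟩ := hc
        refine ⟨fun A => gmul (gmul (φ A) (ginv (ψ A))) (χ A), ?_, ?_⟩
        · refine tendsto_gmul (tendsto_gmul h1 ((continuous_ginv.tendsto b).comp h3)
            (by rw [rng_inv, e1]) ?_) h5 (by rw [src_div e1.symm, e2]) ?_
          · filter_upwards [h2, h4] with A h7 h8
            rw [rng_inv, A.src_eq _ h7 _ h8]
          · filter_upwards [h2, h4, h6] with A h7 h8 h9
            rw [src_div (A.src_eq _ h8 _ h7), A.rng_eq _ h8 _ h9]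
        · filter_upwards [h2, h4, h6] with A h7 h8 h9
          exact A.closed _ h7 _ h8 _ h9 }
  exact ⟨A₀, ⟨k, hk, hkK⟩, tendsto_of_forall_isLimPt (Φ := id) fun k => Iff.rfl⟩

instance : LocallyCompactSpace (Coset G) := by
  have : WeaklyLocallyCompactSpace (Coset G) := ⟨fun A => by
    obtain ⟨a, ha⟩ := A.nonempty
    obtain ⟨K, hK, -, hKc⟩ := exists_compact_nhds a Filter.univ_mem
    refine ⟨_, isCompact_meets hKc, ?_⟩
    filter_upwards [(isOpen_meets isOpen_interior).mem_nhds
      ⟨a, ha, mem_interior_iff_mem_nhds.2 hK⟩] with B hB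
    obtain ⟨b, hb, hbK⟩ := hB
    exact ⟨b, hb, interior_subset hbK⟩⟩
  infer_instance

theorem continuous_cinv : Continuous (cinv : Coset G → Coset G) := by
  rw [continuous_iff_ultrafilter]
  intro A l hl
  refine tendsto_of_forall_isLimPt fun k => ?_
  rw [mem_cinv]
  constructor
  · intro hk
    obtain ⟨φ, h1, h2⟩ := isLimPt_of_mem (Φ := id) hl hk
    refine ⟨fun B => ginv (φ B), ?_, ?_⟩
    · have := (continuous_ginv.tendsto _).comp h1
      rwa [gpd_inv_inv] at this
    · filter_upwards [h2] with B hB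
      rw [mem_cinv, gpd_inv_inv]
      exact hB
  · rintro ⟨φ, h1, h2⟩
    refine mem_of_isLimPt (Φ := id) (l := l) (Filter.tendsto_id'.2 hl) ⟨fun B => ginv (φ B),
      (continuous_ginv.tendsto _).comp h1, ?_⟩
    filter_upwards [h2] with B hB
    exact mem_cinv.1 hB

theorem continuous_csrc : Continuous (csrc : Coset G → Coset G) := by
  rw [continuous_iff_ultrafilter]
  intro A l hl
  refine tendsto_of_forall_isLimPt fun k => ?_
  constructor
  · rintro ⟨a, ha, b, hb, rfl⟩
    obtain ⟨φ, h1, h2⟩ := isLimPt_of_mem (Φ := id) hl ha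
    obtain ⟨ψ, h3, h4⟩ := isLimPt_of_mem (Φ := id) hl hb
    refine ⟨fun B => gmul (ginv (φ B)) (ψ B), ?_, ?_⟩
    · refine tendsto_gmul ((continuous_ginv.tendsto a).comp h1) h3
        (by rw [src_inv, A.rng_eq a ha b hb]) ?_
      filter_upwards [h2, h4] with B h5 h6
      exact (src_inv _).trans (B.rng_eq _ h5 _ h6)
    · filter_upwards [h2, h4] with B h5 h6
      exact mem_csrc h5 h6
  · rintro ⟨φ, h1, h2⟩
    obtain ⟨c, hc⟩ := A.nonempty
    obtain ⟨ψ, h3, h4⟩ := isLimPt_of_mem (Φ := id) hl hc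
    have ev : ∀ᶠ B in (l : Filter (Coset G)), src (ψ B) = rng (φ B) := by
      filter_upwards [h2, h4] with B h5 h6
      exact (src_of_mem_csrc h6 h5).2.symm
    have e : src c = rng k := by
      refine congrArg Subtype.val (tendsto_nhds_unique ((continuous_srcUnit.tendsto c).comp h3)
        (((continuous_rngUnit.tendsto k).comp h1).congr' ?_))
      filter_upwards [ev] with B hB
      exact Subtype.ext hB.symm
    have : gmul c k ∈ A.carrier := by
      refine mem_of_isLimPt (Φ := id) (l := l) (Filter.tendsto_id'.2 hl) ⟨_, tendsto_gmul h3 h1 e ev, ?_⟩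
      filter_upwards [h2, h4] with B h5 h6
      exact mul_csrc_mem h6 h5
    exact ⟨c, hc, _, this, (gpd_inv_cancel_left c k e).symm⟩

theorem continuous_crng : Continuous (crng : Coset G → Coset G) := by
  have : (crng : Coset G → Coset G) = csrc ∘ cinv := funext fun A => (csrc_cinv A).symm
  rw [this]
  exact continuous_csrc.comp continuous_cinv

theorem continuous_srcPt : Continuous (srcPt : Coset G → units G) := by
  rw [continuous_iff_continuousAt]
  intro A
  obtain ⟨a, ha⟩ := A.nonempty
  obtain ⟨φ, h1, h2⟩ := isLimPt_of_mem (Φ := id) (Filter.tendsto_id (x := 𝓝 A)) ha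
  have := (continuous_srcUnit.tendsto a).comp h1
  rw [srcUnit_of_mem ha] at this
  refine this.congr' ?_
  filter_upwards [h2] with B hB
  exact srcUnit_of_mem hB

theorem continuous_rngPt : Continuous (rngPt : Coset G → units G) := by
  have : (rngPt : Coset G → units G) = srcPt ∘ cinv := funext fun A => (srcPt_cinv A).symm
  rw [this]
  exact continuous_srcPt.comp continuous_cinv

/-- Moving arrows `z` that converge to a group `X` in the Fell topology by sections through
elements of two cosets of `X`, one obtains convergence to the quotient of these cosets. -/
theorem tendsto_sing_div {ι : Type*} {l : Filter ι} {z p q : ι → G} {A B X : Coset G}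
    (hA : A.csrc = X) (hB : B.csrc = X) {a b : G} (ha : a ∈ A.carrier) (hb : b ∈ B.carrier)
    (hz : Filter.Tendsto (fun i => sing (z i)) l (𝓝 X)) (hp : Filter.Tendsto p l (𝓝 a))
    (hq : Filter.Tendsto q l (𝓝 b)) (hpz : ∀ᶠ i in l, src (p i) = z i)
    (hqz : ∀ᶠ i in l, src (q i) = z i) :
    Filter.Tendsto (fun i => sing (gmul (p i) (ginv (q i)))) l (𝓝 (gmul A (ginv B))) := by
  rw [Filter.tendsto_iff_ultrafilter]
  intro g hg
  replace hz := hz.mono_left hg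
  replace hp := hp.mono_left hg
  replace hq := hq.mono_left hg
  replace hpz := hpz.filter_mono hg
  replace hqz := hqz.filter_mono hg
  have hAB : A.csrc = B.csrc := hA.trans hB.symm
  refine tendsto_of_forall_isLimPt fun k => ?_
  rw [mem_div_iff hAB hb]
  have esrc : src a = src b := by
    have h1 := src_of_mem_csrc ha (x := src a) (src_mem_csrc ha)
    have h2 := src_of_mem_csrc hb (x := src a) (hAB ▸ src_mem_csrc ha)
    rw [← h2.1, h1.1]
  constructor
  · rintro ⟨h1, h2⟩
    have hx : gmul (ginv a) (gmul k b) ∈ X.carrier := hA ▸ mem_csrc ha h2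
    obtain ⟨φ, h3, h4⟩ := isLimPt_of_mem hz hx
    have h5 : Filter.Tendsto z g (𝓝 (gmul (ginv a) (gmul k b))) := by
      refine h3.congr' ?_
      filter_upwards [h4] with i hi
      exact hi
    have ek : rng a = rng (gmul k b) := A.rng_eq _ ha _ h2
    have ekb : rng k = rng (gmul k b) := (rng_mul _ _ h1).symm
    have h6 := tendsto_gmul (tendsto_gmul hp h5
      (by rw [rng_mul _ _ (by rw [src_inv, ek]), rng_inv])
      (by filter_upwards [hpz] with i hi; rw [← hi, gpd_rng_src]))
      ((continuous_ginv.tendsto b).comp hq) (by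
        rw [src_mul _ _ (by rw [rng_mul _ _ (by rw [src_inv, ek]), rng_inv]),
          src_mul _ _ (by rw [src_inv, ek]), src_mul _ _ h1, rng_inv])
      (by
        filter_upwards [hpz, hqz] with i h7 h8
        rw [src_mul _ _ (by rw [← h7, gpd_rng_src]), Function.comp_apply, rng_inv, h8, ← h7,
          gpd_src_src])
    rw [gpd_cancel_inv_left _ _ ek, gpd_mul_inv_cancel_right _ _ h1] at h6
    refine ⟨_, h6, ?_⟩
    filter_upwards [hpz] with i hi
    rw [← hi, gmul_src]
    rfl
  · rintro ⟨φ, h1, h2⟩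
    have h3 : Filter.Tendsto (fun i => gmul (p i) (ginv (q i))) g (𝓝 k) := by
      refine h1.congr' ?_
      filter_upwards [h2] with i hi
      exact hi
    have es : ∀ᶠ i in (g : Filter ι), src (q i) = src (p i) := by
      filter_upwards [hpz, hqz] with i h4 h5
      rw [h4, h5]
    have ek : src k = rng b := by
      refine congrArg Subtype.val (tendsto_nhds_unique ((continuous_srcUnit.tendsto k).comp h3)
        (((continuous_rngUnit.tendsto b).comp hq).congr' ?_))
      filter_upwards [es] with i hi
      exact Subtype.ext (src_div hi).symm
    have ek' : rng k = rng a := by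
      refine congrArg Subtype.val (tendsto_nhds_unique ((continuous_rngUnit.tendsto k).comp h3)
        (((continuous_rngUnit.tendsto a).comp hp).congr' ?_))
      filter_upwards [es] with i hi
      exact Subtype.ext (rng_div hi).symm
    refine ⟨ek, ?_⟩
    have h4 := tendsto_gmul ((continuous_ginv.tendsto a).comp hp) (tendsto_gmul h3 hq ek (by
      filter_upwards [es] with i hi
      exact src_div hi)) (by rw [src_inv, rng_mul _ _ ek, ek']) (by
      filter_upwards [es] with i hi
      rw [Function.comp_apply, src_inv, rng_mul _ _ (src_div hi), rng_div hi])
    have hx : gmul (ginv a) (gmul k b) ∈ X.carrier := by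
      refine mem_of_isLimPt hz ⟨_, h4, ?_⟩
      filter_upwards [hpz, hqz, es] with i h5 h6 h7
      rw [Function.comp_apply, gpd_inv_mul_cancel_right _ _ h7.symm, ginv_gmul, h5]
      rfl
    have := mul_csrc_mem ha (hA.symm ▸ hx)
    rwa [gpd_cancel_inv_left _ _ (by rw [rng_mul _ _ ek, ek'])] at this

end Topology

end Coset

/-! ### Convolution algebras of sets of cosets -/

section

variable {G : Type*} [TopologicalSpace G] [GroupoidArrows G]

theorem isOpenBisection_univ_iff {U : Set G} :
    IsOpenBisection Set.univ U ↔ IsOpen U ∧ Set.InjOn src U ∧ Set.InjOn rng U := by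
  unfold IsOpenBisection
  constructor
  · rintro ⟨⟨V, hV, rfl⟩, h⟩
    exact ⟨by rwa [Set.inter_univ], h⟩
  · rintro ⟨h, h'⟩
    exact ⟨⟨U, h, (Set.inter_univ U).symm⟩, h'⟩

theorem bisectionBounded_of_mem {S : Set G} {f : G → ℂ} (hf : f ∈ convolutionAlgebra S) :
    BisectionBounded f := by
  induction hf using Submodule.span_induction with
  | mem f h =>
    obtain ⟨U, hU, hc, K, hKU, hK, h0⟩ := h
    obtain ⟨c, hcb⟩ := hK.exists_bound_of_continuousOn (hc.mono hKU)
    refine ⟨1, fun _ => U, max c 0, le_max_right _ _, fun _ => hU.2, fun g hg => ⟨0, hKU ?_⟩, ?_⟩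
    · by_contra hcon
      exact hg (h0 g hcon)
    · intro g
      by_cases hg : g ∈ K
      · exact (hcb g hg).trans (le_max_left _ _)
      · rw [h0 g hg, norm_zero]
        exact le_max_right _ _
  | zero => exact BisectionBounded.zero
  | add f f' _ _ h h' => exact h.add h'
  | smul c f _ h => exact h.smul c

/-- Elements of `𝒞_c(S)` as finite sums of functions supported on open bisections. -/
theorem exists_sum_of_mem {S : Set G} {f : G → ℂ} (hf : f ∈ convolutionAlgebra S) :
    ∃ (n : ℕ) (φ : Fin n → G → ℂ) (U K : Fin n → Set G), f = ∑ i, φ i ∧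
      ∀ i, IsOpenBisection S (U i) ∧ ContinuousOn (φ i) (U i) ∧ K i ⊆ U i ∧ IsCompact (K i) ∧
        ∀ g ∉ K i, φ i g = 0 := by
  induction hf using Submodule.span_induction with
  | mem f h =>
    obtain ⟨U, hU, hc, K, hKU, hK, h0⟩ := h
    exact ⟨1, fun _ => f, fun _ => U, fun _ => K, by simp, fun _ => ⟨hU, hc, hKU, hK, h0⟩⟩
  | zero => exact ⟨0, fun i => i.elim0, fun i => i.elim0, fun i => i.elim0, by simp,
      fun i => i.elim0⟩
  | add f f' _ _ h h' =>
    obtain ⟨n, φ, U, K, rfl, h⟩ := h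
    obtain ⟨n', φ', U', K', rfl, h'⟩ := h'
    refine ⟨n + n', Fin.append φ φ', Fin.append U U', Fin.append K K', ?_, fun i => ?_⟩
    · rw [Fin.sum_univ_add]
      simp
    · refine Fin.addCases (fun i => ?_) (fun i => ?_) i
      · simpa using h i
      · simpa using h' i
  | smul c f _ h =>
    obtain ⟨n, φ, U, K, rfl, h⟩ := h
    refine ⟨n, fun i => c • φ i, U, K, by rw [Finset.smul_sum], fun i => ?_⟩
    obtain ⟨h1, h2, h3, h4, h5⟩ := h i
    exact ⟨h1, h2.const_smul c, h3, h4, fun g hg => by simp [h5 g hg]⟩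

end

namespace Coset

section Injectivity

variable {G : Type*} [GroupoidArrows G]

theorem injOn_src_meets {U : Set G} (hU : Set.InjOn src U) :
    Set.InjOn src {A : Coset G | (A.carrier ∩ U).Nonempty} := by
  rintro A ⟨a, haA, haU⟩ B ⟨b, hbB, hbU⟩ (e : A.csrc = B.csrc)
  have h := src_of_mem_csrc hbB (e ▸ src_mem_csrc haA)
  rw [gpd_src_src] at h
  exact ext_of_mem haA (hU haU hbU h.1 ▸ hbB) e

theorem injOn_rng_meets {U : Set G} (hU : Set.InjOn rng U) :
    Set.InjOn rng {A : Coset G | (A.carrier ∩ U).Nonempty} := by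
  rintro A ⟨a, haA, haU⟩ B ⟨b, hbB, hbU⟩ (e : A.crng = B.crng)
  have h1 : A.rngPt = B.rngPt := by rw [← srcPt_crng, e, srcPt_crng]
  have h : rng a = rng b := by rw [rng_of_mem haA, rng_of_mem hbB, h1]
  exact ext_of_mem_rng haA (hU haU hbU h ▸ hbB) e

end Injectivity

variable {G : Type*} [TopologicalSpace G] [GroupoidArrows G] [IsEtaleGroupoid G]

theorem exists_bisection_cover {K : Set (Coset G)} (hK : IsCompact K) :
    ∃ (n : ℕ) (U : Fin n → Set G), (∀ i, IsOpen (U i) ∧ Set.InjOn src (U i) ∧ Set.InjOn rng (U i)) ∧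
      K ⊆ ⋃ i, {A | (A.carrier ∩ U i).Nonempty} := by
  choose a ha using fun A : Coset G => A.nonempty
  choose V hV haV _ hVs hVr using fun A => exists_open_bisection (a A) Filter.univ_mem
  obtain ⟨t, ht⟩ := hK.elim_finite_subcover (fun A => {B : Coset G | (B.carrier ∩ V A).Nonempty})
    (fun A => isOpen_meets (hV A)) fun A _ => Set.mem_iUnion.2 ⟨A, a A, ha A, haV A⟩
  refine ⟨t.card, fun i => V (t.equivFin.symm i), fun i => ⟨hV _, hVs _, hVr _⟩, fun A hA => ?_⟩
  obtain ⟨B, hB, hAB⟩ := Set.mem_iUnion₂.1 (ht hA)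
  refine Set.mem_iUnion.2 ⟨t.equivFin ⟨B, hB⟩, ?_⟩
  simpa using hAB

/-- Since the space of cosets is Hausdorff, `𝒞_c(S)` consists of the continuous compactly supported
functions on `S`, extended by zero. -/
theorem mem_convolutionAlgebra_iff {S : Set (Coset G)} {f : Coset G → ℂ} :
    f ∈ convolutionAlgebra S ↔
      ContinuousOn f S ∧ ∃ K ⊆ S, IsCompact K ∧ ∀ A ∉ K, f A = 0 := by
  constructor
  · intro hf
    induction hf using Submodule.span_induction with
    | mem f h =>
      obtain ⟨U, ⟨⟨V, hV, hUV⟩, -⟩, hc, K, hKU, hK, h0⟩ := h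
      have hUS : U ⊆ S := hUV ▸ Set.inter_subset_right
      refine ⟨fun A hA => ?_, K, hKU.trans hUS, hK, h0⟩
      by_cases hAU : A ∈ U
      · refine (hc A hAU).mono_of_mem_nhdsWithin ?_
        rw [hUV] at hAU ⊢
        exact Filter.inter_mem (mem_nhdsWithin_of_mem_nhds (hV.mem_nhds hAU.1)) self_mem_nhdsWithin
      · have : ∀ᶠ B in 𝓝 A, f B = 0 := by
          filter_upwards [hK.isClosed.isOpen_compl.mem_nhds fun h => hAU (hKU h)] with B hB
          exact h0 B hB
        refine ContinuousAt.continuousWithinAt ?_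
        exact continuousAt_const.congr (this.mono fun B hB => hB.symm)
    | zero => exact ⟨continuousOn_const, ∅, Set.empty_subset _, isCompact_empty, fun _ _ => rfl⟩
    | add f f' _ _ h h' =>
      obtain ⟨h1, K, h2, h3, h4⟩ := h
      obtain ⟨h1', K', h2', h3', h4'⟩ := h'
      refine ⟨h1.add h1', K ∪ K', Set.union_subset h2 h2', h3.union h3', fun A hA => ?_⟩
      rw [Set.mem_union, not_or] at hA
      simp [h4 A hA.1, h4' A hA.2]
    | smul c f _ h =>
      obtain ⟨h1, K, h2, h3, h4⟩ := h
      exact ⟨h1.const_smul c, K, h2, h3, fun A hA => by simp [h4 A hA]⟩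
  · rintro ⟨hc, K, hKS, hK, h0⟩
    obtain ⟨n, U, hU, hcov⟩ := exists_bisection_cover hK
    obtain ⟨ρ, hρ, hone, -, -⟩ := exists_continuous_sum_one_of_isOpen_isCompact
      (s := fun i => {A : Coset G | (A.carrier ∩ U i).Nonempty}) (fun i => isOpen_meets (hU i).1)
      hK hcov
    have e : f = ∑ i, fun A => (ρ i A : ℂ) * f A := by
      ext A
      rw [Finset.sum_apply, ← Finset.sum_mul]
      by_cases hA : A ∈ K
      · have := hone hA
        simp only [Finset.sum_apply, Pi.one_apply] at this
        rw [← Complex.ofReal_sum, this, Complex.ofReal_one, one_mul]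
      · rw [h0 A hA, mul_zero]
    rw [e]
    refine Submodule.sum_mem _ fun i _ => Submodule.subset_span
      ⟨{A : Coset G | (A.carrier ∩ U i).Nonempty} ∩ S, ⟨⟨_, isOpen_meets (hU i).1, rfl⟩,
        (injOn_src_meets (hU i).2.1).mono Set.inter_subset_left,
        (injOn_rng_meets (hU i).2.2).mono Set.inter_subset_left⟩, ?_,
        tsupport (ρ i) ∩ K, Set.inter_subset_inter (hρ i) hKS,
        hK.inter_left (isClosed_tsupport _), fun A hA => ?_⟩
    · exact (Complex.continuous_ofReal.comp (ρ i).continuous).continuousOn.mul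
        (hc.mono Set.inter_subset_right)
    · rw [Set.mem_inter_iff, not_and_or] at hA
      rcases hA with hA | hA
      · simp [image_eq_zero_of_notMem_tsupport hA]
      · simp [h0 A hA]

theorem indicator_mem_convolutionAlgebra {S T : Set (Coset G)} {f : Coset G → ℂ} (hT : IsClosed T)
    (hST : T ⊆ S) (hf : f ∈ convolutionAlgebra S) :
    T.indicator f ∈ convolutionAlgebra T := by
  rw [mem_convolutionAlgebra_iff] at hf ⊢
  obtain ⟨h1, K, h2, h3, h4⟩ := hf
  refine ⟨?_, K ∩ T, Set.inter_subset_right, h3.inter_right hT, fun A hA => ?_⟩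
  · exact (h1.mono hST).congr fun A hA => Set.indicator_of_mem hA f
  · by_cases hAT : A ∈ T
    · rw [Set.indicator_of_mem hAT]
      exact h4 A fun hK => hA ⟨hK, hAT⟩
    · exact Set.indicator_of_notMem hAT f

end Coset

/-! ### The function on cosets defined by a function on arrows -/

section Tilde

variable {G : Type*} [GroupoidArrows G]

/-- The function `A ↦ ∑_{a ∈ A} f(a)` on cosets. -/
def sumOnCosets (f : G → ℂ) (A : Coset G) : ℂ := ∑ᶠ a ∈ A.carrier, f a

theorem sumOnCosets_sing (f : G → ℂ) (g : G) : sumOnCosets f (Coset.sing g) = f g :=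
  finsum_mem_singleton

theorem finite_inter_support {f : G → ℂ} (hf : BisectionBounded f) (A : Coset G) :
    (A.carrier ∩ Function.support f).Finite := by
  obtain ⟨n, U, c, hc, hU, hf, -⟩ := hf
  refine (Set.finite_iUnion (f := fun m => A.carrier ∩ U m) fun m =>
    Set.Subsingleton.finite ?_).subset fun a ha => ?_
  · rintro a ⟨ha, haU⟩ b ⟨hb, hbU⟩
    exact (hU m).1 haU hbU (A.src_eq a ha b hb)
  · obtain ⟨m, hm⟩ := hf a ha.2
    exact Set.mem_iUnion.2 ⟨m, ha.1, hm⟩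

theorem sumOnCosets_add {f f' : G → ℂ} (hf : BisectionBounded f) (hf' : BisectionBounded f') :
    sumOnCosets (f + f') = sumOnCosets f + sumOnCosets f' :=
  funext fun A => finsum_mem_add_distrib' (finite_inter_support hf A) (finite_inter_support hf' A)

theorem sumOnCosets_smul (f : G → ℂ) (c : ℂ) : sumOnCosets (c • f) = c • sumOnCosets f := by
  ext A
  simp only [sumOnCosets, Pi.smul_apply]
  simp_rw [← smul_finsum]

theorem sumOnCosets_zero : sumOnCosets (0 : G → ℂ) = 0 := by
  ext A
  simp [sumOnCosets]

theorem sumOnCosets_of_mem {f : G → ℂ} {U : Set G} (hU : Set.InjOn src U) (h0 : ∀ g ∉ U, f g = 0)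
    {A : Coset G} {a : G} (ha : a ∈ A.carrier) (haU : a ∈ U) : sumOnCosets f A = f a := by
  rw [sumOnCosets, ← finsum_mem_singleton (f := f) (a := a)]
  refine finsum_mem_inter_support_eq' f _ _ fun b hb => ?_
  have hbU : b ∈ U := by
    by_contra hcon
    exact hb (h0 b hcon)
  constructor
  · intro hbA
    exact hU hbU haU (A.src_eq b hbA a ha)
  · rintro rfl
    exact ha

theorem sumOnCosets_of_disjoint {f : G → ℂ} {K : Set G} (h0 : ∀ g ∉ K, f g = 0) {A : Coset G}
    (hA : ¬ (A.carrier ∩ K).Nonempty) : sumOnCosets f A = 0 := by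
  refine finsum_mem_eq_zero_of_forall_eq_zero fun a ha => h0 a fun haK => hA ⟨a, ha, haK⟩

variable [TopologicalSpace G] [IsEtaleGroupoid G]

theorem sumOnCosets_mem {f : G → ℂ} (hf : f ∈ convolutionAlgebra Set.univ) :
    sumOnCosets f ∈ convolutionAlgebra Set.univ := by
  induction hf using Submodule.span_induction with
  | mem f h =>
    obtain ⟨U, hU, hc, K, hKU, hK, h0⟩ := h
    obtain ⟨hUo, hUs, -⟩ := isOpenBisection_univ_iff.1 hU
    have h0' : ∀ g ∉ U, f g = 0 := fun g hg => h0 g fun h => hg (hKU h)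
    rw [Coset.mem_convolutionAlgebra_iff]
    refine ⟨?_, _, Set.subset_univ _, Coset.isCompact_meets hK, fun A hA =>
      sumOnCosets_of_disjoint h0 hA⟩
    rw [continuousOn_univ, continuous_iff_continuousAt]
    intro A
    by_cases hA : (A.carrier ∩ U).Nonempty
    · obtain ⟨a, haA, haU⟩ := hA
      obtain ⟨φ, h1, h2⟩ := Coset.isLimPt_of_mem (Φ := id) (Filter.tendsto_id (x := 𝓝 A)) haA
      have h3 := (hc.continuousAt (hUo.mem_nhds haU)).tendsto.comp h1
      rw [ContinuousAt, sumOnCosets_of_mem hUs h0' haA haU]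
      refine h3.congr' ?_
      filter_upwards [h2, h1 (hUo.mem_nhds haU)] with B h4 h5
      exact (sumOnCosets_of_mem hUs h0' h4 h5).symm
    · have hA' : A.carrier ∩ K = ∅ := by
        refine Set.not_nonempty_iff_eq_empty.1 fun h => hA (h.mono ?_)
        exact Set.inter_subset_inter_right _ hKU
      refine (continuousAt_const (y := (0 : ℂ))).congr ?_
      filter_upwards [(Coset.isOpen_misses hK).mem_nhds hA'] with B hB
      exact (sumOnCosets_of_disjoint h0 (Set.not_nonempty_iff_eq_empty.2 hB)).symm
  | zero =>
    rw [sumOnCosets_zero]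
    exact Submodule.zero_mem _
  | add f f' hf hf' h h' =>
    rw [sumOnCosets_add (bisectionBounded_of_mem hf) (bisectionBounded_of_mem hf')]
    exact Submodule.add_mem _ h h'
  | smul c f _ h =>
    rw [sumOnCosets_smul]
    exact Submodule.smul_mem _ c h

end Tilde

/-! ### The essential Hausdorff cover -/

section EssCover

open Coset

variable {G : Type*} [TopologicalSpace G] [GroupoidArrows G]

theorem essUnits_eq : essUnits G = closure (sing '' hausdorffUnits G) := by
  unfold essUnits
  congr 1
  ext A
  constructor
  · rintro ⟨x, hx, h⟩
    exact ⟨x, hx, (eq_sing_iff.2 h).symm⟩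
  · rintro ⟨x, hx, rfl⟩
    exact ⟨x, hx, rfl⟩

theorem sing_mem_essUnits {x : G} (hx : x ∈ hausdorffUnits G) : sing x ∈ essUnits G := by
  rw [essUnits_eq]
  exact subset_closure ⟨x, hx, rfl⟩

theorem exists_filter_of_mem_essUnits {X : Coset G} (hX : X ∈ essUnits G) :
    ∃ l : Filter G, l.NeBot ∧ (∀ᶠ z in l, z ∈ hausdorffUnits G) ∧
      Filter.Tendsto sing l (𝓝 X) := by
  rw [essUnits_eq, mem_closure_iff_comap_neBot] at hX
  refine ⟨Filter.comap sing (𝓝 X) ⊓ Filter.principal (hausdorffUnits G), ?_,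
    Filter.mem_inf_of_right (Filter.mem_principal_self _),
    Filter.tendsto_comap.mono_left inf_le_left⟩
  rw [Filter.comap_neBot_iff] at hX
  rw [Filter.inf_principal_neBot_iff]
  intro W hW
  obtain ⟨N, hN, hNW⟩ := Filter.mem_comap.1 hW
  obtain ⟨⟨_, x, hx, rfl⟩, ha⟩ := hX N hN
  exact ⟨x, hNW ha, hx⟩

theorem isClosed_essUnits : IsClosed (essUnits G) := isClosed_closure

theorem crng_mem_essUnits {A : Coset G} (hA : A ∈ essCover G) : A.crng ∈ essUnits G := hA.2.2

variable [IsEtaleGroupoid G]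

theorem csrc_of_mem_essUnits {X : Coset G} (hX : X ∈ essUnits G) : X.csrc = X := by
  rw [essUnits_eq] at hX
  refine closure_minimal (t := {X : Coset G | X.csrc = X}) ?_
    (isClosed_eq continuous_csrc continuous_id) hX
  rintro _ ⟨x, hx, rfl⟩
  change (sing x).csrc = _
  rw [csrc_sing, src_eq_self hx.1]

theorem isClosed_essCover : IsClosed (essCover G) :=
  isClosed_closure.inter ((isClosed_essUnits.preimage continuous_csrc).inter
    (isClosed_essUnits.preimage continuous_crng))

theorem sing_mem_essCover {g : G} (hg : src g ∈ hausdorffUnits G) : sing g ∈ essCover G := by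
  refine ⟨subset_closure ⟨g, rfl⟩, ?_, ?_⟩
  · change (sing g).csrc ∈ _
    rw [csrc_sing]
    exact sing_mem_essUnits hg
  · change (sing g).crng ∈ _
    rw [crng_sing]
    exact sing_mem_essUnits (rng_mem_hausdorffUnits hg)

/-- Sections through an arrow `a`, composed with a family of units converging in the Fell topology
to a group that contains the source of `a`. -/
theorem exists_section_of_tendsto_sing {ι : Type*} {l : Filter ι} {z : ι → G} {X : Coset G}
    (hz : Filter.Tendsto (fun i => sing (z i)) l (𝓝 X)) (hu : ∀ᶠ i in l, z i ∈ units G) {a : G}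
    (ha : src a ∈ X.carrier) :
    ∃ p : ι → G, Filter.Tendsto p l (𝓝 a) ∧ ∀ᶠ i in l, src (p i) = z i := by
  obtain ⟨σ, h1, -, h3⟩ := exists_src_section a
  obtain ⟨φ, h4, h5⟩ := isLimPt_of_mem hz ha
  have h6 : Filter.Tendsto z l (𝓝 (src a)) := h4.congr' (h5.mono fun i hi => hi)
  have h7 : Filter.Tendsto (fun i => srcUnit (z i)) l (𝓝 (srcUnit a)) := by
    have := (continuous_srcUnit.tendsto (src a)).comp h6
    rwa [show srcUnit (src a) = srcUnit a from Subtype.ext (gpd_src_src a)] at this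
  refine ⟨fun i => σ (srcUnit (z i)), h1.comp h7, ?_⟩
  filter_upwards [h7.eventually h3, hu] with i h8 h9
  have := congrArg Subtype.val h8
  exact this.trans (src_eq_self h9)

theorem tendsto_sing_of_section {ι : Type*} {l : Filter ι} {z p : ι → G} {A X : Coset G}
    (hA : A.csrc = X) {a : G} (ha : a ∈ A.carrier)
    (hz : Filter.Tendsto (fun i => sing (z i)) l (𝓝 X)) (hu : ∀ᶠ i in l, z i ∈ units G)
    (hp : Filter.Tendsto p l (𝓝 a)) (hpz : ∀ᶠ i in l, src (p i) = z i) :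
    Filter.Tendsto (fun i => sing (p i)) l (𝓝 A) := by
  have hX : X.csrc = X := by
    rw [← hA]
    exact gpd_src_src A
  have hsa : src a ∈ X.carrier := hA ▸ src_mem_csrc ha
  obtain ⟨φ, h4, h5⟩ := isLimPt_of_mem hz hsa
  have hzt : Filter.Tendsto z l (𝓝 (src a)) := h4.congr' (h5.mono fun i hi => hi)
  have := tendsto_sing_div hA hX ha hsa hz hp hzt hpz (hu.mono fun i hi => src_eq_self hi)
  have e : gmul A (ginv X) = A := by
    rw [ginv_eq_self (u := X) hX, ← hA]
    exact gmul_src A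
  rw [e] at this
  refine this.congr' ?_
  filter_upwards [hu, hpz] with i h1 h2
  rw [ginv_eq_self h1, ← h2, gmul_src]

/-- A coset `A` with source group in `G̃⁰_ess` is a limit of arrows with Hausdorff sources: these
arrows are taken on a local section through an element of `A`. -/
theorem mem_essCover_of_csrc {A : Coset G} (hA : A.csrc ∈ essUnits G) : A ∈ essCover G := by
  obtain ⟨l, hl, hC, hz⟩ := exists_filter_of_mem_essUnits hA
  obtain ⟨a, ha⟩ := A.nonempty
  have hu : ∀ᶠ z in l, z ∈ units G := hC.mono fun z hz => hz.1
  obtain ⟨p, hp, hpz⟩ := exists_section_of_tendsto_sing hz hu (src_mem_csrc ha)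
  refine isClosed_essCover.mem_of_tendsto (tendsto_sing_of_section rfl ha hz hu hp hpz) ?_
  filter_upwards [hC, hpz] with z h1 h2
  exact sing_mem_essCover (by rwa [h2])

theorem mem_essCover_iff {A : Coset G} : A ∈ essCover G ↔ A.csrc ∈ essUnits G :=
  ⟨fun h => h.2.1, mem_essCover_of_csrc⟩

theorem div_mem_essCover {A B : Coset G} (hB : B ∈ essCover G)
    (e : A.csrc = B.csrc) : gmul A (ginv B) ∈ essCover G := by
  rw [mem_essCover_iff, csrc_div e]
  exact crng_mem_essUnits hB

end EssCover

/-! ### Cutting off functions near a unit -/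

section Cut

variable {E : Type*} [GroupoidArrows E]

/-- The function `g ↦ α(r(g)) f(g) α(s(g))`. -/
def cut (α : E → ℂ) (f : E → ℂ) (g : E) : ℂ := α (rng g) * f g * α (src g)

theorem norm_cut_le {α : E → ℂ} (hα : ∀ g, ‖α g‖ ≤ 1) (f : E → ℂ) (g : E) :
    ‖cut α f g‖ ≤ ‖f g‖ := by
  unfold cut
  rw [norm_mul, norm_mul]
  calc _ ≤ 1 * ‖f g‖ * 1 := by gcongr <;> exact hα _
    _ = _ := by ring

theorem BisectionBounded.cut {α f : E → ℂ} (hf : BisectionBounded f) (hα : ∀ g, ‖α g‖ ≤ 1) :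
    BisectionBounded (cut α f) := hf.of_norm_le (norm_cut_le hα f)

theorem kern_cut (α f : E → ℂ) (g h : E) :
    kern (cut α f) g h = α (rng g) * kern f g h * α (rng h) := by
  by_cases e : src h = src g
  · rw [kern_of_eq _ e, kern_of_eq _ e, cut, src_div e, rng_div e]
  · rw [kern_of_ne _ e, kern_of_ne _ e, mul_zero, zero_mul]

theorem KerBound.cut {α f : E → ℂ} {S : Set E} {c : ℝ} (h : KerBound (kern f) S c) (hc : 0 ≤ c)
    (hα : ∀ g, ‖α g‖ ≤ 1) : KerBound (kern (cut α f)) S c :=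
  (h.mul_diag hc (a := fun g => α (rng g)) (b := fun g => α (rng g)) (fun _ => hα _)
    fun _ => hα _).congr fun g _ h _ => kern_cut α f g h

theorem reducedNorm_cut_le {α f : E → ℂ} (hf : BisectionBounded f) (hα : ∀ g, ‖α g‖ ≤ 1)
    (S : Set E) : reducedNorm S (cut α f) ≤ reducedNorm S f :=
  reducedNorm_le (hf.cut hα) (reducedNorm_nonneg _ _)
    ((kerBound_reducedNorm hf S).cut (reducedNorm_nonneg _ _) hα)

theorem cut_add (α f f' : E → ℂ) : cut α (f + f') = cut α f + cut α f' := by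
  ext g
  simp only [cut, Pi.add_apply]
  ring

theorem cut_smul (α : E → ℂ) (c : ℂ) (f : E → ℂ) : cut α (c • f) = c • cut α f := by
  ext g
  simp only [cut, Pi.smul_apply, smul_eq_mul]
  ring

end Cut

section CutUnits

variable {G : Type*} [GroupoidArrows G]

/-- The function `φ f φ` on `G`. -/
def cutArrows (φ : units G → ℝ) : (G → ℂ) → G → ℂ := cut fun g => (φ (srcUnit g) : ℂ)

/-- The function `φ f φ` on the space of cosets. -/
def cutCosets (φ : units G → ℝ) : (Coset G → ℂ) → Coset G → ℂ := cut fun A => (φ A.srcPt : ℂ)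

theorem cutArrows_apply (φ : units G → ℝ) (f : G → ℂ) (g : G) :
    cutArrows φ f g = φ (rngUnit g) * f g * φ (srcUnit g) := by
  unfold cutArrows cut
  beta_reduce
  rw [show srcUnit (rng g) = rngUnit g from Subtype.ext (gpd_src_rng g),
    show srcUnit (src g) = srcUnit g from Subtype.ext (gpd_src_src g)]

theorem cutCosets_apply (φ : units G → ℝ) (f : Coset G → ℂ) (A : Coset G) :
    cutCosets φ f A = φ A.rngPt * f A * φ A.srcPt := by
  unfold cutCosets cut
  change ((φ A.crng.srcPt : ℝ) : ℂ) * f A * (φ A.csrc.srcPt : ℝ) = _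
  rw [Coset.srcPt_crng, Coset.srcPt_csrc]

end CutUnits

/-- A continuous function `G⁰ → [0,1]` with value `1` at `x` that vanishes outside `V`. -/
structure IsCutoff {G : Type*} [TopologicalSpace G] [GroupoidArrows G] (x : units G)
    (V : Set (units G)) (φ : units G → ℝ) : Prop where
  continuous : Continuous φ
  apply_self : φ x = 1
  mem_Icc : ∀ u, φ u ∈ Set.Icc (0 : ℝ) 1
  eq_zero : ∀ u ∉ V, φ u = 0

section Cutoff

variable {G : Type*} [TopologicalSpace G] [GroupoidArrows G]

theorem IsCutoff.norm_le {x : units G} {V : Set (units G)} {φ : units G → ℝ} (h : IsCutoff x V φ)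
    (u : units G) : ‖(φ u : ℂ)‖ ≤ 1 := by
  rw [Complex.norm_real, Real.norm_of_nonneg (h.mem_Icc u).1]
  exact (h.mem_Icc u).2

theorem IsCutoff.mono {x : units G} {V W : Set (units G)} {φ : units G → ℝ} (h : IsCutoff x V φ)
    (hVW : V ⊆ W) : IsCutoff x W φ :=
  ⟨h.1, h.2, h.3, fun u hu => h.4 u fun h' => hu (hVW h')⟩

variable [IsEtaleGroupoid G]

theorem exists_isCutoff {x : units G} {V : Set (units G)} (hV : V ∈ 𝓝 x) :
    ∃ φ, IsCutoff x V φ := by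
  obtain ⟨φ, h1, h2, -, h4⟩ := exists_continuous_one_zero_of_isCompact
    (isCompact_singleton (x := x)) (isOpen_interior (s := V)).isClosed_compl
    (Set.disjoint_singleton_left.2 fun h => h (mem_interior_iff_mem_nhds.2 hV))
  exact ⟨φ, φ.continuous, h1 rfl, h4, fun u hu => h2 fun h => hu (interior_subset h)⟩

theorem cutArrows_mem {φ : units G → ℝ} (hφ : Continuous φ) {f : G → ℂ}
    (hf : f ∈ convolutionAlgebra Set.univ) : cutArrows φ f ∈ convolutionAlgebra Set.univ := by
  induction hf using Submodule.span_induction with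
  | mem f h =>
    obtain ⟨U, hU, hc, K, hKU, hK, h0⟩ := h
    refine Submodule.subset_span ⟨U, hU, ?_, K, hKU, hK, fun g hg => ?_⟩
    · refine ContinuousOn.congr (f := fun g => (φ (rngUnit g) : ℂ) * f g * φ (srcUnit g)) ?_
        fun g _ => cutArrows_apply φ f g
      refine (ContinuousOn.mul ?_ hc).mul ?_
      · exact (Complex.continuous_ofReal.comp (hφ.comp continuous_rngUnit)).continuousOn
      · exact (Complex.continuous_ofReal.comp (hφ.comp continuous_srcUnit)).continuousOn
    · rw [cutArrows_apply, h0 g hg, mul_zero, zero_mul]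
  | zero =>
    have : cutArrows φ (0 : G → ℂ) = 0 := by
      ext g
      simp [cutArrows_apply]
    rw [this]
    exact Submodule.zero_mem _
  | add f f' _ _ h h' =>
    unfold cutArrows at *
    rw [cut_add]
    exact Submodule.add_mem _ h h'
  | smul c f _ h =>
    unfold cutArrows at *
    rw [cut_smul]
    exact Submodule.smul_mem _ c h

theorem continuousOn_cutCosets {φ : units G → ℝ} (hφ : Continuous φ) {f : Coset G → ℂ}
    {S : Set (Coset G)} (hf : ContinuousOn f S) : ContinuousOn (cutCosets φ f) S := by
  refine ContinuousOn.congr (f := fun A => (φ A.rngPt : ℂ) * f A * φ A.srcPt) ?_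
    fun g _ => cutCosets_apply φ f g
  refine (ContinuousOn.mul ?_ hf).mul ?_
  · exact (Complex.continuous_ofReal.comp (hφ.comp Coset.continuous_rngPt)).continuousOn
  · exact (Complex.continuous_ofReal.comp (hφ.comp Coset.continuous_srcPt)).continuousOn

theorem exists_nhds_of_isCompact {x : units G} {K : Set (Coset G)} (hK : IsCompact K)
    (h : ∀ A ∈ K, ¬ (A.srcPt = x ∧ A.rngPt = x)) :
    ∃ V ∈ 𝓝 x, ∀ A ∈ K, ¬ (A.srcPt ∈ V ∧ A.rngPt ∈ V) := by
  have h1 : IsClosed ((fun A : Coset G => (A.srcPt, A.rngPt)) '' K) :=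
    (hK.image (Coset.continuous_srcPt.prodMk Coset.continuous_rngPt)).isClosed
  have h2 : (x, x) ∉ (fun A : Coset G => (A.srcPt, A.rngPt)) '' K := by
    rintro ⟨A, hA, e⟩
    rw [Prod.mk.injEq] at e
    exact h A hA e
  have h3 := h1.isOpen_compl.mem_nhds h2
  rw [nhds_prod_eq, Filter.mem_prod_self_iff] at h3
  obtain ⟨V, hV, hVs⟩ := h3
  exact ⟨V, hV, fun A hA hAV => hVs (Set.mk_mem_prod hAV.1 hAV.2) ⟨A, hA, rfl⟩⟩

end Cutoff

/-! ### The fibre over a unit and its local groupoid -/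

section Fibre

open Coset

variable {G : Type*} [TopologicalSpace G] [GroupoidArrows G] [IsEtaleGroupoid G] {x : units G}

theorem mem_essFibre_iff {A : Coset G} : A ∈ essFibre x ↔ A ∈ essUnits G ∧ A.srcPt = x := by
  refine and_congr_right fun hA => ?_
  obtain ⟨a, ha⟩ := A.nonempty
  have hs : (A.srcPt : G) ∈ A.carrier := by
    rw [← src_of_mem ha, ← csrc_of_mem_essUnits hA]
    exact src_mem_csrc ha
  constructor
  · intro h
    have hx : (x : G) ∈ A.carrier ∩ units G := h ▸ rfl
    rw [← srcUnit_of_mem hx.1, srcUnit_coe]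
  · rintro rfl
    ext u
    constructor
    · rintro ⟨hu, hu'⟩
      rw [Set.mem_singleton_iff, ← src_of_mem hu, src_eq_self hu']
    · rintro rfl
      exact ⟨hs, A.srcPt.2⟩

theorem mem_cosetGroupoid_iff {A : Coset G} :
    A ∈ cosetGroupoid x ↔ A ∈ essCover G ∧ A.srcPt = x ∧ A.rngPt = x := by
  refine and_congr_right fun hA => ?_
  change A.csrc ∈ essFibre x ∧ A.crng ∈ essFibre x ↔ _
  rw [mem_essFibre_iff, mem_essFibre_iff, srcPt_csrc, srcPt_crng]
  exact ⟨fun h => ⟨h.1.2, h.2.2⟩, fun h => ⟨⟨hA.2.1, h.1⟩, hA.2.2, h.2⟩⟩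

theorem isClosed_cosetGroupoid : IsClosed (cosetGroupoid x) := by
  have : cosetGroupoid x = essCover G ∩ ({A | A.srcPt = x} ∩ {A | A.rngPt = x}) := by
    ext A
    exact mem_cosetGroupoid_iff
  rw [this]
  exact isClosed_essCover.inter ((isClosed_singleton.preimage continuous_srcPt).inter
    (isClosed_singleton.preimage continuous_rngPt))

theorem div_mem_cosetGroupoid {A B : Coset G} (hA : A ∈ cosetGroupoid x) (hB : B ∈ cosetGroupoid x)
    (e : A.csrc = B.csrc) : gmul A (ginv B) ∈ cosetGroupoid x := by
  rw [mem_cosetGroupoid_iff] at hA hB ⊢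
  refine ⟨div_mem_essCover hB.1 e, ?_, ?_⟩
  · rw [← srcPt_csrc, csrc_div e, srcPt_crng, hB.2.2]
  · rw [← srcPt_crng, crng_div e, srcPt_crng, hA.2.2]

/-- Arrows near which the source is `x` if and only if the range is `x`. -/
def locallyInvariant (x : units G) : Set G :=
  interior {h | srcUnit h = x ↔ rngUnit h = x}

theorem locallyInvariant_of_isotropy {a : G} (hs : srcUnit a = x) (hr : rngUnit a = x) :
    a ∈ locallyInvariant x := by
  obtain ⟨U, hU, haU, -, his, hir⟩ := exists_open_bisection a Filter.univ_mem
  refine mem_interior.2 ⟨U, fun h hh => ⟨fun e => ?_, fun e => ?_⟩, hU, haU⟩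
  · rw [his hh haU (congrArg Subtype.val (e.trans hs.symm)), hr]
  · rw [hir hh haU (congrArg Subtype.val (e.trans hr.symm)), hs]

/-- The cosets that contain a locally invariant arrow form a local groupoid. -/
theorem isLocalGroupoid_locallyInvariant (x : units G) :
    IsLocalGroupoid (essCover G) (essFibre x)
      ({A | (A.carrier ∩ locallyInvariant x).Nonempty} ∩ essCover G) where
  isOpen := ⟨_, isOpen_meets isOpen_interior, rfl⟩
  inv_mem := by
    rintro A ⟨⟨a, ha, haP⟩, hA⟩
    refine ⟨⟨ginv a, ⟨a, ha, rfl⟩, ?_⟩, ?_⟩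
    · obtain ⟨U, hUs, hU, haU⟩ := mem_interior.1 haP
      refine mem_interior.2 ⟨ginv ⁻¹' U, fun h hh => ?_, hU.preimage continuous_ginv,
        by rwa [Set.mem_preimage, gpd_inv_inv]⟩
      have := hUs hh
      rw [Set.mem_ofPred_eq, srcUnit_inv, rngUnit_inv] at this
      exact this.symm
    · rw [mem_essCover_iff]
      change A.cinv.csrc ∈ _
      rw [csrc_cinv]
      exact crng_mem_essUnits hA
  mul_mem := by
    rintro A ⟨⟨a, ha, haP⟩, hA⟩ B ⟨⟨b, hb, hbP⟩, hB⟩ e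
    have hab := src_eq_rng e ha hb
    constructor
    · refine ⟨gmul a b, ?_, ?_⟩
      · change _ ∈ (cmul A B).carrier
        rw [cmul_of e]
        exact ⟨a, ha, b, hb, rfl⟩
      · obtain ⟨U, hUs, hU, haU⟩ := mem_interior.1 haP
        obtain ⟨V, hVs, hV, hbV⟩ := mem_interior.1 hbP
        refine mem_interior.2 ⟨_, ?_, isOpen_setMul hU hV, a, haU, b, hbV, hab, rfl⟩
        rintro _ ⟨c, hc, d, hd, hcd, rfl⟩
        have h1 : srcUnit (gmul c d) = srcUnit d := Subtype.ext (src_mul _ _ hcd)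
        have h2 : rngUnit (gmul c d) = rngUnit c := Subtype.ext (rng_mul _ _ hcd)
        have h3 : srcUnit c = rngUnit d := Subtype.ext hcd
        have h4 := hUs hc
        have h5 := hVs hd
        rw [Set.mem_ofPred_eq] at h4 h5 ⊢
        rw [h1, h2, h5, ← h3, h4]
    · rw [mem_essCover_iff]
      have : (gmul A B).csrc = B.csrc := src_mul A B e
      rw [this]
      exact mem_essCover_iff.1 hB
  invariant := by
    rintro A ⟨⟨a, ha, haP⟩, hA⟩
    change A.csrc ∈ essFibre x ↔ A.crng ∈ essFibre x
    rw [mem_essFibre_iff, mem_essFibre_iff, srcPt_csrc, srcPt_crng, ← srcUnit_of_mem ha,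
      ← rngUnit_of_mem ha]
    have : a ∈ {h | srcUnit h = x ↔ rngUnit h = x} := interior_subset haP
    rw [Set.mem_ofPred_eq] at this
    exact ⟨fun h => ⟨hA.2.2, this.1 h.2⟩, fun h => ⟨hA.2.1, this.2 h.2⟩⟩
  reduction_eq := by
    refine Set.Subset.antisymm (fun A hA => ⟨hA.1.2, hA.2⟩) fun A hA => ⟨⟨?_, hA.1⟩, hA.2⟩
    obtain ⟨a, ha⟩ := A.nonempty
    have h := mem_cosetGroupoid_iff.1 (show A ∈ cosetGroupoid x from hA)
    exact ⟨a, ha, locallyInvariant_of_isotropy ((srcUnit_of_mem ha).trans h.2.1)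
      ((rngUnit_of_mem ha).trans h.2.2)⟩

theorem convolutionAlgebra_localGroupoid_le {E : Type*} [TopologicalSpace E] [GroupoidArrows E]
    (S X : Set E) : convolutionAlgebra (localGroupoid S X) ≤ convolutionAlgebra S := by
  have : ∃ W, IsOpen W ∧ localGroupoid S X = W ∩ S := by
    choose! V hV using fun H (hH : IsLocalGroupoid S X H) => hH.isOpen
    refine ⟨⋃ H ∈ {H | IsLocalGroupoid S X H}, V H,
      isOpen_biUnion fun H hH => (hV H hH).1, ?_⟩
    unfold localGroupoid
    rw [Set.sUnion_eq_biUnion, Set.iUnion₂_inter]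
    exact Set.iUnion₂_congr fun H hH => (hV H hH).2
  obtain ⟨W, hW, e⟩ := this
  refine Submodule.span_mono ?_
  rintro f ⟨U, ⟨⟨V, hV, rfl⟩, hU⟩, h⟩
  exact ⟨V ∩ localGroupoid S X, ⟨⟨V ∩ W, hV.inter hW, by rw [e, Set.inter_assoc]⟩, hU⟩, h⟩

theorem restrictedNorm_le {E : Type*} [TopologicalSpace E] [GroupoidArrows E] {S X : Set E}
    {F b : E → ℂ}
    (hF : F ∈ convolutionAlgebra (localGroupoid S X)) (hb : Set.EqOn F b (reduction S X)) :
    restrictedNorm S X b ≤ reducedNorm S F := by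
  refine csInf_le ⟨0, ?_⟩ ⟨F, hF, hb, rfl⟩
  rintro _ ⟨f, -, -, rfl⟩
  exact reducedNorm_nonneg _ _

theorem restrictedNorm_nonneg {E : Type*} [TopologicalSpace E] [GroupoidArrows E] (S X : Set E)
    (b : E → ℂ) : 0 ≤ restrictedNorm S X b := by
  refine Real.sInf_nonneg ?_
  rintro _ ⟨f, -, -, rfl⟩
  exact reducedNorm_nonneg _ _

theorem exists_cutCosets_mem {f : Coset G → ℂ} (hf : f ∈ convolutionAlgebra (essCover G))
    {V : Set (units G)} (hV : V ∈ 𝓝 x) :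
    ∃ φ, IsCutoff x V φ ∧
      cutCosets φ f ∈ convolutionAlgebra (localGroupoid (essCover G) (essFibre x)) := by
  obtain ⟨hc, K, hKS, hK, h0⟩ := mem_convolutionAlgebra_iff.1 hf
  set W : Set (Coset G) := {A | (A.carrier ∩ locallyInvariant x).Nonempty}
  have hW : IsOpen W := isOpen_meets isOpen_interior
  have hWH : W ∩ essCover G ⊆ localGroupoid (essCover G) (essFibre x) :=
    Set.subset_sUnion_of_mem (isLocalGroupoid_locallyInvariant x)
  obtain ⟨V', hV', hKV'⟩ := exists_nhds_of_isCompact (x := x) (hK.diff hW) (by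
    rintro A ⟨hA, hAW⟩ ⟨h1, h2⟩
    obtain ⟨a, ha⟩ := A.nonempty
    exact hAW ⟨a, ha, locallyInvariant_of_isotropy ((srcUnit_of_mem ha).trans h1)
      ((rngUnit_of_mem ha).trans h2)⟩)
  obtain ⟨L, hL, hLc, hLs⟩ := exists_mem_nhds_isClosed_subset (Filter.inter_mem hV hV')
  obtain ⟨φ, hφ⟩ := exists_isCutoff hL
  refine ⟨φ, hφ.mono fun u hu => (hLs hu).1, ?_⟩
  rw [mem_convolutionAlgebra_iff]
  refine ⟨(continuousOn_cutCosets hφ.continuous hc).mono ?_,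
    K ∩ (srcPt ⁻¹' L ∩ rngPt ⁻¹' L), ?_, ?_, ?_⟩
  · refine Set.sUnion_subset fun H hH => ?_
    obtain ⟨W', -, rfl⟩ := hH.isOpen
    exact Set.inter_subset_right
  · rintro A ⟨hA, h1, h2⟩
    refine hWH ⟨?_, hKS hA⟩
    by_contra hAW
    exact hKV' A ⟨hA, hAW⟩ ⟨(hLs h1).2, (hLs h2).2⟩
  · exact hK.inter_right ((hLc.preimage continuous_srcPt).inter (hLc.preimage continuous_rngPt))
  · intro A hA
    rw [cutCosets_apply]
    by_cases h1 : A ∈ K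
    · by_cases h2 : A.srcPt ∈ L
      · have h3 : A.rngPt ∉ L := fun h3 => hA ⟨h1, h2, h3⟩
        rw [hφ.eq_zero _ h3]; simp
      · rw [hφ.eq_zero _ h2]; simp
    · rw [h0 A h1]; simp

theorem cutCosets_eqOn {f : Coset G → ℂ} {V : Set (units G)} {φ : units G → ℝ}
    (hφ : IsCutoff x V φ) : Set.EqOn (cutCosets φ f) f (cosetGroupoid x) := by
  intro A hA
  obtain ⟨-, h1, h2⟩ := mem_cosetGroupoid_iff.1 hA
  rw [cutCosets_apply, h1, h2, hφ.apply_self]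
  simp

/-- The norm on the fibre may be computed with extensions to `G̃_ess` instead of a local groupoid,
because cutting off near `x` moves the support into a local groupoid. -/
theorem restrictedNorm_le_of_eqOn {f b : Coset G → ℂ} (hf : f ∈ convolutionAlgebra (essCover G))
    (hb : Set.EqOn f b (cosetGroupoid x)) :
    restrictedNorm (essCover G) (essFibre x) b ≤ reducedNorm (essCover G) f := by
  obtain ⟨φ, hφ, hmem⟩ := exists_cutCosets_mem hf (Filter.univ_mem (f := 𝓝 x))
  exact (restrictedNorm_le hmem fun A hA => (cutCosets_eqOn hφ hA).trans (hb hA)).trans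
    (reducedNorm_cut_le (bisectionBounded_of_mem hf) (fun A => hφ.norm_le _) _)

theorem le_restrictedNorm {f b : Coset G → ℂ} (hf : f ∈ convolutionAlgebra (essCover G))
    (hb : Set.EqOn f b (cosetGroupoid x)) {c : ℝ}
    (h : ∀ F ∈ convolutionAlgebra (essCover G), Set.EqOn F b (cosetGroupoid x) →
      c ≤ reducedNorm (essCover G) F) :
    c ≤ restrictedNorm (essCover G) (essFibre x) b := by
  obtain ⟨φ, hφ, hmem⟩ := exists_cutCosets_mem hf (Filter.univ_mem (f := 𝓝 x))
  refine le_csInf ⟨_, _, hmem, fun A hA => (cutCosets_eqOn hφ hA).trans (hb hA), rfl⟩ ?_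
  rintro _ ⟨F, hF, hFb, rfl⟩
  exact h F (convolutionAlgebra_localGroupoid_le _ _ hF) hFb

/-- A function that vanishes on the fibre over `x` becomes small in norm when it is cut off close
to `x`. -/
theorem exists_nhds_kerBound_cut {f : Coset G → ℂ} (hf : f ∈ convolutionAlgebra (essCover G))
    (h0 : ∀ A ∈ cosetGroupoid x, f A = 0) {ε : ℝ} (hε : 0 < ε) :
    ∃ V ∈ 𝓝 x, ∀ φ, IsCutoff x V φ → reducedNorm (essCover G) (cutCosets φ f) ≤ ε := by
  obtain ⟨n, U, -, -, hU, hfU, -⟩ := bisectionBounded_of_mem hf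
  obtain ⟨hc, K, hKS, hK, hK0⟩ := mem_convolutionAlgebra_iff.1 hf
  set δ : ℝ := ε / (n + 1)
  have hδ : 0 < δ := by positivity
  have hcl : IsClosed (K ∩ {A | δ ≤ ‖f A‖}) :=
    (hc.mono hKS).norm.preimage_isClosed_of_isClosed hK.isClosed isClosed_Ici
  obtain ⟨V, hV, hKV⟩ := exists_nhds_of_isCompact (x := x)
    (hK.of_isClosed_subset hcl Set.inter_subset_left) (by
      rintro A ⟨hA, hAδ⟩ ⟨h1, h2⟩
      have := h0 A (mem_cosetGroupoid_iff.2 ⟨hKS hA, h1, h2⟩)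
      rw [Set.mem_ofPred_eq, this, norm_zero] at hAδ
      linarith)
  refine ⟨V, hV, fun φ hφ => ?_⟩
  have hb : ∀ A, ‖cutCosets φ f A‖ ≤ δ := by
    intro A
    by_cases hA : A ∈ K ∩ {A | δ ≤ ‖f A‖}
    · have : φ A.srcPt = 0 ∨ φ A.rngPt = 0 := by
        by_contra! hcon
        refine hKV A hA ⟨?_, ?_⟩
        · by_contra h; exact hcon.1 (hφ.eq_zero _ h)
        · by_contra h; exact hcon.2 (hφ.eq_zero _ h)
      rw [cutCosets_apply]
      rcases this with h | h <;> simp [h, hδ.le]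
    · refine (norm_cut_le (fun A => hφ.norm_le _) f A).trans ?_
      by_cases hAK : A ∈ K
      · exact (not_le.1 fun h => hA ⟨hAK, h⟩).le
      · rw [hK0 A hAK, norm_zero]; exact hδ.le
  have hk := kerBound_kern_of_cover (essCover G) hδ.le hU (f := cutCosets φ f) (fun A hA => hfU A
    fun h => hA (by rw [cutCosets_apply, h]; simp)) hb
  refine (reducedNorm_le ((bisectionBounded_of_mem hf).cut fun A => hφ.norm_le _) (by positivity)
    hk).trans ?_
  rw [mul_div_assoc', div_le_iff₀ (by positivity)]
  nlinarith

/-- The reduced norm of `𝒞_c(G̃_ess)` is computed by the representations at Hausdorff units, since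
every finite block of the matrix of `f` is a limit of blocks at Hausdorff units. -/
theorem kerBound_essCover {f : Coset G → ℂ} (hf : f ∈ convolutionAlgebra (essCover G)) {c : ℝ}
    (hc : 0 ≤ c)
    (h : KerBound (fun g h => kern f (sing g) (sing h)) {g | src g ∈ hausdorffUnits G} c) :
    KerBound (kern f) (essCover G) c := by
  classical
  refine KerBound.of_fibres csrc (fun A _ B _ hne => kern_of_ne f fun e => hne e.symm) hc
    fun X => KerBound.of_forall_pos fun ε hε => ?_
  intro F hF u v
  rcases F.eq_empty_or_nonempty with rfl | ⟨A₀, hA₀⟩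
  · simp
  have hX : X ∈ essUnits G := by
    obtain ⟨h1, rfl⟩ := hF hA₀
    exact mem_essCover_iff.1 h1
  obtain ⟨l, hl, hC, hz⟩ := exists_filter_of_mem_essUnits hX
  have hu : ∀ᶠ z in l, z ∈ units G := hC.mono fun z hz => hz.1
  choose a ha using fun A : Coset G => A.nonempty
  have hFX : ∀ A ∈ F, A.csrc = X := fun A hA => (hF hA).2
  have hsec : ∀ A ∈ F, ∃ p : G → G, Filter.Tendsto p l (𝓝 (a A)) ∧ ∀ᶠ z in l, src (p z) = z :=
    fun A hA => exists_section_of_tendsto_sing hz hu (hFX A hA ▸ src_mem_csrc (ha A))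
  have : Nonempty G := ⟨a A₀⟩
  choose! p hp hpz using hsec
  set η : ℝ := ε / F.card
  have hcard : (0 : ℝ) < F.card := by exact_mod_cast Finset.card_pos.2 ⟨A₀, hA₀⟩
  have ev1 : ∀ᶠ z in l, ∀ A ∈ F, src (p A z) = z :=
    (Filter.eventually_all_finset F).2 fun A hA => hpz A hA
  have ev2 : ∀ᶠ z in l, ∀ A ∈ F, ∀ B ∈ F, A ≠ B → p A z ≠ p B z := by
    refine (Filter.eventually_all_finset F).2 fun A hA =>
      (Filter.eventually_all_finset F).2 fun B hB => ?_
    by_cases hAB : A = B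
    · exact Filter.Eventually.of_forall fun z h => absurd hAB h
    have t1 := tendsto_sing_of_section (hFX A hA) (ha A) hz hu (hp A hA) (hpz A hA)
    have t2 := tendsto_sing_of_section (hFX B hB) (ha B) hz hu (hp B hB) (hpz B hB)
    obtain ⟨W₁, W₂, hW₁, hW₂, hA₁, hB₂, hd⟩ := t2_separation hAB
    filter_upwards [t1 (hW₁.mem_nhds hA₁), t2 (hW₂.mem_nhds hB₂)] with z h1 h2 _ e
    rw [Set.mem_preimage] at h1 h2
    exact Set.disjoint_left.1 hd h1 (e ▸ h2)
  have ev3 : ∀ᶠ z in l, ∀ A ∈ F, ∀ B ∈ F,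
      ‖f (gmul A (ginv B)) - f (sing (gmul (p A z) (ginv (p B z))))‖ ≤ η := by
    refine (Filter.eventually_all_finset F).2 fun A hA =>
      (Filter.eventually_all_finset F).2 fun B hB => ?_
    have t := tendsto_sing_div (hFX A hA) (hFX B hB) (ha A) (ha B) hz (hp A hA) (hp B hB)
      (hpz A hA) (hpz B hB)
    have hmem : gmul A (ginv B) ∈ essCover G :=
      div_mem_essCover (hF hB).1 ((hFX A hA).trans (hFX B hB).symm)
    have t' := (((mem_convolutionAlgebra_iff.1 hf).1 _ hmem).tendsto.comp
      (tendsto_nhdsWithin_iff.2 ⟨t, ?_⟩))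
    · have := Metric.tendsto_nhds.1 t' η (by positivity)
      filter_upwards [this] with z hz
      rw [← dist_eq_norm, dist_comm]
      exact hz.le
    · filter_upwards [hpz A hA, hpz B hB, hC] with z h1 h2 h3
      refine sing_mem_essCover ?_
      rw [src_div (by rw [h1, h2])]
      exact rng_mem_hausdorffUnits (by rwa [h2])
  obtain ⟨z, h1, h2, h3, h4⟩ := (ev1.and (ev2.and (ev3.and hC))).exists
  have key := h.block_le (k := kern f) (F := F) (η := η) (fun A => p A z) (by
      intro A hA B hB e
      by_contra hne
      exact h2 A hA B hB hne e) (fun A hA => by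
      rwa [Set.mem_ofPred_eq, h1 A hA]) (fun A hA B hB => by
      rw [kern_of_eq f (show B.csrc = A.csrc by rw [hFX A hA, hFX B hB]), kern_of_eq f
        (show (sing (p B z)).csrc = (sing (p A z)).csrc by
          rw [csrc_sing, csrc_sing, h1 A hA, h1 B hB])]
      change ‖_ - f (gmul (sing (p A z)) (cinv (sing (p B z))))‖ ≤ η
      rw [cinv_sing, gmul_sing (by rw [rng_inv, h1 A hA, h1 B hB])]
      exact h3 A hA B hB) u v
  rwa [show F.card * η = ε by simp only [η]; field_simp] at key

end Fibre

/-! ### The convolution product on `𝒞_c(G)` -/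

theorem ell2_operator_ext_single {ι : Type*} [DecidableEq ι] {T T' : Ell2 ι →L[ℂ] Ell2 ι}
    (h : ∀ i j, (T (lp.single 2 j (1 : ℂ)) : ι → ℂ) i = (T' (lp.single 2 j (1 : ℂ)) : ι → ℂ) i) :
    T = T' := by
  rw [← sub_eq_zero, ← norm_le_zero_iff]
  refine ell2_norm_le_of_kerBound (k := fun _ _ => 0) (fun i j => ?_) le_rfl
    (KerBound.zero le_rfl)
  rw [sub_apply, lp.coeFn_sub, Pi.sub_apply, h, sub_self]

section Product

variable {G : Type*} [GroupoidArrows G]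

/-- The convolution product `m ↦ ∑ f(a) f'(b)`, over the factorizations `m = a b`. -/
def convMul (f f' : G → ℂ) (m : G) : ℂ :=
  ∑ᶠ a ∈ {a | rng a = rng m}, f a * f' (gmul (ginv a) m)

theorem convMul_of_mem {f : G → ℂ} (f' : G → ℂ) {U : Set G} (hU : Set.InjOn rng U)
    (h0 : ∀ g ∉ U, f g = 0) {m a : G} (ha : a ∈ U) (e : rng a = rng m) :
    convMul f f' m = f a * f' (gmul (ginv a) m) := by
  unfold convMul
  rw [← finsum_mem_singleton (f := fun a => f a * f' (gmul (ginv a) m)) (a := a)]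
  refine finsum_mem_inter_support_eq' _ _ _ fun b hb => ?_
  have hbU : b ∈ U := by
    by_contra hcon
    exact hb (by simp [h0 b hcon])
  constructor
  · intro hbm
    exact hU hbU ha (Eq.trans hbm e.symm)
  · rintro rfl
    exact e

theorem convMul_of_forall {f : G → ℂ} (f' : G → ℂ) {m : G} (h : ∀ a, rng a = rng m → f a = 0) :
    convMul f f' m = 0 := by
  unfold convMul
  refine finsum_mem_eq_zero_of_forall_eq_zero fun a ha => ?_
  rw [h a ha, zero_mul]

theorem leftRegular_convMul {f f' : G → ℂ} {U : Set G} (hU : Set.InjOn rng U)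
    (h0 : ∀ g ∉ U, f g = 0) (hf : BisectionBounded f) (hf' : BisectionBounded f')
    (hm : BisectionBounded (convMul f f')) {S : Set G}
    (hS : ∀ g ∈ S, ∀ k, src k = src g → k ∈ S) :
    leftRegular S (convMul f f') = leftRegular S f * leftRegular S f' := by
  classical
  refine ell2_operator_ext_single fun g h => ?_
  rw [mul_apply_eq_comp, leftRegular_single hm, leftRegular_apply hf]
  simp_rw [leftRegular_single hf']
  by_cases e : src (h : G) = src (g : G)
  · rw [kern_of_eq _ e]
    by_cases hex : ∃ a ∈ U, rng a = rng (g : G)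
    · obtain ⟨a, ha, ea⟩ := hex
      have es : src (gmul (ginv a) (g : G)) = src (g : G) :=
        src_mul _ _ (by rw [src_inv, ea])
      rw [tsum_eq_single ⟨gmul (ginv a) g, hS g g.2 _ es⟩]
      · rw [convMul_of_mem f' hU h0 ha (by rw [rng_div e, ea]), kern_of_eq _ es,
          kern_of_eq _ (e.trans es.symm)]
        have e1 : gmul (g : G) (ginv (gmul (ginv a) g)) = a := by
          rw [gpd_mul_inv_rev _ _ (by rw [src_inv, ea]), gpd_inv_inv,
            gpd_cancel_inv_left _ _ ea.symm]
        have e2 : gmul (ginv a) (gmul (g : G) (ginv h)) = gmul (gmul (ginv a) g) (ginv h) :=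
          (gmul_assoc _ _ _ (by rw [src_inv, ea]) (by rw [rng_inv, e])).symm
        rw [e1, e2]
      · rintro k hk
        by_cases ek : src (k : G) = src (g : G)
        · rw [kern_of_eq _ ek]
          by_cases hkU : gmul (g : G) (ginv (k : G)) ∈ U
          · refine absurd (Subtype.ext ?_) hk
            have : gmul (g : G) (ginv (k : G)) = a := hU hkU ha (by rw [rng_div ek, ea])
            change (k : G) = gmul (ginv a) g
            rw [← this, gpd_mul_inv_rev _ _ (by rw [rng_inv, ek]), gpd_inv_inv,
              gpd_inv_mul_cancel_right _ _ ek]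
          · rw [h0 _ hkU, zero_mul]
        · rw [kern_of_ne _ ek, zero_mul]
    · push Not at hex
      rw [convMul_of_forall f' fun a ha => h0 a fun haU => hex a haU (by rw [ha, rng_div e])]
      symm
      refine (tsum_congr fun k => ?_).trans tsum_zero
      by_cases ek : src (k : G) = src (g : G)
      · rw [kern_of_eq _ ek, h0 _ fun hkU => hex _ hkU (rng_div ek), zero_mul]
      · rw [kern_of_ne _ ek, zero_mul]
  · rw [kern_of_ne _ e]
    symm
    refine (tsum_congr fun k => ?_).trans tsum_zero
    by_cases ek : src (k : G) = src (g : G)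
    · rw [kern_of_ne _ (fun e' => e (e'.trans ek)), mul_zero]
    · rw [kern_of_ne _ ek, zero_mul]

/-- The involution `f*(g) = conj f(g⁻¹)`. -/
def convStar (f : G → ℂ) (g : G) : ℂ := starRingEnd ℂ (f (ginv g))

theorem leftRegular_convStar {f : G → ℂ} (hf : BisectionBounded f)
    (hs : BisectionBounded (convStar f)) (S : Set G) :
    leftRegular S (convStar f) = star (leftRegular S f) := by
  classical
  refine ell2_operator_ext_single fun g h => ?_
  rw [leftRegular_single hs, ContinuousLinearMap.star_eq_adjoint]
  have h1 := ContinuousLinearMap.adjoint_inner_right (leftRegular S f) (lp.single 2 g (1 : ℂ))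
    (lp.single 2 h (1 : ℂ))
  rw [lp.inner_single_left, lp.inner_single_right, leftRegular_single hf] at h1
  simp only [RCLike.inner_apply, map_one, mul_one, one_mul] at h1
  rw [h1]
  by_cases e : src (h : G) = src (g : G)
  · rw [kern_of_eq _ e, kern_of_eq _ e.symm, convStar, gpd_mul_inv_rev _ _ (by rw [rng_inv, e]),
      gpd_inv_inv]
  · rw [kern_of_ne _ e, kern_of_ne _ fun e' => e e'.symm, map_zero]

end Product

section ProductTop

variable {G : Type*} [TopologicalSpace G] [GroupoidArrows G] [IsEtaleGroupoid G]

theorem convMul_mem_of_bisections {f f' : G → ℂ} {U U' K K' : Set G}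
    (hU : IsOpenBisection Set.univ U) (hU' : IsOpenBisection Set.univ U') (hc : ContinuousOn f U)
    (hc' : ContinuousOn f' U') (hKU : K ⊆ U) (hKU' : K' ⊆ U') (hK : IsCompact K)
    (hK' : IsCompact K') (h0 : ∀ g ∉ K, f g = 0) (h0' : ∀ g ∉ K', f' g = 0) :
    convMul f f' ∈ convolutionAlgebra Set.univ := by
  rw [isOpenBisection_univ_iff] at hU hU'
  obtain ⟨hUo, hUs, hUr⟩ := hU
  obtain ⟨hUo', hUs', hUr'⟩ := hU'
  have hz : ∀ g ∉ U, f g = 0 := fun g hg => h0 g fun h => hg (hKU h)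
  refine Submodule.subset_span ⟨{g | ∃ a ∈ U, ∃ b ∈ U', src a = rng b ∧ g = gmul a b},
    isOpenBisection_univ_iff.2 ⟨isOpen_setMul hUo hUo', ?_, ?_⟩, ?_,
    {g | ∃ a ∈ K, ∃ b ∈ K', src a = rng b ∧ g = gmul a b}, ?_, ?_, ?_⟩
  · rintro _ ⟨a, ha, b, hb, e, rfl⟩ _ ⟨a', ha', b', hb', e', rfl⟩ q
    rw [src_mul _ _ e, src_mul _ _ e'] at q
    obtain rfl := hUs' hb hb' q
    obtain rfl := hUs ha ha' (e.trans e'.symm)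
    rfl
  · rintro _ ⟨a, ha, b, hb, e, rfl⟩ _ ⟨a', ha', b', hb', e', rfl⟩ q
    rw [rng_mul _ _ e, rng_mul _ _ e'] at q
    obtain rfl := hUr ha ha' q
    obtain rfl := hUr' hb hb' (e.symm.trans e')
    rfl
  · rintro _ ⟨a, ha, b, hb, e, rfl⟩
    refine ContinuousAt.continuousWithinAt ?_
    obtain ⟨σ, h1, h2, h3⟩ := exists_rng_section a
    have er : rngUnit (gmul a b) = rngUnit a := Subtype.ext (rng_mul _ _ e)
    have t1 : Filter.Tendsto rngUnit (𝓝 (gmul a b)) (𝓝 (rngUnit a)) :=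
      er ▸ continuous_rngUnit.tendsto (gmul a b)
    have t2 : Filter.Tendsto (fun m => σ (rngUnit m)) (𝓝 (gmul a b)) (𝓝 a) := h1.comp t1
    have ev : ∀ᶠ m in 𝓝 (gmul a b), rng (σ (rngUnit m)) = rng m :=
      (t1.eventually h3).mono fun m hm => congrArg Subtype.val hm
    have t3 : Filter.Tendsto (fun m => gmul (ginv (σ (rngUnit m))) m) (𝓝 (gmul a b)) (𝓝 b) := by
      have := tendsto_gmul ((continuous_ginv.tendsto a).comp t2) (Filter.tendsto_id)
        (by rw [src_inv, rng_mul _ _ e]) (ev.mono fun m hm => by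
          change src (ginv _) = rng m
          rw [src_inv, hm])
      rwa [gpd_inv_cancel_left _ _ e] at this
    have t4 := ((hc.continuousAt (hUo.mem_nhds ha)).tendsto.comp t2).mul
      ((hc'.continuousAt (hUo'.mem_nhds hb)).tendsto.comp t3)
    rw [ContinuousAt, convMul_of_mem f' hUr hz ha (rng_mul _ _ e).symm,
      gpd_inv_cancel_left _ _ e]
    refine t4.congr' ?_
    filter_upwards [t2 (hUo.mem_nhds ha), ev] with m h4 h5
    exact (convMul_of_mem f' hUr hz h4 h5).symm
  · rintro _ ⟨a, ha, b, hb, e, rfl⟩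
    exact ⟨a, hKU ha, b, hKU' hb, e, rfl⟩
  · have h1 : IsClosed {p : G × G | src p.1 = rng p.2} := by
      have : {p : G × G | src p.1 = rng p.2} = {p | srcUnit p.1 = rngUnit p.2} := by
        ext p
        exact (Subtype.ext_iff (a1 := srcUnit p.1) (a2 := rngUnit p.2)).symm
      rw [this]
      exact isClosed_eq (continuous_srcUnit.comp continuous_fst)
        (continuous_rngUnit.comp continuous_snd)
    have h2 := ((hK.prod hK').inter_right h1).image_of_continuousOn
      ((IsEtaleGroupoid.continuousOn_mul (G := G)).mono Set.inter_subset_right)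
    convert h2 using 1
    ext g
    constructor
    · rintro ⟨a, ha, b, hb, e, rfl⟩
      exact ⟨(a, b), ⟨⟨ha, hb⟩, e⟩, rfl⟩
    · rintro ⟨⟨a, b⟩, ⟨⟨ha, hb⟩, e⟩, rfl⟩
      exact ⟨a, ha, b, hb, e, rfl⟩
  · intro g hg
    by_cases hex : ∃ a ∈ U, rng a = rng g
    · obtain ⟨a, ha, ea⟩ := hex
      rw [convMul_of_mem f' hUr hz ha ea]
      by_cases haK : a ∈ K
      · rw [h0' _ fun hb => hg ⟨a, haK, _, hb, ?_, ?_⟩, mul_zero]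
        · rw [rng_mul _ _ (by rw [src_inv, ea]), rng_inv]
        · rw [gpd_cancel_inv_left _ _ ea]
      · rw [h0 a haK, zero_mul]
    · push Not at hex
      exact convMul_of_forall f' fun a ha => hz a fun haU => hex a haU ha

/-- `𝒞_c(G)` is closed under convolution, and convolution is represented by composition of
operators on `ℓ²` of every set of arrows that is a union of sets `G_x`. -/
theorem exists_leftRegular_mul {f f' : G → ℂ} (hf : f ∈ convolutionAlgebra Set.univ)
    (hf' : f' ∈ convolutionAlgebra Set.univ) :
    ∃ p ∈ convolutionAlgebra (Set.univ : Set G), ∀ S : Set G,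
      (∀ g ∈ S, ∀ k, src k = src g → k ∈ S) →
      leftRegular S p = leftRegular S f * leftRegular S f' := by
  have z : ∀ S : Set G, leftRegular S (0 : G → ℂ) = 0 := fun S => by
    simpa using leftRegular_smul BisectionBounded.zero 0 S
  induction hf using Submodule.span_induction with
  | mem f h =>
    have hb : BisectionBounded f := bisectionBounded_of_mem (Submodule.subset_span h)
    obtain ⟨U, hU, hc, K, hKU, hK, h0⟩ := h
    induction hf' using Submodule.span_induction with
    | mem f' h' =>
      have hb' : BisectionBounded f' := bisectionBounded_of_mem (Submodule.subset_span h')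
      obtain ⟨U', hU', hc', K', hKU', hK', h0'⟩ := h'
      have := convMul_mem_of_bisections hU hU' hc hc' hKU hKU' hK hK' h0 h0'
      exact ⟨_, this, fun S hS => leftRegular_convMul hU.2.2 (fun g hg => h0 g fun h => hg (hKU h))
        hb hb' (bisectionBounded_of_mem this) hS⟩
    | zero => exact ⟨0, Submodule.zero_mem _, fun S _ => by rw [z, mul_zero]⟩
    | add f₁ f₂ hf₁ hf₂ h₁ h₂ =>
      obtain ⟨p₁, hp₁, e₁⟩ := h₁
      obtain ⟨p₂, hp₂, e₂⟩ := h₂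
      refine ⟨p₁ + p₂, Submodule.add_mem _ hp₁ hp₂, fun S hS => ?_⟩
      rw [leftRegular_add (bisectionBounded_of_mem hp₁) (bisectionBounded_of_mem hp₂), e₁ S hS,
        e₂ S hS, leftRegular_add (bisectionBounded_of_mem hf₁) (bisectionBounded_of_mem hf₂),
        mul_add]
    | smul c f₁ hf₁ h₁ =>
      obtain ⟨p₁, hp₁, e₁⟩ := h₁
      refine ⟨c • p₁, Submodule.smul_mem _ _ hp₁, fun S hS => ?_⟩
      rw [leftRegular_smul (bisectionBounded_of_mem hp₁), e₁ S hS,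
        leftRegular_smul (bisectionBounded_of_mem hf₁), mul_smul_comm]
  | zero => exact ⟨0, Submodule.zero_mem _, fun S _ => by rw [z, zero_mul]⟩
  | add f₁ f₂ hf₁ hf₂ h₁ h₂ =>
    obtain ⟨p₁, hp₁, e₁⟩ := h₁
    obtain ⟨p₂, hp₂, e₂⟩ := h₂
    refine ⟨p₁ + p₂, Submodule.add_mem _ hp₁ hp₂, fun S hS => ?_⟩
    rw [leftRegular_add (bisectionBounded_of_mem hp₁) (bisectionBounded_of_mem hp₂), e₁ S hS,
      e₂ S hS, leftRegular_add (bisectionBounded_of_mem hf₁) (bisectionBounded_of_mem hf₂),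
      add_mul]
  | smul c f₁ hf₁ h₁ =>
    obtain ⟨p₁, hp₁, e₁⟩ := h₁
    refine ⟨c • p₁, Submodule.smul_mem _ _ hp₁, fun S hS => ?_⟩
    rw [leftRegular_smul (bisectionBounded_of_mem hp₁), e₁ S hS,
      leftRegular_smul (bisectionBounded_of_mem hf₁), smul_mul_assoc]

theorem convStar_mem {f : G → ℂ} (hf : f ∈ convolutionAlgebra Set.univ) :
    convStar f ∈ convolutionAlgebra Set.univ := by
  induction hf using Submodule.span_induction with
  | mem f h =>
    obtain ⟨U, hU, hc, K, hKU, hK, h0⟩ := h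
    rw [isOpenBisection_univ_iff] at hU
    refine Submodule.subset_span ⟨ginv ⁻¹' U, isOpenBisection_univ_iff.2
      ⟨hU.1.preimage continuous_ginv, fun g hg h hh e => ?_, fun g hg h hh e => ?_⟩, ?_,
      ginv '' K, ?_, hK.image continuous_ginv, fun g hg => ?_⟩
    · exact gpd_inv_injective (hU.2.2 hg hh (by rw [rng_inv, rng_inv, e]))
    · exact gpd_inv_injective (hU.2.1 hg hh (by rw [src_inv, src_inv, e]))
    · exact Complex.continuous_conj.comp_continuousOn
        (hc.comp continuous_ginv.continuousOn fun g hg => hg)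
    · rintro _ ⟨g, hg, rfl⟩
      rw [Set.mem_preimage, gpd_inv_inv]
      exact hKU hg
    · rw [convStar, h0 _ fun h => hg ⟨_, h, gpd_inv_inv g⟩, map_zero]
  | zero =>
    have : convStar (0 : G → ℂ) = 0 := by
      ext g
      simp [convStar]
    rw [this]
    exact Submodule.zero_mem _
  | add f f' _ _ h h' =>
    have : convStar (f + f') = convStar f + convStar f' := by
      ext g
      simp [convStar]
    rw [this]
    exact Submodule.add_mem _ h h'
  | smul c f _ h =>
    have : convStar (c • f) = starRingEnd ℂ c • convStar f := by
      ext g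
      simp [convStar]
    rw [this]
    exact Submodule.smul_mem _ _ h

end ProductTop

/-! ### The reduced C*-algebra and the singular ideal -/

/-- If no nonzero element of the first algebra is, paired with zero, in the closure of a star
subalgebra `R` of a product of C*-algebras, then the second coordinate of elements of `R` dominates
the first: the second projection of the closure is injective, hence isometric. -/
theorem norm_fst_le_norm_snd {A B : Type*} [NonUnitalCStarAlgebra A] [NonUnitalCStarAlgebra B]
    (R : NonUnitalStarSubalgebra ℂ (A × B))
    (h : ∀ z : A, (z, (0 : B)) ∈ closure (R : Set (A × B)) → z = 0) {p : A × B} (hp : p ∈ R) :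
    ‖p.1‖ ≤ ‖p.2‖ := by
  let D := R.topologicalClosure
  have : IsClosed (D : Set (A × B)) := R.isClosed_topologicalClosure
  let φ : D →⋆ₙₐ[ℂ] B := (NonUnitalStarAlgHom.snd ℂ A B).comp (NonUnitalStarSubalgebraClass.subtype D)
  have hφ : Function.Injective φ := by
    rw [injective_iff_map_eq_zero]
    rintro ⟨⟨z, w⟩, hz⟩ (hw : w = 0)
    subst hw
    exact Subtype.ext (Prod.ext (h z hz) rfl)
  have := NonUnitalStarAlgHom.norm_map φ hφ ⟨p, R.le_topologicalClosure hp⟩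
  have e : ‖p.2‖ = ‖p‖ := this
  rw [e]
  exact norm_fst_le p

section Reduced

variable {G : Type*} [GroupoidArrows G]

theorem toFunctionOnArrows_eq [DecidableEq (Set.univ : Set G)]
    (a : Ell2 (Set.univ : Set G) →L[ℂ] Ell2 (Set.univ : Set G)) (g : G) :
    toFunctionOnArrows a g =
      a (lp.single 2 (⟨src g, trivial⟩ : (Set.univ : Set G)) (1 : ℂ)) ⟨g, trivial⟩ := by
  unfold toFunctionOnArrows
  have e : ∀ d d' : DecidableEq (Set.univ : Set G), ∀ h : (Set.univ : Set G),
      @lp.single _ (fun _ => ℂ) _ d 2 h 1 = @lp.single _ (fun _ => ℂ) _ d' 2 h 1 := fun d d' h => by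
    rw [Subsingleton.elim d d']
  rw [e]

theorem toFunctionOnArrows_sub (a b : Ell2 (Set.univ : Set G) →L[ℂ] Ell2 (Set.univ : Set G))
    (g : G) : toFunctionOnArrows (a - b) g = toFunctionOnArrows a g - toFunctionOnArrows b g := by
  unfold toFunctionOnArrows
  rw [sub_apply, lp.coeFn_sub, Pi.sub_apply]

theorem norm_apply_single_le {ι : Type*} [DecidableEq ι] (T : Ell2 ι →L[ℂ] Ell2 ι) (i j : ι) :
    ‖(T (lp.single 2 j (1 : ℂ)) : ι → ℂ) i‖ ≤ ‖T‖ := by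
  refine (lp.norm_apply_le_norm (by norm_num) _ i).trans ((T.le_opNorm _).trans ?_)
  rw [lp.norm_single (by norm_num), norm_one, mul_one]

theorem continuous_apply_single {ι : Type*} [DecidableEq ι] (i j : ι) :
    Continuous fun T : Ell2 ι →L[ℂ] Ell2 ι => (T (lp.single 2 j (1 : ℂ)) : ι → ℂ) i := by
  refine (LipschitzWith.of_dist_le_mul (K := 1) fun T T' => ?_).continuous
  have := norm_apply_single_le (T - T') i j
  rw [sub_apply, lp.coeFn_sub, Pi.sub_apply] at this
  rw [dist_eq_norm, dist_eq_norm, NNReal.coe_one, one_mul]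
  exact this

theorem norm_toFunctionOnArrows_le (a : Ell2 (Set.univ : Set G) →L[ℂ] Ell2 (Set.univ : Set G))
    (g : G) : ‖toFunctionOnArrows a g‖ ≤ ‖a‖ := by
  classical
  rw [toFunctionOnArrows_eq]
  exact norm_apply_single_le a _ _

theorem continuous_toFunctionOnArrows (g : G) :
    Continuous fun a : Ell2 (Set.univ : Set G) →L[ℂ] Ell2 (Set.univ : Set G) =>
      toFunctionOnArrows a g := by
  classical
  simp_rw [toFunctionOnArrows_eq]
  exact continuous_apply_single _ _

theorem leftRegular_single_src {f : G → ℂ} (hf : BisectionBounded f) {S : Set G} [DecidableEq S]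
    {g : G} (hg : g ∈ S) (hs : src g ∈ S) :
    (leftRegular S f (lp.single 2 (⟨src g, hs⟩ : S) (1 : ℂ)) : S → ℂ) ⟨g, hg⟩ = f g := by
  rw [leftRegular_single hf, kern_of_eq _ (gpd_src_src g), ginv_eq_self (src_mem_units g),
    gmul_src]

theorem toFunctionOnArrows_leftRegular {f : G → ℂ} (hf : BisectionBounded f) :
    toFunctionOnArrows (leftRegular Set.univ f) = f := by
  classical
  ext g
  rw [toFunctionOnArrows_eq]
  exact leftRegular_single_src hf (Set.mem_univ g) (Set.mem_univ (src g))

variable [TopologicalSpace G]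

/-- Elements of `C*_r(G)` act as convolution operators by the functions they define. -/
theorem apply_single_of_mem {a : Ell2 (Set.univ : Set G) →L[ℂ] Ell2 (Set.univ : Set G)}
    (ha : a ∈ reducedCStarAlgebra G) [DecidableEq (Set.univ : Set G)]
    (g h : (Set.univ : Set G)) :
    (a (lp.single 2 h (1 : ℂ)) : ↥(Set.univ : Set G) → ℂ) g = kern (toFunctionOnArrows a) g h := by
  have hcl : IsClosed {a : Ell2 (Set.univ : Set G) →L[ℂ] Ell2 (Set.univ : Set G) |
      (a (lp.single 2 h (1 : ℂ)) : ↥(Set.univ : Set G) → ℂ) g = kern (toFunctionOnArrows a) g h} := by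
    refine isClosed_eq (continuous_apply_single g h) ?_
    unfold kern
    split_ifs
    · exact continuous_toFunctionOnArrows _
    · exact continuous_const
  refine closure_minimal ?_ hcl ha
  rintro _ ⟨f, hf, rfl⟩
  have hb := bisectionBounded_of_mem hf
  rw [Set.mem_ofPred_eq, leftRegular_single hb, toFunctionOnArrows_leftRegular hb]

theorem eq_zero_of_toFunctionOnArrows
    {a : Ell2 (Set.univ : Set G) →L[ℂ] Ell2 (Set.univ : Set G)}
    (ha : a ∈ reducedCStarAlgebra G) (h : ∀ g, toFunctionOnArrows a g = 0) : a = 0 := by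
  classical
  refine ell2_operator_ext_single fun g k => ?_
  rw [apply_single_of_mem ha]
  unfold kern
  simp [h]

variable [IsEtaleGroupoid G]

/-- An element of `𝒞_c(G)` is continuous at every arrow whose source is a Hausdorff unit. -/
theorem continuousAt_of_src_mem {f : G → ℂ} (hf : f ∈ convolutionAlgebra Set.univ) {g : G}
    (hg : src g ∈ hausdorffUnits G) : ContinuousAt f g := by
  induction hf using Submodule.span_induction with
  | mem f h =>
    obtain ⟨U, hU, hc, K, hKU, hK, h0⟩ := h
    by_cases hgU : g ∈ U
    · exact hc.continuousAt ((isOpenBisection_univ_iff.1 hU).1.mem_nhds hgU)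
    · have hd : Disjoint (𝓝 g) (𝓝ˢ K) := by
        rw [disjoint_comm, hK.disjoint_nhdsSet_left]
        exact fun k hk => (disjoint_nhds_of_src hg fun e => hgU (e ▸ hKU hk)).symm
      obtain ⟨N, hN, M, hM, hNM⟩ := Filter.disjoint_iff.1 hd
      refine (continuousAt_const (y := (0 : ℂ))).congr ?_
      filter_upwards [hN] with k hk
      exact (h0 k fun hkK => Set.disjoint_left.1 hNM hk (subset_of_mem_nhdsSet hM hkK)).symm
  | zero => exact continuousAt_const
  | add f f' _ _ h h' => exact h.add h'
  | smul c f _ h => exact h.const_smul c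

theorem mem_singularIdeal_iff
    (hcover : ∃ U : ℕ → Set G, (∀ n, IsOpenBisection Set.univ (U n)) ∧ ⋃ n, U n = Set.univ)
    {a : Ell2 (Set.univ : Set G) →L[ℂ] Ell2 (Set.univ : Set G)} :
    a ∈ singularIdeal G ↔ a ∈ reducedCStarAlgebra G ∧
      ∀ g, src g ∈ hausdorffUnits G → toFunctionOnArrows a g = 0 := by
  refine and_congr_right fun ha => ⟨fun hm g hg => ?_, fun h => ?_⟩
  · by_contra hne
    have hε : 0 < ‖toFunctionOnArrows a g‖ / 2 := by positivity
    obtain ⟨_, ⟨f, hf, rfl⟩, hd⟩ := Metric.mem_closure_iff.1 ha _ hε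
    have hb := bisectionBounded_of_mem hf
    have hle : ∀ k, ‖toFunctionOnArrows a k - f k‖ < ‖toFunctionOnArrows a g‖ / 2 := by
      intro k
      have := norm_toFunctionOnArrows_le (a - leftRegular Set.univ f) k
      rw [toFunctionOnArrows_sub, toFunctionOnArrows_leftRegular hb] at this
      rw [dist_eq_norm] at hd
      exact this.trans_lt hd
    have h1 : ‖toFunctionOnArrows a g‖ / 2 < ‖f g‖ := by
      have := norm_sub_norm_le (toFunctionOnArrows a g) (f g)
      have := hle g
      linarith
    have h2 : ∀ᶠ k in 𝓝 g, ‖toFunctionOnArrows a g‖ / 2 < ‖f k‖ :=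
      (continuousAt_of_src_mem hf hg).norm.eventually (lt_mem_nhds h1)
    obtain ⟨N, hN, hNo, hgN⟩ := mem_nhds_iff.1 h2
    refine not_isMeagre_of_isOpen (isOpenMap_srcUnit N hNo) ⟨_, g, hgN, rfl⟩ (hm.mono ?_)
    rintro _ ⟨k, hk, rfl⟩
    refine ⟨k, rfl, fun h0 => ?_⟩
    have h3 := hle k
    rw [h0, zero_sub, norm_neg] at h3
    exact absurd (hN hk) (not_lt.2 h3.le)
  · refine (isMeagre_compl_hausdorffUnits hcover).mono ?_
    rintro u ⟨g, hg, hne⟩ hu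
    exact hne (h g (hg ▸ hu))

variable (G) in
/-- The star algebra of pairs `(λ(f), λ_C(f))`, `f ∈ 𝒞_c(G)`, where `λ_C` is the direct sum of the
regular representations at Hausdorff units. -/
def regularPairs : NonUnitalStarSubalgebra ℂ
    ((Ell2 (Set.univ : Set G) →L[ℂ] Ell2 (Set.univ : Set G)) ×
      (Ell2 {g : G | src g ∈ hausdorffUnits G} →L[ℂ] Ell2 {g : G | src g ∈ hausdorffUnits G})) where
  carrier := {p | ∃ f ∈ convolutionAlgebra (Set.univ : Set G),
    p = (leftRegular Set.univ f, leftRegular {g : G | src g ∈ hausdorffUnits G} f)}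
  add_mem' := by
    rintro _ _ ⟨f, hf, rfl⟩ ⟨f', hf', rfl⟩
    refine ⟨f + f', Submodule.add_mem _ hf hf', ?_⟩
    have hb := bisectionBounded_of_mem hf
    have hb' := bisectionBounded_of_mem hf'
    rw [leftRegular_add hb hb', leftRegular_add hb hb', Prod.mk_add_mk]
  zero_mem' := by
    refine ⟨0, Submodule.zero_mem _, ?_⟩
    have z : ∀ S : Set G, leftRegular S (0 : G → ℂ) = 0 := fun S => by
      simpa using leftRegular_smul BisectionBounded.zero 0 S
    rw [z, z]
    rfl
  smul_mem' := by
    rintro c _ ⟨f, hf, rfl⟩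
    refine ⟨c • f, Submodule.smul_mem _ c hf, ?_⟩
    have hb := bisectionBounded_of_mem hf
    rw [leftRegular_smul hb, leftRegular_smul hb, Prod.smul_mk]
  mul_mem' := by
    rintro _ _ ⟨f, hf, rfl⟩ ⟨f', hf', rfl⟩
    obtain ⟨p, hp, e⟩ := exists_leftRegular_mul hf hf'
    refine ⟨p, hp, ?_⟩
    rw [e Set.univ fun _ _ _ _ => trivial, e {g : G | src g ∈ hausdorffUnits G}, Prod.mk_mul_mk]
    intro g hg k hk
    rw [Set.mem_ofPred_eq] at hg ⊢
    rwa [hk]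
  star_mem' := by
    rintro _ ⟨f, hf, rfl⟩
    have hs := convStar_mem hf
    refine ⟨convStar f, hs, ?_⟩
    rw [leftRegular_convStar (bisectionBounded_of_mem hf) (bisectionBounded_of_mem hs),
      leftRegular_convStar (bisectionBounded_of_mem hf) (bisectionBounded_of_mem hs)]
    rfl

theorem fst_mem_reducedCStarAlgebra
    {p : (Ell2 (Set.univ : Set G) →L[ℂ] Ell2 (Set.univ : Set G)) ×
      (Ell2 {g : G | src g ∈ hausdorffUnits G} →L[ℂ] Ell2 {g : G | src g ∈ hausdorffUnits G})}
    (hp : p ∈ closure (regularPairs G : Set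
      ((Ell2 (Set.univ : Set G) →L[ℂ] Ell2 (Set.univ : Set G)) ×
      (Ell2 {g : G | src g ∈ hausdorffUnits G} →L[ℂ] Ell2 {g : G | src g ∈ hausdorffUnits G})))) :
    p.1 ∈ reducedCStarAlgebra G := by
  refine map_mem_closure continuous_fst hp ?_
  rintro _ ⟨f, hf, rfl⟩
  exact ⟨f, hf, rfl⟩

theorem mul_mem_reducedCStarAlgebra
    {a b : Ell2 (Set.univ : Set G) →L[ℂ] Ell2 (Set.univ : Set G)}
    (ha : a ∈ reducedCStarAlgebra G) (hb : b ∈ reducedCStarAlgebra G) :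
    a * b ∈ reducedCStarAlgebra G := by
  refine map_mem_closure₂ continuous_mul ha hb ?_
  rintro _ ⟨f, hf, rfl⟩ _ ⟨f', hf', rfl⟩
  obtain ⟨p, hp, e⟩ := exists_leftRegular_mul hf hf'
  exact ⟨p, hp, e _ fun _ _ _ _ => trivial⟩

theorem star_mem_reducedCStarAlgebra
    {a : Ell2 (Set.univ : Set G) →L[ℂ] Ell2 (Set.univ : Set G)}
    (ha : a ∈ reducedCStarAlgebra G) : star a ∈ reducedCStarAlgebra G := by
  refine map_mem_closure continuous_star ha ?_
  rintro _ ⟨f, hf, rfl⟩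
  have hs := convStar_mem hf
  exact ⟨_, hs, leftRegular_convStar (bisectionBounded_of_mem hf) (bisectionBounded_of_mem hs) _⟩

/-- If the singular ideal vanishes, then the reduced norm is computed by the regular
representations at Hausdorff units. -/
theorem reducedNorm_univ_le_of_singularIdeal
    (hcover : ∃ U : ℕ → Set G, (∀ n, IsOpenBisection Set.univ (U n)) ∧ ⋃ n, U n = Set.univ)
    (hJ : singularIdeal G = {0}) {f : G → ℂ} (hf : f ∈ convolutionAlgebra Set.univ) :
    reducedNorm Set.univ f ≤ reducedNorm {g : G | src g ∈ hausdorffUnits G} f := by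
  classical
  refine norm_fst_le_norm_snd (regularPairs G) (fun z hz => ?_)
    (p := (leftRegular Set.univ f, leftRegular _ f)) ⟨f, hf, rfl⟩
  have : z ∈ singularIdeal G := by
    refine (mem_singularIdeal_iff hcover).2 ⟨fst_mem_reducedCStarAlgebra hz, fun g hg => ?_⟩
    have hs : src g ∈ {g : G | src g ∈ hausdorffUnits G} := by
      rw [Set.mem_ofPred_eq, gpd_src_src]
      exact hg
    have hcl := isClosed_eq ((continuous_toFunctionOnArrows g).comp continuous_fst)
      ((continuous_apply_single (⟨g, hg⟩ : {g : G | src g ∈ hausdorffUnits G}) ⟨src g, hs⟩).comp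
        continuous_snd)
    have := closure_minimal (s := (regularPairs G : Set _)) ?_ hcl hz
    · rw [Set.mem_ofPred_eq] at this
      simpa using this
    · rintro _ ⟨f, hf, rfl⟩
      have hb := bisectionBounded_of_mem hf
      rw [Set.mem_ofPred_eq, Function.comp_apply, Function.comp_apply,
        toFunctionOnArrows_leftRegular hb, leftRegular_single_src hb]
  rw [hJ] at this
  exact this

/-- A nonzero singular element `a` gives the singular element `a* a`, which does not vanish on the
unit space. -/
theorem exists_mem_singularIdeal_unit
    (hcover : ∃ U : ℕ → Set G, (∀ n, IsOpenBisection Set.univ (U n)) ∧ ⋃ n, U n = Set.univ)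
    (hJ : singularIdeal G ≠ {0}) :
    ∃ b ∈ singularIdeal G, ∃ x : units G, toFunctionOnArrows b x ≠ 0 := by
  classical
  have h0 : (0 : Ell2 (Set.univ : Set G) →L[ℂ] Ell2 (Set.univ : Set G)) ∈ singularIdeal G := by
    refine (mem_singularIdeal_iff hcover).2 ⟨subset_closure ⟨0, Submodule.zero_mem _, ?_⟩, ?_⟩
    · simpa using leftRegular_smul BisectionBounded.zero 0 (Set.univ : Set G)
    · intro g _
      unfold toFunctionOnArrows
      simp
  obtain ⟨a, ha, hne⟩ : ∃ a ∈ singularIdeal G, a ≠ 0 := by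
    by_contra! hcon
    exact hJ (Set.Subset.antisymm (fun a ha => hcon a ha) (by simpa using h0))
  rw [mem_singularIdeal_iff hcover] at ha
  obtain ⟨g, hg⟩ : ∃ g, toFunctionOnArrows a g ≠ 0 := by
    by_contra! hcon
    exact hne (eq_zero_of_toFunctionOnArrows ha.1 hcon)
  have hu : ∀ u : (Set.univ : Set G), src (u : G) = u →
      toFunctionOnArrows (star a * a) u = (‖a (lp.single 2 u (1 : ℂ))‖ ^ 2 : ℝ) := by
    rintro ⟨u, hu⟩ (e : src u = u)
    have e' : (⟨src u, trivial⟩ : (Set.univ : Set G)) = ⟨u, hu⟩ := Subtype.ext e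
    rw [toFunctionOnArrows_eq, e', mul_apply_eq_comp, ContinuousLinearMap.star_eq_adjoint]
    have h1 := ContinuousLinearMap.adjoint_inner_right a (lp.single 2 ⟨u, hu⟩ (1 : ℂ))
      (a (lp.single 2 ⟨u, hu⟩ (1 : ℂ)))
    rw [lp.inner_single_left, inner_self_eq_norm_sq_to_K] at h1
    simpa using h1
  refine ⟨star a * a, (mem_singularIdeal_iff hcover).2
    ⟨mul_mem_reducedCStarAlgebra (star_mem_reducedCStarAlgebra ha.1) ha.1, fun k hk => ?_⟩,
    srcUnit g, ?_⟩
  · have : a (lp.single 2 (⟨src k, trivial⟩ : (Set.univ : Set G)) (1 : ℂ)) = 0 := by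
      refine lp.ext (funext fun h => ?_)
      rw [apply_single_of_mem ha.1]
      by_cases e : src (src k) = src (h : G)
      · rw [kern_of_eq _ e, ha.2 _ (by rw [src_div e]; exact rng_mem_hausdorffUnits (by rwa [gpd_src_src]))]
        rfl
      · rw [kern_of_ne _ e]
        rfl
    rw [toFunctionOnArrows_eq, mul_apply_eq_comp, this, map_zero]
    rfl
  · have h1 := hu ⟨src g, trivial⟩ (gpd_src_src g)
    change toFunctionOnArrows (star a * a) (src g) ≠ 0
    rw [h1]
    have h2 : a (lp.single 2 (⟨src g, trivial⟩ : (Set.univ : Set G)) (1 : ℂ)) ≠ 0 := by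
      intro h3
      refine hg ?_
      rw [toFunctionOnArrows_eq, h3]
      rfl
    exact_mod_cast (pow_pos (norm_pos_iff.2 h2) 2).ne'

/-- A singular element does not vanish at a unit only if that unit is extremely dangerous. An
approximation of it in `𝒞_c(G)` is small at the Hausdorff units near `x` although it is not small at
`x`; so most units near `x` must lie in one of the bisections of its pieces that do not contain `x`,
and only those through a nontrivial isotropy arrow at `x` can contain units close to `x`. -/
theorem mem_extremelyDangerous_of_singularIdeal
    (hcover : ∃ U : ℕ → Set G, (∀ n, IsOpenBisection Set.univ (U n)) ∧ ⋃ n, U n = Set.univ)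
    {b : Ell2 (Set.univ : Set G) →L[ℂ] Ell2 (Set.univ : Set G)} (hb : b ∈ singularIdeal G)
    {x : units G} (hx : toFunctionOnArrows b x ≠ 0) : x ∈ extremelyDangerous G := by
  classical
  rw [mem_singularIdeal_iff hcover] at hb
  set δ : ℝ := ‖toFunctionOnArrows b x‖ / 2
  have hδ : 0 < δ := by positivity
  obtain ⟨_, ⟨f, hf, rfl⟩, hd⟩ := Metric.mem_closure_iff.1 hb.1 _ hδ
  have hle : ∀ k, ‖toFunctionOnArrows b k - f k‖ < δ := by
    intro k
    have := norm_toFunctionOnArrows_le (b - leftRegular Set.univ f) k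
    rw [toFunctionOnArrows_sub, toFunctionOnArrows_leftRegular (bisectionBounded_of_mem hf)] at this
    rw [dist_eq_norm] at hd
    exact this.trans_lt hd
  have hfx : δ < ‖f x‖ := by
    have h1 := norm_sub_norm_le (toFunctionOnArrows b x) (f x)
    have h2 := hle x
    have h3 : ‖toFunctionOnArrows b x‖ = δ + δ := by simp only [δ]; ring
    linarith
  have hfC : ∀ z ∈ hausdorffUnits G, ‖f z‖ < δ := by
    intro z hz
    have := hle z
    rwa [hb.2 z (by rwa [src_eq_self hz.1]), zero_sub, norm_neg] at this
  obtain ⟨n, φ, U, K, rfl, h⟩ := exists_sum_of_mem hf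
  have hUo : ∀ i, IsOpen (U i) := fun i => (isOpenBisection_univ_iff.1 (h i).1).1
  -- the pieces whose bisection contains `x` form a function that is continuous on `G⁰` at `x`
  set ψ : units G → ℂ := fun u => ∑ i with (x : G) ∈ U i, φ i u
  have hψ : ContinuousAt ψ x := by
    refine tendsto_finsetSum _ fun i hi => ?_
    have hi' : (x : G) ∈ U i := by simpa using hi
    exact ((h i).2.1.continuousAt ((hUo i).mem_nhds hi')).tendsto.comp
      (continuous_subtype_val.tendsto x)
  have hψx : ψ x = (∑ i, φ i) x := by
    rw [Finset.sum_apply]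
    refine Finset.sum_subset (Finset.filter_subset _ _) fun i _ hi => ?_
    exact (h i).2.2.2.2 _ fun hK => hi (by simpa using (h i).2.2.1 hK)
  -- the bisections that contain a nontrivial isotropy arrow at `x`
  set I : Finset (Fin n) := {i | (x : G) ∉ U i ∧ ∃ g ∈ K i, src g = x ∧ rng g = x}
  have hI : ∀ i ∈ I, (x : G) ∉ U i ∧ ∃ g ∈ K i, src g = x ∧ rng g = x := fun i hi => by
    simpa [I] using hi
  have hev : ∀ᶠ u : units G in 𝓝 x, ∀ i, (x : G) ∉ U i → i ∉ I → (u : G) ∉ K i := by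
    refine Filter.eventually_all.2 fun i => ?_
    by_cases hxi : (x : G) ∈ U i
    · exact Filter.Eventually.of_forall fun u h => absurd hxi h
    by_cases hiI : i ∈ I
    · exact Filter.Eventually.of_forall fun u _ h => absurd hiI h
    have hcl : IsClosed ((fun g : G => (srcUnit g, rngUnit g)) '' K i) :=
      ((h i).2.2.2.1.image (continuous_srcUnit.prodMk continuous_rngUnit)).isClosed
    have hxn : (x, x) ∉ (fun g : G => (srcUnit g, rngUnit g)) '' K i := by
      rintro ⟨g, hg, e⟩
      rw [Prod.mk.injEq] at e
      exact hiI (by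
        simp only [I, Finset.mem_filter, Finset.mem_univ, true_and]
        exact ⟨hxi, g, hg, congrArg Subtype.val e.1, congrArg Subtype.val e.2⟩)
    have hcont : Filter.Tendsto (fun u : units G => (u, u)) (𝓝 x) (𝓝 (x, x)) :=
      (continuous_id.prodMk continuous_id).tendsto x
    filter_upwards [hcont (hcl.isOpen_compl.mem_nhds hxn)] with u hu _ _ huK
    exact hu ⟨u, huK, Prod.ext (srcUnit_coe u) (rngUnit_coe u)⟩
  have hev2 : ∀ᶠ u in 𝓝 x, δ < ‖ψ u‖ := by
    refine hψ.norm.eventually (lt_mem_nhds ?_)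
    change δ < ‖ψ x‖
    rwa [hψx]
  obtain ⟨V, hV, hVo, hxV⟩ := mem_nhds_iff.1 (hev.and hev2)
  have : Nonempty G := ⟨x⟩
  have hI2 : ∀ i ∈ I, ∃ g ∈ K i, src g = x ∧ rng g = x := fun i hi => (hI i hi).2
  choose! g hgK hgs hgr using hI2
  refine ⟨I.card, fun i => g (I.equivFin.symm i), fun i => U (I.equivFin.symm i), fun i => ?_,
    V, hVo, hxV, ?_⟩
  · have hi := (I.equivFin.symm i).2
    refine ⟨hgs _ hi, hgr _ hi, fun e => (hI _ hi).1 ?_, (h _).1, (h _).2.2.1 (hgK _ hi)⟩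
    rw [← e]
    exact (h _).2.2.1 (hgK _ hi)
  · by_contra hne
    obtain ⟨z, hzint, hzC⟩ := (dense_hausdorffUnits hcover).inter_open_nonempty _ isOpen_interior
      (Set.nonempty_iff_ne_empty.2 hne)
    obtain ⟨hzV, hzU⟩ := interior_subset hzint
    have hzU' : ∀ i ∈ I, (z : G) ∉ U i := fun i hi hzi =>
      hzU (Set.mem_iUnion.2 ⟨I.equivFin ⟨i, hi⟩, by simpa using hzi⟩)
    obtain ⟨h1, h2⟩ := hV hzV
    have e : ψ z = (∑ i, φ i) z := by
      rw [Finset.sum_apply]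
      refine Finset.sum_subset (Finset.filter_subset _ _) fun i _ hi => (h i).2.2.2.2 _ fun hK => ?_
      have hxi : (x : G) ∉ U i := by simpa using hi
      by_cases hiI : i ∈ I
      · exact hzU' i hiI ((h i).2.2.1 hK)
      · exact h1 i hxi hiI hK
    rw [e] at h2
    exact absurd h2 (not_lt.2 (hfC z hzC).le)

end Reduced

/-! ### Completions for seminorms -/

section Completions

variable {A : Type*} [AddCommGroup A] [Module ℂ A] {p q : Seminorm ℂ A}

theorem dist_withSeminorm (p : Seminorm ℂ A) (a b : WithSeminorm p) :
    dist a b = p (show A from a - b) := by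
  rw [dist_eq_norm]
  rfl

theorem uniformContinuous_withSeminorm (hqp : q ≤ p) :
    UniformContinuous (fun a : WithSeminorm p => (show WithSeminorm q from (a : A))) := by
  refine (LipschitzWith.of_dist_le_mul (K := 1) fun a b => ?_).uniformContinuous
  rw [dist_withSeminorm, dist_withSeminorm, NNReal.coe_one, one_mul]
  exact hqp _

theorem completionKernel_self (p : Seminorm ℂ A) : completionKernel p p = {0} := by
  have : completionMap p p = id := UniformSpace.Completion.map_id
  unfold completionKernel
  rw [this]
  rfl

/-- Sequences that are Cauchy for `p` and null for `q` represent the elements of the kernel of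
`C*_p → C*_q`. -/
theorem tendsto_zero_of_completionKernel (hqp : q ≤ p) (h : completionKernel p q = {0})
    {a : ℕ → A} (hc : ∀ ε > 0, ∃ N, ∀ m ≥ N, ∀ n ≥ N, p (a m - a n) < ε)
    (hq : Filter.Tendsto (fun n => q (a n)) Filter.atTop (𝓝 0)) :
    Filter.Tendsto (fun n => p (a n)) Filter.atTop (𝓝 0) := by
  let u : ℕ → WithSeminorm p := a
  have hu : CauchySeq u := Metric.cauchySeq_iff.2 fun ε hε => by
    obtain ⟨N, hN⟩ := hc ε hε
    exact ⟨N, fun m hm n hn => (dist_withSeminorm p _ _).trans_lt (hN m hm n hn)⟩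
  obtain ⟨z, hz⟩ := cauchySeq_tendsto_of_complete
    (α := SeminormCompletion p) (u := fun n => (u n : SeminormCompletion p))
    (hu.map (UniformSpace.Completion.uniformContinuous_coe (WithSeminorm p)))
  have h1 : Filter.Tendsto (fun n => completionMap p q ((u n : WithSeminorm p) :
      SeminormCompletion p)) Filter.atTop (𝓝 (completionMap p q z)) :=
    (UniformSpace.Completion.continuous_map.tendsto z).comp hz
  have h2 : Filter.Tendsto (fun n => completionMap p q ((u n : WithSeminorm p) :
      SeminormCompletion p)) Filter.atTop (𝓝 0) := by
    rw [tendsto_zero_iff_norm_tendsto_zero]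
    refine hq.congr fun n => ?_
    rw [completionMap, UniformSpace.Completion.map_coe (uniformContinuous_withSeminorm hqp),
      UniformSpace.Completion.norm_coe]
    rfl
  have h3 : z ∈ completionKernel p q := tendsto_nhds_unique h1 h2
  rw [h] at h3
  have h4 := hz.norm
  rw [show z = 0 from h3, norm_zero] at h4
  refine h4.congr fun n => ?_
  rw [UniformSpace.Completion.norm_coe]
  rfl

end Completions

/-! ### Permutation representations of groups -/

section Permutation

variable {Γ Ω : Type*} [Group Γ] [MulAction Γ Ω]

/-- The operator of `a ∈ ℂ[Γ]` in a unitary representation. -/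
def repOp {H : Type*} [NormedAddCommGroup H] [InnerProductSpace ℂ H]
    (π : Γ →* (H ≃ₗᵢ[ℂ] H)) : MonoidAlgebra ℂ Γ →ₐ[ℂ] (H →L[ℂ] H) :=
  MonoidAlgebra.lift ℂ (H →L[ℂ] H) Γ
    { toFun := fun γ => ((π γ).toContinuousLinearEquiv : H →L[ℂ] H)
      map_one' := by rw [map_one]; rfl
      map_mul' := fun γ δ => by rw [map_mul]; rfl }

theorem repSeminorm_apply {H : Type*} [NormedAddCommGroup H] [InnerProductSpace ℂ H]
    (π : Γ →* (H ≃ₗᵢ[ℂ] H)) (a : MonoidAlgebra ℂ Γ) : repSeminorm π a = ‖repOp π a‖ := rfl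

theorem repOp_apply {H : Type*} [NormedAddCommGroup H] [InnerProductSpace ℂ H]
    (π : Γ →* (H ≃ₗᵢ[ℂ] H)) (a : MonoidAlgebra ℂ Γ) (ξ : H) :
    repOp π a ξ = a.coeff.sum fun γ c => c • π γ ξ := by
  unfold repOp
  rw [MonoidAlgebra.lift_apply, Finsupp.sum, Finsupp.sum, sum_apply]
  rfl

open Classical in
/-- The matrix of `a ∈ ℂ[Γ]` in a permutation representation. -/
def actKern (a : MonoidAlgebra ℂ Γ) (p q : Ω) : ℂ :=
  a.coeff.sum fun γ c => if γ • q = p then c else 0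

theorem repOp_permutationRep_single [DecidableEq Ω] (a : MonoidAlgebra ℂ Γ) (p q : Ω) :
    (repOp (permutationRep Γ Ω) a (lp.single 2 q (1 : ℂ)) : Ω → ℂ) p = actKern a p q := by
  rw [repOp_apply, Finsupp.sum, lp.coeFn_sum, Finset.sum_apply]
  refine Finset.sum_congr rfl fun γ _ => ?_
  rw [lp.coeFn_smul, Pi.smul_apply, smul_eq_mul]
  change a.coeff γ * (lp.single (E := fun _ : Ω => ℂ) 2 q (1 : ℂ)) (γ⁻¹ • p) = _
  beta_reduce
  by_cases h : γ • q = p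
  · have : γ⁻¹ • p = q := by rw [← h, inv_smul_smul]
    rw [if_pos h, this, lp.single_apply_self, mul_one]
  · rw [if_neg h, lp.single_apply_ne _ _ _ (fun e => h (by rw [← e, smul_inv_smul])), mul_zero]

theorem repSeminorm_permutationRep_le {a : MonoidAlgebra ℂ Γ} {c : ℝ} (hc : 0 ≤ c)
    (h : KerBound (actKern (Ω := Ω) a) Set.univ c) : repSeminorm (permutationRep Γ Ω) a ≤ c := by
  classical
  exact ell2_norm_le_of_kerBound (repOp_permutationRep_single a) hc h

theorem kerBound_repSeminorm (a : MonoidAlgebra ℂ Γ) :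
    KerBound (actKern (Ω := Ω) a) Set.univ (repSeminorm (permutationRep Γ Ω) a) := by
  classical
  exact kerBound_of_operator (repOp_permutationRep_single a)

theorem actKern_regular (a : MonoidAlgebra ℂ Γ) (p q : Γ) :
    actKern a p q = a.coeff (p * q⁻¹) := by
  classical
  unfold actKern
  have : ∀ γ : Γ, γ • q = p ↔ γ = p * q⁻¹ := fun γ => by
    rw [smul_eq_mul, eq_mul_inv_iff_mul_eq]
  simp_rw [this]
  rw [Finsupp.sum_ite_eq']
  by_cases h : p * q⁻¹ ∈ a.coeff.support
  · rw [if_pos h]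
  · rw [if_neg h, Finsupp.notMem_support_iff.1 h]

theorem groupReducedNorm_le {a : MonoidAlgebra ℂ Γ} {c : ℝ} (hc : 0 ≤ c)
    (h : KerBound (fun p q : Γ => a.coeff (p * q⁻¹)) Set.univ c) : groupReducedNorm Γ a ≤ c :=
  repSeminorm_permutationRep_le hc (h.congr fun p _ q _ => actKern_regular a p q)

theorem kerBound_groupReducedNorm (a : MonoidAlgebra ℂ Γ) :
    KerBound (fun p q : Γ => a.coeff (p * q⁻¹)) Set.univ (groupReducedNorm Γ a) :=
  (kerBound_repSeminorm a).congr fun p _ q _ => (actKern_regular a p q).symm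

theorem norm_coeff_one_le (a : MonoidAlgebra ℂ Γ) : ‖a.coeff 1‖ ≤ groupReducedNorm Γ a := by
  simpa using (kerBound_groupReducedNorm a).entry_le (Set.mem_univ (1 : Γ))

end Permutation

/-! ### Restriction of functions to isotropy groups -/

section Restriction

open Coset

variable {G : Type*} [GroupoidArrows G] {x : units G}

/-- The restriction of a function to the isotropy group at `x`, as an element of the group algebra. -/
theorem exists_coeff_eq {f : G → ℂ} (hf : BisectionBounded f) (x : units G) :
    ∃ a : MonoidAlgebra ℂ (Isotropy x), ∀ g, a.coeff g = f g.1 := by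
  have hfin : (Function.support fun g : Isotropy x => f g.1).Finite := by
    obtain ⟨n, U, c, hc, hU, hf, -⟩ := hf
    refine (Set.finite_iUnion (f := fun m => {g : Isotropy x | g.1 ∈ U m}) fun m =>
      Set.Subsingleton.finite ?_).subset fun g hg => Set.mem_iUnion.2 (hf _ hg)
    intro g hg h hh
    exact Subtype.ext ((hU m).1 hg hh (g.2.1.trans h.2.1.symm))
  exact ⟨.ofCoeff (Finsupp.ofSupportFinite _ hfin), fun g => rfl⟩

theorem cosetSum_eq_sumOnCosets {a : MonoidAlgebra ℂ (Isotropy x)} {f : G → ℂ}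
    (h : ∀ g, a.coeff g = f g.1) {Y : Coset G} (hs : ∀ g ∈ Y.carrier, src g = x)
    (hr : ∀ g ∈ Y.carrier, rng g = x) : cosetSum a Y = sumOnCosets f Y := by
  classical
  have e : Y.carrier = Subtype.val '' {g : Isotropy x | g.1 ∈ Y.carrier} := by
    ext g
    exact ⟨fun hg => ⟨⟨g, hs g hg, hr g hg⟩, hg, rfl⟩, by rintro ⟨g, hg, rfl⟩; exact hg⟩
  unfold sumOnCosets
  conv_rhs => rw [e]
  rw [finsum_mem_image Subtype.val_injective.injOn]
  unfold cosetSum Finsupp.sum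
  rw [finsum_mem_def]
  change _ = ∑ᶠ g : Isotropy x, {g : Isotropy x | g.1 ∈ Y.carrier}.indicator (fun g => f g.1) g
  rw [finsum_eq_sum_of_support_subset (s := a.coeff.support)]
  · refine Finset.sum_congr rfl fun g _ => ?_
    rw [Set.indicator_apply, ← h]
    rfl
  · intro g hg
    rw [Finset.mem_coe, Finsupp.mem_support_iff, h]
    intro h0
    refine hg ?_
    rw [Set.indicator_apply, h0, ite_self]

theorem cosetSum_add (a b : MonoidAlgebra ℂ (Isotropy x)) :
    cosetSum (a + b) = cosetSum a + cosetSum b := by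
  classical
  ext Y
  unfold cosetSum
  rw [Pi.add_apply, MonoidAlgebra.coeff_add, Finsupp.sum_add_index']
  · simp
  · intro g c d
    split_ifs <;> simp

theorem cosetSum_smul (c : ℂ) (a : MonoidAlgebra ℂ (Isotropy x)) :
    cosetSum (c • a) = c • cosetSum a := by
  classical
  ext Y
  unfold cosetSum
  rw [Pi.smul_apply, MonoidAlgebra.coeff_smul, Finsupp.sum_smul_index' (by simp), Finsupp.smul_sum]
  refine Finsupp.sum_congr fun g _ => ?_
  split_ifs <;> simp

theorem groupReducedNorm_le_reducedNorm {a : MonoidAlgebra ℂ (Isotropy x)} {f : G → ℂ}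
    (hf : BisectionBounded f) (h : ∀ g, a.coeff g = f g.1) :
    groupReducedNorm (Isotropy x) a ≤ reducedNorm Set.univ f := by
  refine groupReducedNorm_le (reducedNorm_nonneg _ _)
    ((kerBound_reducedNorm hf Set.univ).of_embedding Subtype.val Subtype.val_injective.injOn
      (Set.mapsTo_univ _ _) fun p _ q _ => ?_)
  rw [h, kern_of_eq _ (q.2.1.trans p.2.1.symm)]
  rfl

variable [TopologicalSpace G] [IsEtaleGroupoid G]

/-- Elements of the group algebra of the isotropy group at `x` extend to elements of `𝒞_c(G)`. -/
theorem exists_mem_convolutionAlgebra_coeff (a : MonoidAlgebra ℂ (Isotropy x)) :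
    ∃ f ∈ convolutionAlgebra (Set.univ : Set G), ∀ g, a.coeff g = f g.1 := by
  classical
  induction a using MonoidAlgebra.induction_linear with
  | zero => exact ⟨0, Submodule.zero_mem _, fun g => rfl⟩
  | add a b ha hb =>
    obtain ⟨f, hf, h⟩ := ha
    obtain ⟨f', hf', h'⟩ := hb
    refine ⟨f + f', Submodule.add_mem _ hf hf', fun g => ?_⟩
    rw [MonoidAlgebra.coeff_add, Finsupp.add_apply, h, h', Pi.add_apply]
  | single γ c =>
    obtain ⟨U, hU, hγU, -, hUs, hUr⟩ := exists_open_bisection γ.1 Filter.univ_mem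
    obtain ⟨K, hK, hKU, hKc⟩ := Coset.exists_compact_nhds γ.1 (hU.mem_nhds hγU)
    have hx : srcUnit γ.1 = x := Subtype.ext γ.2.1
    obtain ⟨φ, hφ⟩ := exists_isCutoff (x := x) (V := srcUnit '' K)
      (hx ▸ isOpenMap_srcUnit.image_mem_nhds hK)
    refine ⟨U.indicator fun g => c * φ (srcUnit g), Submodule.subset_span ⟨U,
      isOpenBisection_univ_iff.2 ⟨hU, hUs, hUr⟩, ?_, K, hKU, hKc, fun g hg => ?_⟩, fun g => ?_⟩
    · refine ContinuousOn.congr (f := fun g => c * (φ (srcUnit g) : ℂ)) ?_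
        fun g hg => Set.indicator_of_mem hg _
      exact (continuous_const.mul (Complex.continuous_ofReal.comp
        (hφ.continuous.comp continuous_srcUnit))).continuousOn
    · by_cases hgU : g ∈ U
      · rw [Set.indicator_of_mem hgU, hφ.eq_zero, Complex.ofReal_zero, mul_zero]
        rintro ⟨k, hk, e⟩
        exact hg (hUs (hKU hk) hgU (congrArg Subtype.val e) ▸ hk)
      · exact Set.indicator_of_notMem hgU _
    · rw [MonoidAlgebra.coeff_single, Finsupp.single_apply]
      by_cases hg : γ = g
      · rw [if_pos hg, ← hg, Set.indicator_of_mem hγU, hx, hφ.apply_self]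
        simp
      · rw [if_neg hg, Set.indicator_of_notMem fun hgU => hg (Subtype.ext
          (hUs hγU hgU (γ.2.1.trans g.2.1.symm)))]

end Restriction

/-! ### The seminorm of the essential fibre and the singular ideal -/

section FibreSeminorm

open Coset

variable {G : Type*} [GroupoidArrows G]

theorem kern_sing (F : Coset G → ℂ) (g h : G) :
    kern F (sing g) (sing h) = kern (fun k => F (sing k)) g h := by
  by_cases e : src h = src g
  · rw [kern_of_eq F (show (sing h).csrc = (sing g).csrc by rw [csrc_sing, csrc_sing, e]),
      kern_of_eq _ e]
    change F (gmul (sing g) (cinv (sing h))) = _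
    rw [cinv_sing, gmul_sing (by rw [rng_inv, e])]
  · rw [kern_of_ne _ e, kern_of_ne]
    intro h'
    change (sing h).csrc = (sing g).csrc at h'
    rw [csrc_sing, csrc_sing] at h'
    exact e (sing_injective h')

theorem reducedNorm_le_univ {f : G → ℂ} (hf : BisectionBounded f) (S : Set G) :
    reducedNorm S f ≤ reducedNorm Set.univ f :=
  reducedNorm_le hf (reducedNorm_nonneg _ _)
    ((kerBound_reducedNorm hf Set.univ).mono (Set.subset_univ S))

variable [TopologicalSpace G] {x : units G}

theorem fibreSeminorm_le_hat : fibreSeminorm x ≤ fibreSeminormHat x := le_sup_left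

variable [IsEtaleGroupoid G]

/-- The function on the essential Hausdorff cover defined by a function on `G`. -/
def essLift (f : G → ℂ) : Coset G → ℂ := (essCover G).indicator (sumOnCosets f)

theorem essLift_mem {f : G → ℂ} (hf : f ∈ convolutionAlgebra Set.univ) :
    essLift f ∈ convolutionAlgebra (essCover G) :=
  indicator_mem_convolutionAlgebra isClosed_essCover (Set.subset_univ _) (sumOnCosets_mem hf)

theorem essLift_sing (f : G → ℂ) {g : G} (hg : src g ∈ hausdorffUnits G) :
    essLift f (sing g) = f g := by
  unfold essLift
  rw [Set.indicator_of_mem (sing_mem_essCover hg), sumOnCosets_sing]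

theorem essLift_eqOn {a : MonoidAlgebra ℂ (Isotropy x)} {f : G → ℂ}
    (h : ∀ g, a.coeff g = f g.1) : Set.EqOn (essLift f) (cosetSum a) (cosetGroupoid x) := by
  intro Y hY
  obtain ⟨h1, h2, h3⟩ := mem_cosetGroupoid_iff.1 hY
  unfold essLift
  rw [Set.indicator_of_mem h1, cosetSum_eq_sumOnCosets h]
  · intro g hg
    rw [src_of_mem hg, h2]
  · intro g hg
    rw [rng_of_mem hg, h3]

theorem exists_extension (a : MonoidAlgebra ℂ (Isotropy x)) :
    ∃ F ∈ convolutionAlgebra (essCover G), Set.EqOn F (cosetSum a) (cosetGroupoid x) := by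
  obtain ⟨f, hf, h⟩ := exists_mem_convolutionAlgebra_coeff a
  exact ⟨_, essLift_mem hf, essLift_eqOn h⟩

theorem exists_reducedNorm_lt {F b : Coset G → ℂ} (hF : F ∈ convolutionAlgebra (essCover G))
    (hb : Set.EqOn F b (cosetGroupoid x)) {ε : ℝ} (hε : 0 < ε) :
    ∃ F' ∈ convolutionAlgebra (essCover G), Set.EqOn F' b (cosetGroupoid x) ∧
      reducedNorm (essCover G) F' < restrictedNorm (essCover G) (essFibre x) b + ε := by
  by_contra! hcon
  have := le_restrictedNorm hF hb hcon
  linarith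

theorem restrictedNorm_cosetSum_add (a b : MonoidAlgebra ℂ (Isotropy x)) :
    restrictedNorm (essCover G) (essFibre x) (cosetSum (a + b)) ≤
      restrictedNorm (essCover G) (essFibre x) (cosetSum a) +
      restrictedNorm (essCover G) (essFibre x) (cosetSum b) := by
  refine le_of_forall_pos_le_add fun ε hε => ?_
  obtain ⟨F₀, hF₀, e₀⟩ := exists_extension a
  obtain ⟨F₀', hF₀', e₀'⟩ := exists_extension b
  obtain ⟨F, hF, e, h⟩ := exists_reducedNorm_lt hF₀ e₀ (half_pos hε)
  obtain ⟨F', hF', e', h'⟩ := exists_reducedNorm_lt hF₀' e₀' (half_pos hε)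
  have h1 := restrictedNorm_le_of_eqOn (x := x) (Submodule.add_mem _ hF hF')
    (b := cosetSum (a + b)) fun Y hY => by
      rw [cosetSum_add, Pi.add_apply, Pi.add_apply, e hY, e' hY]
  have h2 := reducedNorm_add_le (bisectionBounded_of_mem hF) (bisectionBounded_of_mem hF')
    (essCover G)
  linarith

theorem restrictedNorm_cosetSum_smul_le (c : ℂ) (a : MonoidAlgebra ℂ (Isotropy x)) :
    restrictedNorm (essCover G) (essFibre x) (cosetSum (c • a)) ≤
      ‖c‖ * restrictedNorm (essCover G) (essFibre x) (cosetSum a) := by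
  refine le_of_forall_pos_le_add fun ε hε => ?_
  obtain ⟨F₀, hF₀, e₀⟩ := exists_extension a
  obtain ⟨F, hF, e, h⟩ := exists_reducedNorm_lt hF₀ e₀
    (show 0 < ε / (‖c‖ + 1) by positivity)
  have h1 := restrictedNorm_le_of_eqOn (x := x) (Submodule.smul_mem _ c hF)
    (b := cosetSum (c • a)) fun Y hY => by
      rw [cosetSum_smul, Pi.smul_apply, Pi.smul_apply, e hY]
  rw [reducedNorm_smul (bisectionBounded_of_mem hF)] at h1
  refine h1.trans ?_
  have h3 : ‖c‖ * (ε / (‖c‖ + 1)) ≤ ε := by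
    rw [mul_div_assoc', div_le_iff₀ (by positivity)]
    nlinarith [norm_nonneg c]
  have h4 := mul_le_mul_of_nonneg_left h.le (norm_nonneg c)
  linarith [mul_add ‖c‖ (restrictedNorm (essCover G) (essFibre x) (cosetSum a)) (ε / (‖c‖ + 1))]

theorem restrictedNorm_cosetSum_smul (c : ℂ) (a : MonoidAlgebra ℂ (Isotropy x)) :
    restrictedNorm (essCover G) (essFibre x) (cosetSum (c • a)) =
      ‖c‖ * restrictedNorm (essCover G) (essFibre x) (cosetSum a) := by
  refine le_antisymm (restrictedNorm_cosetSum_smul_le c a) ?_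
  rcases eq_or_ne c 0 with rfl | hc
  · rw [norm_zero, zero_mul]
    exact restrictedNorm_nonneg _ _ _
  · have h := restrictedNorm_cosetSum_smul_le c⁻¹ (c • a)
    rwa [inv_smul_smul₀ hc, norm_inv, le_inv_mul_iff₀ (norm_pos_iff.2 hc)] at h

theorem fibreSeminorm_apply (a : MonoidAlgebra ℂ (Isotropy x)) :
    fibreSeminorm x a = restrictedNorm (essCover G) (essFibre x) (cosetSum a) := by
  unfold fibreSeminorm seminormOfFun
  rw [dif_pos ⟨restrictedNorm_cosetSum_add, restrictedNorm_cosetSum_smul⟩]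
  rfl

theorem kern_essLift_sing (f : G → ℂ) {g h : G} (hh : src h ∈ hausdorffUnits G) :
    kern (essLift f) (sing g) (sing h) = kern f g h := by
  rw [kern_sing]
  by_cases e : src h = src g
  · rw [kern_of_eq _ e, kern_of_eq _ e, essLift_sing]
    rw [src_div e]
    exact rng_mem_hausdorffUnits hh
  · rw [kern_of_ne _ e, kern_of_ne _ e]

/-- The reduced norm of `f` at the Hausdorff units is that of its lift to the essential cover. -/
theorem reducedNorm_essLift {f : G → ℂ} (hf : f ∈ convolutionAlgebra Set.univ) :
    reducedNorm (essCover G) (essLift f) = reducedNorm {g : G | src g ∈ hausdorffUnits G} f := by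
  have hF := essLift_mem hf
  refine le_antisymm ?_ ?_
  · refine reducedNorm_le (bisectionBounded_of_mem hF) (reducedNorm_nonneg _ _)
      (kerBound_essCover hF (reducedNorm_nonneg _ _) ?_)
    exact (kerBound_reducedNorm (bisectionBounded_of_mem hf) _).congr fun g _ h hh =>
      kern_essLift_sing f hh
  · refine reducedNorm_le (bisectionBounded_of_mem hf) (reducedNorm_nonneg _ _)
      ((kerBound_reducedNorm (bisectionBounded_of_mem hF) (essCover G)).of_embedding sing
        sing_injective.injOn (fun g hg => sing_mem_essCover hg)
        fun g _ h hh => (kern_essLift_sing f hh).symm)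

theorem fibreSeminorm_le_reducedNorm {a : MonoidAlgebra ℂ (Isotropy x)} {f : G → ℂ}
    (hf : f ∈ convolutionAlgebra Set.univ) (h : ∀ g, a.coeff g = f g.1) :
    fibreSeminorm x a ≤ reducedNorm {g : G | src g ∈ hausdorffUnits G} f := by
  rw [fibreSeminorm_apply, ← reducedNorm_essLift hf]
  exact restrictedNorm_le_of_eqOn (essLift_mem hf) (essLift_eqOn h)

theorem essLift_cutArrows (φ : units G → ℝ) (f : G → ℂ) {g : G} (hg : src g ∈ hausdorffUnits G) :
    essLift (cutArrows φ f) (sing g) = cutCosets φ (essLift f) (sing g) := by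
  rw [essLift_sing _ hg, cutArrows_apply, cutCosets_apply, essLift_sing _ hg, srcPt_sing,
    rngPt_sing]

/-- If the singular ideal vanishes, then the seminorm of the essential fibre at `x` dominates the
reduced norm of the isotropy group: the two are compared on elements cut off close to `x`. -/
theorem groupReducedNorm_le_fibreSeminorm
    (hcover : ∃ U : ℕ → Set G, (∀ n, IsOpenBisection Set.univ (U n)) ∧ ⋃ n, U n = Set.univ)
    (hJ : singularIdeal G = {0}) (a : MonoidAlgebra ℂ (Isotropy x)) :
    groupReducedNorm (Isotropy x) a ≤ fibreSeminorm x a := by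
  obtain ⟨f, hf, h⟩ := exists_mem_convolutionAlgebra_coeff a
  rw [fibreSeminorm_apply]
  refine le_restrictedNorm (essLift_mem hf) (essLift_eqOn h) fun F hF hFa =>
    le_of_forall_pos_le_add fun ε hε => ?_
  have hd : essLift f - F ∈ convolutionAlgebra (essCover G) :=
    Submodule.sub_mem _ (essLift_mem hf) hF
  obtain ⟨V, hV, hVε⟩ := exists_nhds_kerBound_cut (x := x) hd (fun A hA => by
    rw [Pi.sub_apply, essLift_eqOn h hA, hFa hA, sub_self]) hε
  obtain ⟨φ, hφ⟩ := exists_isCutoff hV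
  have hf' := cutArrows_mem hφ.continuous hf
  have h' : ∀ g : Isotropy x, a.coeff g = cutArrows φ f g.1 := fun g => by
    rw [cutArrows_apply, show rngUnit g.1 = x from Subtype.ext g.2.2,
      show srcUnit g.1 = x from Subtype.ext g.2.1, hφ.apply_self, h]
    simp
  have hb := bisectionBounded_of_mem (essLift_mem hf)
  have hbF := bisectionBounded_of_mem hF
  have hcut : ∀ {F : Coset G → ℂ}, BisectionBounded F → BisectionBounded (cutCosets φ F) :=
    fun hF => hF.cut fun A => hφ.norm_le _
  calc groupReducedNorm (Isotropy x) a ≤ reducedNorm Set.univ (cutArrows φ f) :=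
        groupReducedNorm_le_reducedNorm (bisectionBounded_of_mem hf') h'
    _ ≤ reducedNorm {g : G | src g ∈ hausdorffUnits G} (cutArrows φ f) :=
        reducedNorm_univ_le_of_singularIdeal hcover hJ hf'
    _ ≤ reducedNorm (essCover G) (cutCosets φ (essLift f)) := by
        refine reducedNorm_le (bisectionBounded_of_mem hf') (reducedNorm_nonneg _ _)
          ((kerBound_reducedNorm (hcut hb) (essCover G)).of_embedding sing
            sing_injective.injOn (fun g hg => sing_mem_essCover hg) fun g _ k hk => ?_)
        rw [← kern_essLift_sing _ hk, kern_sing, kern_sing]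
        by_cases e : src k = src g
        · rw [kern_of_eq _ e, kern_of_eq _ e, essLift_cutArrows]
          rw [src_div e]
          exact rng_mem_hausdorffUnits hk
        · rw [kern_of_ne _ e, kern_of_ne _ e]
    _ ≤ reducedNorm (essCover G) (cutCosets φ F) +
          reducedNorm (essCover G) (cutCosets φ (essLift f - F)) := by
        refine le_trans (le_of_eq ?_) (reducedNorm_add_le (hcut hbF)
          (hcut (bisectionBounded_of_mem hd)) _)
        congr 1
        unfold cutCosets
        rw [← cut_add, add_sub_cancel]
    _ ≤ reducedNorm (essCover G) F + ε :=
        add_le_add (reducedNorm_cut_le hbF (fun A => hφ.norm_le _) _) (hVε φ hφ)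

theorem fibreSeminormHat_le_reducedNorm {a : MonoidAlgebra ℂ (Isotropy x)} {f : G → ℂ}
    (hf : f ∈ convolutionAlgebra Set.univ) (h : ∀ g, a.coeff g = f g.1) :
    fibreSeminormHat x a ≤ reducedNorm Set.univ f := by
  have hb := bisectionBounded_of_mem hf
  exact sup_le ((fibreSeminorm_le_reducedNorm hf h).trans (reducedNorm_le_univ hb _))
    (groupReducedNorm_le_reducedNorm hb h)

/-- The singular ideal vanishes if and only if, at every extremely dangerous point, the reduced
norm of the isotropy group adds nothing to the seminorm of the essential fibre. -/
theorem singularIdeal_eq_iff_fibreKernel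
    (hcover : ∃ U : ℕ → Set G, (∀ n, IsOpenBisection Set.univ (U n)) ∧ ⋃ n, U n = Set.univ) :
    singularIdeal G = {0} ↔ ∀ x ∈ extremelyDangerous G, fibreKernel x = {0} := by
  constructor
  · intro hJ x _
    have : fibreSeminormHat x = fibreSeminorm x :=
      sup_eq_left.2 fun a => groupReducedNorm_le_fibreSeminorm hcover hJ a
    unfold fibreKernel
    rw [this]
    exact completionKernel_self _
  · intro hK
    by_contra hJ
    obtain ⟨b, hb, x, hbx⟩ := exists_mem_singularIdeal_unit hcover hJ
    have hx := mem_extremelyDangerous_of_singularIdeal hcover hb hbx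
    rw [mem_singularIdeal_iff hcover] at hb
    obtain ⟨T, hT, hTb⟩ := mem_closure_iff_seq_limit.1 hb.1
    choose f hf hfT using hT
    have hbd := fun n => bisectionBounded_of_mem (hf n)
    choose a ha using fun n => exists_coeff_eq (hbd n) x
    have hT0 : Filter.Tendsto (fun n => ‖T n - b‖) Filter.atTop (𝓝 0) :=
      tendsto_iff_norm_sub_tendsto_zero.1 hTb
    -- `b` vanishes on the arrows with Hausdorff source, so the norms of `f n` there tend to zero
    have hC : ∀ n, reducedNorm {g : G | src g ∈ hausdorffUnits G} (f n) ≤ ‖T n - b‖ := by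
      classical
      intro n
      refine reducedNorm_le (hbd n) (norm_nonneg _) ?_
      refine (KerBound.subtype_iff (k := kern (f n - toFunctionOnArrows b)).1
        (kerBound_of_operator (T := T n - b) fun g h => ?_) |>.mono (Set.subset_univ _)).congr ?_
      · rw [sub_apply, lp.coeFn_sub, Pi.sub_apply, apply_single_of_mem hb.1, ← hfT,
          leftRegular_single (hbd n)]
        unfold kern
        split_ifs <;> simp
      · intro g _ h hh
        by_cases e : src h = src g
        · rw [kern_of_eq _ e, kern_of_eq _ e, Pi.sub_apply, hb.2, sub_zero]
          rw [src_div e]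
          exact rng_mem_hausdorffUnits hh
        · rw [kern_of_ne _ e, kern_of_ne _ e]
    have hq : Filter.Tendsto (fun n => fibreSeminorm x (a n)) Filter.atTop (𝓝 0) :=
      squeeze_zero (fun n => apply_nonneg _ _)
        (fun n => (fibreSeminorm_le_reducedNorm (hf n) (ha n)).trans (hC n)) hT0
    have hc : ∀ ε > 0, ∃ N, ∀ m ≥ N, ∀ n ≥ N, fibreSeminormHat x (a m - a n) < ε := by
      intro ε hε
      obtain ⟨N, hN⟩ := Metric.cauchySeq_iff.1 hTb.cauchySeq ε hε
      refine ⟨N, fun m hm n hn => lt_of_le_of_lt ?_ (hN m hm n hn)⟩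
      refine (fibreSeminormHat_le_reducedNorm (f := f m + (-1 : ℂ) • f n)
        (Submodule.add_mem _ (hf m) (Submodule.smul_mem _ _ (hf n))) fun g => ?_).trans ?_
      · rw [MonoidAlgebra.coeff_sub, Finsupp.sub_apply, ha, ha]
        simp [sub_eq_add_neg]
      · unfold reducedNorm
        rw [leftRegular_add (hbd m) ((hbd n).smul _), leftRegular_smul (hbd n), hfT, hfT,
          dist_eq_norm, neg_one_smul, sub_eq_add_neg]
    have hp := tendsto_zero_of_completionKernel fibreSeminorm_le_hat (hK x hx) hc hq
    have hfx : Filter.Tendsto (fun n => ‖f n x‖) Filter.atTop (𝓝 ‖toFunctionOnArrows b x‖) := by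
      have := ((continuous_toFunctionOnArrows (x : G)).tendsto b).comp hTb
      refine this.norm.congr fun n => ?_
      rw [Function.comp_apply, ← hfT, toFunctionOnArrows_leftRegular (hbd n)]
    refine hbx (norm_le_zero_iff.1 (le_of_tendsto_of_tendsto' hfx hp fun n => ?_))
    have h1 := norm_coeff_one_le (a n)
    rw [ha] at h1
    exact h1.trans (le_sup_right (a := fibreSeminorm x) (b := groupReducedNorm (Isotropy x)) (a n))

end FibreSeminorm

/-! ### Norm inequalities between unitary representations -/

section Reps

variable {Γ : Type*} [Group Γ]

section General

variable {H K : Type*} [NormedAddCommGroup H] [InnerProductSpace ℂ H] [NormedAddCommGroup K]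
  [InnerProductSpace ℂ K]

theorem repOp_single (π : Γ →* (H ≃ₗᵢ[ℂ] H)) (γ : Γ) (c : ℂ) (ξ : H) :
    repOp π (MonoidAlgebra.single γ c) ξ = c • π γ ξ := by
  rw [repOp_apply, MonoidAlgebra.coeff_single, Finsupp.sum_single_index (by simp)]

theorem inner_repOp (π : Γ →* (H ≃ₗᵢ[ℂ] H)) (a : MonoidAlgebra ℂ Γ) (ξ : H) :
    inner ℂ ξ (repOp π a ξ) = ∑ γ ∈ a.coeff.support, a.coeff γ * inner ℂ ξ (π γ ξ) := by
  rw [repOp_apply, Finsupp.sum, inner_sum]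
  exact Finset.sum_congr rfl fun γ _ => inner_smul_right _ _ _

theorem inner_repOp_single (π : Γ →* (H ≃ₗᵢ[ℂ] H)) (γ : Γ) (c : ℂ) (ξ η : H) :
    inner ℂ ξ (repOp π (MonoidAlgebra.single γ⁻¹ (starRingEnd ℂ c)) η) =
      inner ℂ (repOp π (MonoidAlgebra.single γ c) ξ) η := by
  rw [repOp_single, repOp_single, inner_smul_left, inner_smul_right,
    ← (π γ).inner_map_map ξ (π γ⁻¹ η)]
  have : π γ (π γ⁻¹ η) = η := by
    change (π γ * π γ⁻¹) η = η
    rw [← map_mul, mul_inv_cancel, map_one]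
    rfl
  rw [this]

theorem repOp_smul_one_add (π : Γ →* (H ≃ₗᵢ[ℂ] H)) (s : ℂ) (b : MonoidAlgebra ℂ Γ) (η : H) :
    repOp π (s • 1 + b) η = s • η + repOp π b η := by
  rw [map_add, map_smul, map_one]
  rfl

/-- The adjoint of `π(a)` is `π(a*)`, and `a*` does not depend on the representation. -/
theorem exists_repOp_adjoint (π : Γ →* (H ≃ₗᵢ[ℂ] H)) (ρ : Γ →* (K ≃ₗᵢ[ℂ] K))
    (a : MonoidAlgebra ℂ Γ) : ∃ b : MonoidAlgebra ℂ Γ,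
      (∀ ξ η, inner ℂ ξ (repOp π b η) = inner ℂ (repOp π a ξ) η) ∧
      ∀ ξ η, inner ℂ ξ (repOp ρ b η) = inner ℂ (repOp ρ a ξ) η := by
  induction a using MonoidAlgebra.induction_linear with
  | zero => exact ⟨0, by simp, by simp⟩
  | add a a' h h' =>
    obtain ⟨b, h1, h2⟩ := h
    obtain ⟨b', h1', h2'⟩ := h'
    refine ⟨b + b', fun ξ η => ?_, fun ξ η => ?_⟩
    · rw [map_add, map_add, add_apply, add_apply, inner_add_left, inner_add_right, h1, h1']
    · rw [map_add, map_add, add_apply, add_apply, inner_add_left, inner_add_right, h2, h2']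
  | single γ c =>
    exact ⟨MonoidAlgebra.single γ⁻¹ (starRingEnd ℂ c), inner_repOp_single π γ c,
      inner_repOp_single ρ γ c⟩

/-- If the kernel of `C*_{max(π, ρ)}(Γ) → C*_ρ(Γ)` is zero, then the closure of the pairs
`(π(a), ρ(a))` contains no `(z, 0)` with `z ≠ 0`, so `ρ` dominates `π` by `norm_fst_le_norm_snd`. -/
theorem repSeminorm_le_of_completionKernel [CompleteSpace H] [CompleteSpace K]
    (π : Γ →* (H ≃ₗᵢ[ℂ] H)) (ρ : Γ →* (K ≃ₗᵢ[ℂ] K))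
    (h : completionKernel (repSeminorm π ⊔ repSeminorm ρ) (repSeminorm ρ) = {0})
    (a : MonoidAlgebra ℂ Γ) : repSeminorm π a ≤ repSeminorm ρ a := by
  let R : NonUnitalStarSubalgebra ℂ ((H →L[ℂ] H) × (K →L[ℂ] K)) :=
    { carrier := Set.range fun a => (repOp π a, repOp ρ a)
      add_mem' := by
        rintro _ _ ⟨a, rfl⟩ ⟨b, rfl⟩
        exact ⟨a + b, by simp⟩
      zero_mem' := ⟨0, by simp⟩
      smul_mem' := by
        rintro c _ ⟨a, rfl⟩
        exact ⟨c • a, by simp⟩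
      mul_mem' := by
        rintro _ _ ⟨a, rfl⟩ ⟨b, rfl⟩
        exact ⟨a * b, by simp⟩
      star_mem' := by
        rintro _ ⟨a, rfl⟩
        obtain ⟨b, h1, h2⟩ := exists_repOp_adjoint π ρ a
        refine ⟨b, Prod.ext ?_ ?_⟩
        · refine ContinuousLinearMap.ext fun η => ext_inner_left ℂ fun ξ => ?_
          rw [h1]
          exact (ContinuousLinearMap.adjoint_inner_right _ _ _).symm
        · refine ContinuousLinearMap.ext fun η => ext_inner_left ℂ fun ξ => ?_
          rw [h2]
          exact (ContinuousLinearMap.adjoint_inner_right _ _ _).symm }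
  refine norm_fst_le_norm_snd R (fun z hz => ?_) (p := (repOp π a, repOp ρ a)) ⟨a, rfl⟩
  obtain ⟨T, hT, hTz⟩ := mem_closure_iff_seq_limit.1 hz
  choose u hu using hT
  have h1 : Filter.Tendsto (fun n => repOp π (u n)) Filter.atTop (𝓝 z) :=
    ((continuous_fst.tendsto _).comp hTz).congr fun n => by rw [Function.comp_apply, ← hu]
  have h2 : Filter.Tendsto (fun n => repOp ρ (u n)) Filter.atTop (𝓝 0) :=
    ((continuous_snd.tendsto _).comp hTz).congr fun n => by rw [Function.comp_apply, ← hu]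
  have h3 := tendsto_zero_of_completionKernel le_sup_right h (a := u) (fun ε hε => by
    obtain ⟨N, hN⟩ := Metric.cauchySeq_iff.1 hTz.cauchySeq ε hε
    refine ⟨N, fun m hm n hn => lt_of_le_of_lt ?_ (hN m hm n hn)⟩
    rw [← hu, ← hu, dist_eq_norm, Seminorm.sup_apply, repSeminorm_apply, repSeminorm_apply,
      map_sub, map_sub]
    rfl) (by
    have := h2.norm
    rwa [norm_zero] at this)
  have h4 : Filter.Tendsto (fun n => ‖repOp π (u n)‖) Filter.atTop (𝓝 0) :=
    squeeze_zero (fun n => norm_nonneg _) (fun n => le_sup_left (a := repSeminorm π)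
      (b := repSeminorm ρ) (u n)) h3
  exact tendsto_nhds_unique h1 (tendsto_zero_iff_norm_tendsto_zero.2 h4)

/-- Applied to `⟨ξ, π(a* a) ξ⟩ = ‖π(a) ξ‖²`, weak containment bounds `‖π(a) ξ‖²` by sums
`∑ ‖ρ(a) η_i‖²` with `∑ ‖η_i‖²` close to `‖ξ‖²`. -/
theorem repSeminorm_le_of_weaklyContained (π : Γ →* (H ≃ₗᵢ[ℂ] H)) (ρ : Γ →* (K ≃ₗᵢ[ℂ] K))
    (h : WeaklyContained π ρ) (a : MonoidAlgebra ℂ Γ) : repSeminorm π a ≤ repSeminorm ρ a := by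
  classical
  obtain ⟨b, h1, h2⟩ := exists_repOp_adjoint π ρ a
  set M := ‖repOp ρ a‖
  set s := ∑ γ ∈ (b * a).coeff.support, ‖(b * a).coeff γ‖
  have hs : 0 ≤ s := Finset.sum_nonneg fun _ _ => norm_nonneg _
  rw [repSeminorm_apply, repSeminorm_apply]
  refine ContinuousLinearMap.opNorm_le_bound _ (norm_nonneg _) fun ξ => ?_
  refine (pow_le_pow_iff_left₀ (norm_nonneg _) (by positivity) two_ne_zero).1 ?_
  refine le_of_forall_pos_le_add fun δ hδ => ?_
  set ε := δ / (s + M ^ 2 + 1)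
  have hε : 0 < ε := by positivity
  obtain ⟨n, η, hη⟩ := h ξ (insert 1 (b * a).coeff.support) ε hε
  have e1 : (inner ℂ ξ (repOp π (b * a) ξ) : ℂ) = (‖repOp π a ξ‖ ^ 2 : ℝ) := by
    rw [map_mul, mul_apply_eq_comp, h1, inner_self_eq_norm_sq_to_K]
    norm_cast
  have e2 : ∀ i, (inner ℂ (η i) (repOp ρ (b * a) (η i)) : ℂ) = (‖repOp ρ a (η i)‖ ^ 2 : ℝ) := by
    intro i
    rw [map_mul, mul_apply_eq_comp, h2, inner_self_eq_norm_sq_to_K]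
    norm_cast
  have e3 : ‖(inner ℂ ξ (repOp π (b * a) ξ) : ℂ) - ∑ i, inner ℂ (η i) (repOp ρ (b * a) (η i))‖ ≤
      s * ε := by
    simp_rw [inner_repOp]
    rw [Finset.sum_comm, ← Finset.sum_sub_distrib, Finset.sum_mul]
    refine (norm_sum_le _ _).trans (Finset.sum_le_sum fun γ hγ => ?_)
    rw [← Finset.mul_sum, ← mul_sub, norm_mul]
    gcongr
    exact (hη γ (Finset.mem_insert_of_mem hγ)).le
  have e4 : ∑ i, ‖η i‖ ^ 2 ≤ ‖ξ‖ ^ 2 + ε := by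
    have := hη 1 (Finset.mem_insert_self _ _)
    rw [map_one, map_one] at this
    change ‖inner ℂ ξ ξ - ∑ i, inner ℂ (η i) (η i)‖ < ε at this
    simp_rw [inner_self_eq_norm_sq_to_K] at this
    norm_cast at this
    have := (abs_lt.1 this).1
    linarith
  have e5 : ‖repOp π a ξ‖ ^ 2 - ∑ i, ‖repOp ρ a (η i)‖ ^ 2 ≤ s * ε := by
    rw [e1] at e3
    simp_rw [e2] at e3
    norm_cast at e3
    exact (le_abs_self _).trans e3
  have e6 : ∑ i, ‖repOp ρ a (η i)‖ ^ 2 ≤ M ^ 2 * ∑ i, ‖η i‖ ^ 2 := by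
    rw [Finset.mul_sum]
    refine Finset.sum_le_sum fun i _ => ?_
    rw [← mul_pow]
    gcongr
    exact (repOp ρ a).le_opNorm _
  have e7 : (s + M ^ 2 + 1) * ε = δ := by
    simp only [ε]
    field_simp
  change ‖repOp π a ξ‖ ^ 2 ≤ (M * ‖ξ‖) ^ 2 + δ
  nlinarith [mul_le_mul_of_nonneg_left e4 (sq_nonneg M)]

theorem norm_smul_add_apply_sq (T : H →L[ℂ] H) {s : ℝ} (hs : 0 ≤ s) (η : H) :
    ‖(s : ℂ) • η + T η‖ ^ 2 =
      s ^ 2 * ‖η‖ ^ 2 + 2 * s * (inner ℂ η (T η) : ℂ).re + ‖T η‖ ^ 2 := by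
  rw [@norm_add_sq ℂ, norm_smul, Complex.norm_real, Real.norm_of_nonneg hs, inner_smul_left,
    Complex.conj_ofReal]
  have : RCLike.re ((s : ℂ) * inner ℂ η (T η)) = s * (inner ℂ η (T η) : ℂ).re :=
    Complex.re_ofReal_mul _ _
  rw [this]
  ring

/-- If the norm of `π` is dominated by that of `ρ`, then `π` is weakly contained in `ρ`: a linear
functional separating a function of positive type of `π` from those of `ρ` would be an element of
the group algebra with nonpositive real part in `ρ` but not in `π`. -/
theorem weaklyContained_of_repSeminorm_le (π : Γ →* (H ≃ₗᵢ[ℂ] H)) (ρ : Γ →* (K ≃ₗᵢ[ℂ] K))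
    (h : ∀ a, repSeminorm π a ≤ repSeminorm ρ a) : WeaklyContained π ρ := by
  classical
  intro ξ Q ε hε
  let P : Set (Q → ℂ) := {φ | ∃ (n : ℕ) (η : Fin n → K), ∀ γ, φ γ = ∑ i, inner ℂ (η i) (ρ γ (η i))}
  have hsmul : ∀ φ ∈ P, ∀ t : ℝ, 0 ≤ t → t • φ ∈ P := by
    rintro φ ⟨n, η, hφ⟩ t ht
    refine ⟨n, fun i => (√t : ℂ) • η i, fun γ => ?_⟩
    rw [Pi.smul_apply, hφ, Finset.smul_sum]
    refine Finset.sum_congr rfl fun i _ => ?_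
    rw [map_smul, inner_smul_left, inner_smul_right, Complex.conj_ofReal, ← mul_assoc,
      ← Complex.ofReal_mul, Real.mul_self_sqrt ht]
    rfl
  have hadd : ∀ φ ∈ P, ∀ φ' ∈ P, φ + φ' ∈ P := by
    rintro φ ⟨n, η, hφ⟩ φ' ⟨n', η', hφ'⟩
    refine ⟨n + n', Fin.append η η', fun γ => ?_⟩
    rw [Pi.add_apply, hφ, hφ', Fin.sum_univ_add]
    simp
  have hconv : Convex ℝ P := fun φ hφ φ' hφ' s t hs ht _ =>
    hadd _ (hsmul φ hφ s hs) _ (hsmul φ' hφ' t ht)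
  let φ₀ : Q → ℂ := fun γ => inner ℂ ξ (π γ ξ)
  by_cases hmem : φ₀ ∈ closure P
  · obtain ⟨φ, ⟨n, η, hφ⟩, hd⟩ := Metric.mem_closure_iff.1 hmem ε hε
    refine ⟨n, η, fun γ hγ => ?_⟩
    have := (dist_pi_lt_iff hε).1 hd ⟨γ, hγ⟩
    rwa [dist_eq_norm, hφ] at this
  exfalso
  obtain ⟨F, u, hF, hu⟩ := RCLike.geometric_hahn_banach_closed_point (𝕜 := ℂ) hconv.closure
    isClosed_closure hmem
  have h0 : 0 < u := by
    have := hF 0 (subset_closure ⟨0, Fin.elim0, fun γ => by simp⟩)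
    simpa using this
  have hneg : ∀ φ ∈ P, (F φ).re ≤ 0 := by
    intro φ hφ
    by_contra! hcon
    have h1 := hF _ (subset_closure (hsmul φ hφ (u / (F φ).re) (by positivity)))
    have h2 : F ((u / (F φ).re) • φ) = ((u / (F φ).re : ℝ) : ℂ) * F φ := by
      have : (u / (F φ).re) • φ = ((u / (F φ).re : ℝ) : ℂ) • φ := by
        ext γ
        simp
      rw [this, map_smul, smul_eq_mul]
    rw [h2] at h1
    change (((u / (F φ).re : ℝ) : ℂ) * F φ).re < u at h1
    rw [Complex.re_ofReal_mul, div_mul_cancel₀ _ hcon.ne'] at h1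
    exact lt_irrefl _ h1
  let b : MonoidAlgebra ℂ Γ := ∑ γ : Q, MonoidAlgebra.single (γ : Γ) (F (Pi.single γ 1))
  have hFsum : ∀ φ : Q → ℂ, F φ = ∑ γ, φ γ * F (Pi.single γ 1) := by
    intro φ
    have := LinearMap.pi_apply_eq_sum_univ (F : (Q → ℂ) →ₗ[ℂ] ℂ) φ
    have e : ∀ γ : Q, (fun j => if γ = j then (1 : ℂ) else 0) = Pi.single γ 1 := by
      intro γ
      ext j
      simp [Pi.single_apply, eq_comm]
    simpa [e] using this
  have hρ : ∀ η, (inner ℂ η (repOp ρ b η) : ℂ) = F fun γ => inner ℂ η (ρ γ η) := by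
    intro η
    rw [hFsum, map_sum, sum_apply, inner_sum]
    refine Finset.sum_congr rfl fun γ _ => ?_
    rw [repOp_single, inner_smul_right, mul_comm]
  have hπ : (inner ℂ ξ (repOp π b ξ) : ℂ) = F φ₀ := by
    rw [hFsum, map_sum, sum_apply, inner_sum]
    refine Finset.sum_congr rfl fun γ _ => ?_
    rw [repOp_single, inner_smul_right, mul_comm]
  have hT : ∀ η, (inner ℂ η (repOp ρ b η) : ℂ).re ≤ 0 := by
    intro η
    rw [hρ]
    exact hneg _ ⟨1, fun _ => η, fun γ => by simp⟩
  set t := ‖repOp ρ b‖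
  set v := (inner ℂ ξ (repOp π b ξ) : ℂ).re
  have hv : 0 < v := by
    simp only [v]
    rw [hπ]
    exact h0.trans hu
  have key : ∀ s : ℝ, 0 < s → 2 * s * v ≤ t ^ 2 * ‖ξ‖ ^ 2 := by
    intro s hs
    have h2 : ‖repOp ρ ((s : ℂ) • 1 + b)‖ ≤ √(s ^ 2 + t ^ 2) := by
      refine ContinuousLinearMap.opNorm_le_bound _ (Real.sqrt_nonneg _) fun η => ?_
      refine (pow_le_pow_iff_left₀ (norm_nonneg _) (by positivity) two_ne_zero).1 ?_
      rw [repOp_smul_one_add, norm_smul_add_apply_sq _ hs.le, mul_pow,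
        Real.sq_sqrt (by positivity)]
      have h3 : ‖repOp ρ b η‖ ^ 2 ≤ (t * ‖η‖) ^ 2 := by
        gcongr
        exact (repOp ρ b).le_opNorm η
      nlinarith [mul_nonneg hs.le (neg_nonneg.2 (hT η))]
    have h4 : ‖(s : ℂ) • ξ + repOp π b ξ‖ ≤ √(s ^ 2 + t ^ 2) * ‖ξ‖ := by
      rw [← repOp_smul_one_add]
      refine ((repOp π _).le_opNorm ξ).trans ?_
      gcongr
      exact (h _).trans h2
    have h5 := pow_le_pow_left₀ (norm_nonneg _) h4 2
    rw [norm_smul_add_apply_sq _ hs.le, mul_pow, Real.sq_sqrt (by positivity)] at h5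
    nlinarith [sq_nonneg ‖repOp π b ξ‖]
  have hlim := key ((t ^ 2 * ‖ξ‖ ^ 2 + 1) / v) (by positivity)
  have : 2 * ((t ^ 2 * ‖ξ‖ ^ 2 + 1) / v) * v = 2 * (t ^ 2 * ‖ξ‖ ^ 2 + 1) := by
    field_simp
  have hn : 0 ≤ t ^ 2 * ‖ξ‖ ^ 2 := by positivity
  linarith

end General

end Reps

/-! ### Quasi-regular representations -/

section QuasiRegular

variable {Γ : Type*} [Group Γ]

theorem repSeminorm_le_sum {H : Type*} [NormedAddCommGroup H] [InnerProductSpace ℂ H]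
    (π : Γ →* (H ≃ₗᵢ[ℂ] H)) (a : MonoidAlgebra ℂ Γ) :
    repSeminorm π a ≤ ∑ γ ∈ a.coeff.support, ‖a.coeff γ‖ := by
  rw [repSeminorm_apply]
  refine ContinuousLinearMap.opNorm_le_bound _ (Finset.sum_nonneg fun _ _ => norm_nonneg _)
    fun ξ => ?_
  rw [repOp_apply, Finsupp.sum, Finset.sum_mul]
  refine (norm_sum_le _ _).trans (Finset.sum_le_sum fun γ _ => ?_)
  rw [norm_smul, LinearIsometryEquiv.norm_map]

theorem cosetSeminorm_apply (𝒳 : Set (Subgroup Γ)) (a : MonoidAlgebra ℂ Γ) :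
    cosetSeminorm 𝒳 a = ⨆ X : 𝒳, repSeminorm (quasiRegularRep X.1) a := by
  refine Seminorm.iSup_apply (Seminorm.bddAbove_range_iff.2 fun a =>
    ⟨∑ γ ∈ a.coeff.support, ‖a.coeff γ‖, ?_⟩)
  rintro _ ⟨X, rfl⟩
  exact repSeminorm_le_sum _ a

theorem repSeminorm_le_cosetSeminorm {𝒳 : Set (Subgroup Γ)} {X : Subgroup Γ} (hX : X ∈ 𝒳)
    (a : MonoidAlgebra ℂ Γ) : repSeminorm (quasiRegularRep X) a ≤ cosetSeminorm 𝒳 a := by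
  rw [cosetSeminorm_apply]
  refine le_ciSup (f := fun X : 𝒳 => repSeminorm (quasiRegularRep X.1) a)
    ⟨∑ γ ∈ a.coeff.support, ‖a.coeff γ‖, ?_⟩ ⟨X, hX⟩
  rintro _ ⟨X, rfl⟩
  exact repSeminorm_le_sum _ a

theorem cosetSeminorm_le {𝒳 : Set (Subgroup Γ)} {a : MonoidAlgebra ℂ Γ} {c : ℝ} (hc : 0 ≤ c)
    (h : ∀ X ∈ 𝒳, repSeminorm (quasiRegularRep X) a ≤ c) : cosetSeminorm 𝒳 a ≤ c := by
  rw [cosetSeminorm_apply]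
  exact Real.iSup_le (fun X => h X.1 X.2) hc

theorem repOp_directSumRep {I : Type*} {H : I → Type*} [∀ i, NormedAddCommGroup (H i)]
    [∀ i, InnerProductSpace ℂ (H i)] (ρ : ∀ i, Γ →* (H i ≃ₗᵢ[ℂ] H i)) (a : MonoidAlgebra ℂ Γ)
    (ψ : lp H 2) (i : I) : repOp (directSumRep ρ) a ψ i = repOp (ρ i) a (ψ i) := by
  rw [repOp_apply, repOp_apply, Finsupp.sum, Finsupp.sum, lp.coeFn_sum, Finset.sum_apply]
  rfl

theorem repSeminorm_directSumRep (𝒳 : Set (Subgroup Γ)) (a : MonoidAlgebra ℂ Γ) :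
    repSeminorm (directSumRep fun X : 𝒳 => quasiRegularRep X.1) a = cosetSeminorm 𝒳 a := by
  classical
  refine le_antisymm ?_ (cosetSeminorm_le (apply_nonneg _ _) fun X hX => ?_)
  · rw [repSeminorm_apply]
    refine ContinuousLinearMap.opNorm_le_bound _ (apply_nonneg _ _) fun ψ => ?_
    refine lp.norm_le_of_forall_sum_le (by norm_num) (by positivity) fun F => ?_
    have h1 : ∀ X : 𝒳, ‖repOp (directSumRep fun X : 𝒳 => quasiRegularRep X.1) a ψ X‖ ≤
        cosetSeminorm 𝒳 a * ‖ψ X‖ := by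
      intro X
      rw [repOp_directSumRep]
      refine ((repOp (quasiRegularRep X.1) a).le_opNorm _).trans ?_
      gcongr
      exact repSeminorm_le_cosetSeminorm X.2 a
    have h2 := lp.sum_rpow_le_norm_rpow (p := 2) (by norm_num) ψ F
    simp only [ENNReal.toReal_ofNat, Real.rpow_ofNat] at h2 ⊢
    calc _ ≤ ∑ X ∈ F, (cosetSeminorm 𝒳 a) ^ 2 * ‖ψ X‖ ^ 2 := by
          refine Finset.sum_le_sum fun X _ => ?_
          rw [← mul_pow]
          gcongr
          exact h1 X
      _ ≤ _ := by
          rw [← Finset.mul_sum, mul_pow]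
          gcongr
  · rw [repSeminorm_apply]
    refine ContinuousLinearMap.opNorm_le_bound _ (apply_nonneg _ _) fun ξ => ?_
    have h1 := (repOp (directSumRep fun X : 𝒳 => quasiRegularRep X.1) a).le_opNorm
      (lp.single 2 ⟨X, hX⟩ ξ)
    rw [lp.norm_single (by norm_num)] at h1
    refine le_trans ?_ h1
    have h2 := lp.norm_apply_le_norm (p := 2) (by norm_num)
      (repOp (directSumRep fun X : 𝒳 => quasiRegularRep X.1) a (lp.single 2 ⟨X, hX⟩ ξ)) ⟨X, hX⟩
    rwa [repOp_directSumRep, lp.single_apply_self] at h2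

theorem repSeminorm_permutationRep_le_of_embedding {Ω Ω' : Type*} [MulAction Γ Ω]
    [MulAction Γ Ω'] (σ : Ω → Ω') (hσ : Function.Injective σ)
    (h : ∀ (γ : Γ) q, σ (γ • q) = γ • σ q) (a : MonoidAlgebra ℂ Γ) :
    repSeminorm (permutationRep Γ Ω) a ≤ repSeminorm (permutationRep Γ Ω') a := by
  classical
  refine repSeminorm_permutationRep_le (apply_nonneg _ _) ((kerBound_repSeminorm a).of_embedding σ
    hσ.injOn (Set.mapsTo_univ _ _) fun p _ q _ => ?_)
  unfold actKern
  refine Finsupp.sum_congr fun γ _ => ?_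
  simp_rw [← h, hσ.eq_iff]

theorem repSeminorm_quasiRegularRep_bot (a : MonoidAlgebra ℂ Γ) :
    repSeminorm (quasiRegularRep (⊥ : Subgroup Γ)) a = groupReducedNorm Γ a := by
  have hinj : Function.Injective (fun g : Γ => (g : Γ ⧸ (⊥ : Subgroup Γ))) := by
    intro g h e
    rw [QuotientGroup.eq, Subgroup.mem_bot, inv_mul_eq_one] at e
    exact e
  let e := Equiv.ofBijective _ ⟨hinj, QuotientGroup.mk_surjective⟩
  refine le_antisymm (repSeminorm_permutationRep_le_of_embedding e.symm e.symm.injective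
    (fun γ q => ?_) a) (repSeminorm_permutationRep_le_of_embedding _ hinj (fun γ q => rfl) a)
  obtain ⟨g, rfl⟩ := QuotientGroup.mk_surjective q
  rw [Equiv.symm_apply_eq]
  have : e.symm (g : Γ ⧸ (⊥ : Subgroup Γ)) = g := e.symm_apply_apply g
  rw [this]
  rfl

theorem cosetSeminorm_insert_bot (𝒳 : Set (Subgroup Γ)) :
    cosetSeminorm (insert ⊥ 𝒳) = groupReducedNorm Γ ⊔ cosetSeminorm 𝒳 := by
  refine Seminorm.ext fun a => le_antisymm (cosetSeminorm_le (apply_nonneg _ _) ?_)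
    (sup_le ?_ (cosetSeminorm_le (apply_nonneg _ _) fun X hX =>
      repSeminorm_le_cosetSeminorm (Set.mem_insert_of_mem _ hX) a))
  · rintro X (rfl | hX)
    · rw [repSeminorm_quasiRegularRep_bot]
      exact le_sup_left (a := groupReducedNorm Γ) (b := cosetSeminorm 𝒳) a
    · exact (repSeminorm_le_cosetSeminorm hX a).trans
        (le_sup_right (a := groupReducedNorm Γ) (b := cosetSeminorm 𝒳) a)
  · rw [← repSeminorm_quasiRegularRep_bot]
    exact repSeminorm_le_cosetSeminorm (Set.mem_insert _ _) a

/-- The ideal `J_{Γ,𝒳}` vanishes if and only if the regular representation is weakly contained in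
the direct sum of the quasi-regular representations: both conditions mean that the reduced norm is
dominated by the seminorm of `𝒳`. -/
theorem groupIdeal_eq_iff_weaklyContained (𝒳 : Set (Subgroup Γ)) :
    groupIdeal 𝒳 = {0} ↔
      WeaklyContained (regularRep Γ) (directSumRep fun X : 𝒳 => quasiRegularRep X.1) := by
  have hds : repSeminorm (directSumRep fun X : 𝒳 => quasiRegularRep X.1) = cosetSeminorm 𝒳 :=
    Seminorm.ext fun a => repSeminorm_directSumRep 𝒳 a
  constructor
  · intro h
    refine weaklyContained_of_repSeminorm_le _ _ fun a => ?_
    refine repSeminorm_le_of_completionKernel _ _ ?_ a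
    unfold groupIdeal at h
    rw [cosetSeminorm_insert_bot, ← hds] at h
    exact h
  · intro h
    have h1 : cosetSeminorm (insert ⊥ 𝒳) = cosetSeminorm 𝒳 := by
      rw [cosetSeminorm_insert_bot, sup_eq_right, ← hds]
      exact fun a => repSeminorm_le_of_weaklyContained _ _ h a
    unfold groupIdeal
    rw [h1]
    exact completionKernel_self _

end QuasiRegular

/-! ### The coset groupoid and the quasi-regular representations -/

section IsoCoset

open Coset

variable {G : Type*} [GroupoidArrows G] {x : units G}

/-- A coset of a subgroup of the isotropy group at `x`, as a set of arrows. -/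
def isoCoset (X : Subgroup (Isotropy x)) (q : Isotropy x ⧸ X) : Coset G where
  carrier := {k | ∃ g : Isotropy x, (g : Isotropy x ⧸ X) = q ∧ k = g.1}
  nonempty := let ⟨g, hg⟩ := QuotientGroup.mk_surjective q; ⟨g.1, g, hg, rfl⟩
  src_eq := by
    rintro _ ⟨g, -, rfl⟩ _ ⟨h, -, rfl⟩
    rw [g.2.1, h.2.1]
  rng_eq := by
    rintro _ ⟨g, -, rfl⟩ _ ⟨h, -, rfl⟩
    rw [g.2.2, h.2.2]
  closed := by
    rintro _ ⟨g, rfl, rfl⟩ _ ⟨h, e, rfl⟩ _ ⟨k, e', rfl⟩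
    refine ⟨g * h⁻¹ * k, ?_, rfl⟩
    rw [eq_comm, mul_assoc, QuotientGroup.eq, inv_mul_cancel_left, ← QuotientGroup.eq, e, e']

theorem mem_isoCoset {X : Subgroup (Isotropy x)} {q : Isotropy x ⧸ X} {g : Isotropy x} :
    g.1 ∈ (isoCoset X q).carrier ↔ (g : Isotropy x ⧸ X) = q := by
  constructor
  · rintro ⟨h, hq, e⟩
    rwa [Subtype.ext e]
  · intro h
    exact ⟨g, h, rfl⟩

theorem isoCoset_injective (X : Subgroup (Isotropy x)) :
    Function.Injective (isoCoset X) := by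
  intro p q e
  obtain ⟨g, rfl⟩ := QuotientGroup.mk_surjective p
  exact mem_isoCoset.1 (e ▸ mem_isoCoset.2 rfl)

theorem carrier_csrc_isoCoset (X : Subgroup (Isotropy x)) (q : Isotropy x ⧸ X) :
    (isoCoset X q).csrc.carrier = Subtype.val '' (X : Set (Isotropy x)) := by
  ext k
  constructor
  · rintro ⟨_, ⟨g, hg, rfl⟩, _, ⟨h, hh, rfl⟩, rfl⟩
    have h1 : g⁻¹ * h ∈ X := QuotientGroup.eq.1 (hg.trans hh.symm)
    exact ⟨_, h1, rfl⟩
  · rintro ⟨k : Isotropy x, hk, rfl⟩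
    obtain ⟨g, rfl⟩ := QuotientGroup.mk_surjective q
    refine ⟨g.1, ⟨g, rfl, rfl⟩, (g * k).1, ⟨g * k, ?_, rfl⟩, ?_⟩
    · rw [QuotientGroup.eq, mul_inv_rev, inv_mul_cancel_right]
      exact X.inv_mem hk
    · exact (congrArg (fun γ : Isotropy x => γ.1) (inv_mul_cancel_left g k)).symm

theorem src_of_mem_isoCoset {X : Subgroup (Isotropy x)} {q : Isotropy x ⧸ X} {k : G}
    (hk : k ∈ (isoCoset X q).carrier) : src k = x := by
  obtain ⟨g, -, rfl⟩ := hk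
  exact g.2.1

theorem rng_of_mem_isoCoset {X : Subgroup (Isotropy x)} {q : Isotropy x ⧸ X} {k : G}
    (hk : k ∈ (isoCoset X q).carrier) : rng k = x := by
  obtain ⟨g, -, rfl⟩ := hk
  exact g.2.2

theorem cosetSum_isoCoset_div (a : MonoidAlgebra ℂ (Isotropy x)) (X : Subgroup (Isotropy x))
    (p q : Isotropy x ⧸ X) (e : (isoCoset X p).csrc = (isoCoset X q).csrc) :
    cosetSum a (gmul (isoCoset X p) (ginv (isoCoset X q))) = actKern a p q := by
  classical
  unfold cosetSum actKern
  refine Finsupp.sum_congr fun γ _ => ?_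
  obtain ⟨g, rfl⟩ := QuotientGroup.mk_surjective q
  have : γ.1 ∈ (gmul (isoCoset X p) (ginv (isoCoset X (g : Isotropy x ⧸ X)))).carrier ↔
      γ • (g : Isotropy x ⧸ X) = p := by
    rw [mem_div_iff e (mem_isoCoset.2 rfl)]
    refine (and_iff_right (γ.2.1.trans g.2.2.symm)).trans ?_
    exact mem_isoCoset (g := γ * g)
  by_cases h : γ • (g : Isotropy x ⧸ X) = p
  · rw [if_pos (this.2 h), if_pos h]
  · rw [if_neg fun h' => h (this.1 h'), if_neg h]

theorem exists_eq_isoCoset {A : Coset G} (hs : ∀ g ∈ A.carrier, src g = x)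
    (hr : ∀ g ∈ A.carrier, rng g = x) :
    ∃ (X : Subgroup (Isotropy x)) (q : Isotropy x ⧸ X), A = isoCoset X q := by
  have hγ : ∀ g ∈ A.carrier, ∃ γ : Isotropy x, γ.1 = g := fun g hg => ⟨⟨g, hs g hg, hr g hg⟩, rfl⟩
  obtain ⟨_, hg₀⟩ := A.nonempty
  obtain ⟨γ₀, rfl⟩ := hγ _ hg₀
  let X : Subgroup (Isotropy x) :=
    { carrier := {k | (γ₀ * k).1 ∈ A.carrier}
      one_mem' := by
        rw [Set.mem_ofPred_eq, mul_one]
        exact hg₀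
      mul_mem' := by
        intro k l hk hl
        have h : (γ₀ * k * γ₀⁻¹ * (γ₀ * l)).1 ∈ A.carrier := A.closed _ hk _ hg₀ _ hl
        rwa [show γ₀ * k * γ₀⁻¹ * (γ₀ * l) = γ₀ * (k * l) by group] at h
      inv_mem' := by
        intro k hk
        have h : (γ₀ * (γ₀ * k)⁻¹ * γ₀).1 ∈ A.carrier := A.closed _ hg₀ _ hk _ hg₀
        rwa [show γ₀ * (γ₀ * k)⁻¹ * γ₀ = γ₀ * k⁻¹ by group] at h }
  have hX : ∀ g : Isotropy x, (g : Isotropy x ⧸ X) = γ₀ ↔ g.1 ∈ A.carrier := by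
    intro g
    rw [eq_comm, QuotientGroup.eq]
    change (γ₀ * (γ₀⁻¹ * g)).1 ∈ A.carrier ↔ _
    rw [mul_inv_cancel_left]
  refine ⟨X, (γ₀ : Isotropy x ⧸ X), Coset.ext (Set.ext fun k => ⟨fun hk => ?_, ?_⟩)⟩
  · obtain ⟨g, rfl⟩ := hγ k hk
    exact ⟨g, (hX g).2 hk, rfl⟩
  · rintro ⟨g, hg, rfl⟩
    exact (hX g).1 hg

end IsoCoset

section FibreReduced

open Coset

variable {G : Type*} [TopologicalSpace G] [GroupoidArrows G]

theorem mem_essSubgroups_iff {x : units G} {X : Subgroup (Isotropy x)} (q : Isotropy x ⧸ X) :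
    X ∈ essSubgroups x ↔ (isoCoset X q).csrc ∈ essFibre x := by
  constructor
  · rintro ⟨A, hA, e⟩
    have : (isoCoset X q).csrc = A := Coset.ext ((carrier_csrc_isoCoset X q).trans e.symm)
    rwa [this]
  · intro h
    exact ⟨_, h, carrier_csrc_isoCoset X q⟩

variable [IsEtaleGroupoid G] {x : units G}

theorem isoCoset_mem_cosetGroupoid {X : Subgroup (Isotropy x)} (hX : X ∈ essSubgroups x)
    (q : Isotropy x ⧸ X) : isoCoset X q ∈ cosetGroupoid x := by
  have h := mem_essFibre_iff.1 ((mem_essSubgroups_iff q).1 hX)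
  obtain ⟨g, hg⟩ := (isoCoset X q).nonempty
  refine mem_cosetGroupoid_iff.2 ⟨mem_essCover_of_csrc h.1, ?_, ?_⟩
  · rw [← srcUnit_of_mem hg]
    exact Subtype.ext (src_of_mem_isoCoset hg)
  · rw [← rngUnit_of_mem hg]
    exact Subtype.ext (rng_of_mem_isoCoset hg)

theorem exists_isoCoset_of_mem {A : Coset G} (hA : A ∈ cosetGroupoid x) :
    ∃ X ∈ essSubgroups x, ∃ q : Isotropy x ⧸ X, A = isoCoset X q := by
  obtain ⟨h1, h2, h3⟩ := mem_cosetGroupoid_iff.1 hA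
  obtain ⟨X, q, rfl⟩ := exists_eq_isoCoset (x := x) (A := A)
    (fun g hg => by rw [src_of_mem hg, h2]) (fun g hg => by rw [rng_of_mem hg, h3])
  exact ⟨X, (mem_essSubgroups_iff q).2 (mem_essFibre_iff.2
    ⟨mem_essCover_iff.1 h1, by rw [srcPt_csrc, h2]⟩), q, rfl⟩

/-- The reduced norm of the coset groupoid is the supremum of the norms in the quasi-regular
representations. -/
theorem reducedNorm_cosetGroupoid {b : Coset G → ℂ} (hb : b ∈ convolutionAlgebra (cosetGroupoid x))
    {a : MonoidAlgebra ℂ (Isotropy x)} (hba : Set.EqOn b (cosetSum a) (cosetGroupoid x)) :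
    reducedNorm (cosetGroupoid x) b = cosetSeminorm (essSubgroups x) a := by
  have hbd := bisectionBounded_of_mem hb
  have hk : ∀ (X : Subgroup (Isotropy x)), X ∈ essSubgroups x → ∀ p q : Isotropy x ⧸ X,
      kern b (isoCoset X p) (isoCoset X q) = actKern a p q := by
    intro X hX p q
    have e : (isoCoset X p).csrc = (isoCoset X q).csrc :=
      Coset.ext ((carrier_csrc_isoCoset X p).trans (carrier_csrc_isoCoset X q).symm)
    rw [kern_of_eq _ e.symm, hba (div_mem_cosetGroupoid (isoCoset_mem_cosetGroupoid hX p)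
      (isoCoset_mem_cosetGroupoid hX q) e), cosetSum_isoCoset_div a X p q e]
  refine le_antisymm (reducedNorm_le hbd (apply_nonneg _ _) ?_)
    (cosetSeminorm_le (reducedNorm_nonneg _ _) fun X hX => ?_)
  · refine KerBound.of_fibres csrc (fun A _ B _ hne => kern_of_ne b fun e => hne e.symm)
      (apply_nonneg _ _) fun t => ?_
    rcases Set.eq_empty_or_nonempty {A ∈ cosetGroupoid x | A.csrc = t} with h0 | ⟨A₀, hA₀, hA₀t⟩
    · rw [h0]
      intro F hF u v
      have : F = ∅ := by simpa using hF
      simp [this]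
    · obtain ⟨X, hX, q₀, rfl⟩ := exists_isoCoset_of_mem hA₀
      have hq : ∀ A ∈ {A ∈ cosetGroupoid x | A.csrc = t}, ∃ q : Isotropy x ⧸ X,
          A = isoCoset X q := by
        rintro A ⟨hA, hAt⟩
        obtain ⟨Y, -, q, rfl⟩ := exists_isoCoset_of_mem hA
        have e := (carrier_csrc_isoCoset Y q).symm.trans
          ((congrArg Coset.carrier (hAt.trans hA₀t.symm)).trans (carrier_csrc_isoCoset X q₀))
        have : Y = X := SetLike.coe_injective (Set.image_injective.2 Subtype.val_injective e)
        subst this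
        exact ⟨q, rfl⟩
      have : Nonempty (Isotropy x ⧸ X) := ⟨q₀⟩
      choose! σ hσ using hq
      refine ((kerBound_repSeminorm (Ω := Isotropy x ⧸ X) a).mono_const
        (repSeminorm_le_cosetSeminorm hX a)).of_embedding σ (fun A hA B hB e => ?_)
        (Set.mapsTo_univ _ _) fun A hA B hB => ?_
      · rw [hσ A hA, hσ B hB, e]
      · rw [← hk X hX, ← hσ A hA, ← hσ B hB]
  · refine repSeminorm_permutationRep_le (reducedNorm_nonneg _ _)
      ((kerBound_reducedNorm hbd (cosetGroupoid x)).of_embedding (isoCoset X)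
        (isoCoset_injective X).injOn (fun q _ => isoCoset_mem_cosetGroupoid hX q)
        fun p _ q _ => (hk X hX p q).symm)

theorem fibreSeminorm_eq_cosetSeminorm (h : FibreNormIsReduced x) :
    fibreSeminorm x = cosetSeminorm (essSubgroups x) := by
  refine Seminorm.ext fun a => ?_
  obtain ⟨F, hF, e⟩ := exists_extension a
  have hS : cosetGroupoid x ⊆ essCover G := fun A hA => hA.1
  have hb := indicator_mem_convolutionAlgebra isClosed_cosetGroupoid hS hF
  have hba : Set.EqOn ((cosetGroupoid x).indicator F) (cosetSum a) (cosetGroupoid x) :=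
    fun A hA => (Set.indicator_of_mem hA F).trans (e hA)
  rw [← reducedNorm_cosetGroupoid hb hba, ← h _ hb, fibreSeminorm_apply]
  unfold restrictedNorm
  congr 1
  ext t
  refine exists_congr fun f => and_congr_right fun _ => and_congr_left fun _ =>
    ⟨fun h A hA => (h hA).trans (hba hA).symm, fun h A hA => (h hA).trans (hba hA)⟩

theorem fibreKernel_eq_iff_groupIdeal (h : FibreNormIsReduced x) :
    fibreKernel x = {0} ↔ groupIdeal (essSubgroups x) = {0} := by
  have h1 := fibreSeminorm_eq_cosetSeminorm h
  have h2 : fibreSeminormHat x = cosetSeminorm (insert ⊥ (essSubgroups x)) := by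
    rw [cosetSeminorm_insert_bot, fibreSeminormHat, h1, sup_comm]
  unfold fibreKernel groupIdeal
  rw [h1, h2]

end FibreReduced

/-! ### Amenable isotropy: extension from the fibre and bounds for finite blocks -/

section Extension

open Coset

variable {G : Type*} [TopologicalSpace G] [GroupoidArrows G] [IsEtaleGroupoid G] {x : units G}

/-- Functions in `𝒞_c` of a closed set of cosets extend to larger closed sets. -/
theorem exists_extension_of_isClosed {S T : Set (Coset G)} (hT : IsClosed T) (hS : IsClosed S)
    {b : Coset G → ℂ} (hb : b ∈ convolutionAlgebra T) :
    ∃ f ∈ convolutionAlgebra S, Set.EqOn f b (T ∩ S) := by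
  obtain ⟨hc, K, hKT, hK, h0⟩ := mem_convolutionAlgebra_iff.1 hb
  obtain ⟨L, hL, hKL⟩ := exists_compact_superset hK
  have : CompactSpace L := isCompact_iff_compactSpace.1 hL
  obtain ⟨g, hg⟩ := ContinuousMap.exists_restrict_eq (Y := ℂ)
    (s := (Subtype.val ⁻¹' T : Set L)) (hT.preimage continuous_subtype_val)
    ⟨fun A => b A.1, hc.comp_continuous (continuous_subtype_val.comp continuous_subtype_val)
      fun A => A.2⟩
  obtain ⟨χ, h1, h2, hχ, -⟩ := exists_continuous_one_zero_of_isCompact hK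
    (isOpen_interior (s := L)).isClosed_compl (Set.disjoint_left.2 fun A hA h => h (hKL hA))
  classical
  let f : Coset G → ℂ := fun A => if h : A ∈ L then χ A * g ⟨A, h⟩ else 0
  have hsupp : ∀ A ∉ interior L, f A = 0 := by
    intro A hA
    simp only [f]
    split_ifs
    · rw [h2 hA]
      simp
    · rfl
  have hf : f ∈ convolutionAlgebra (Set.univ : Set (Coset G)) := by
    refine mem_convolutionAlgebra_iff.2 ⟨?_, L, Set.subset_univ _, hL, fun A hA =>
      hsupp A fun h => hA (interior_subset h)⟩
    rw [continuousOn_univ, continuous_iff_continuousAt]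
    intro A
    by_cases hA : A ∈ interior L
    · have hfL : ContinuousOn f L := by
        rw [continuousOn_iff_continuous_domRestrict]
        have e : L.domRestrict f = fun A => (χ A.1 : ℂ) * g A := by
          ext A
          exact dif_pos A.2
        rw [e]
        exact (Complex.continuous_ofReal.comp (χ.continuous.comp continuous_subtype_val)).mul
          g.continuous
      exact hfL.continuousAt (mem_interior_iff_mem_nhds.1 hA)
    · rw [ContinuousAt, hsupp A hA]
      refine squeeze_zero_norm (a := fun B => ‖χ B‖ * ‖g‖) (fun B => ?_) ?_
      · simp only [f]
        split_ifs
        · rw [norm_mul, Complex.norm_real]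
          gcongr
          exact g.norm_coe_le_norm _
        · rw [norm_zero]
          positivity
      · have := (χ.continuous.tendsto A).norm.mul_const ‖g‖
        rwa [h2 hA, Pi.zero_apply, norm_zero, zero_mul] at this
  refine ⟨S.indicator f, indicator_mem_convolutionAlgebra hS (Set.subset_univ _) hf,
    fun A hA => ?_⟩
  rw [Set.indicator_of_mem hA.2]
  by_cases hAL : A ∈ L
  · have e : g ⟨A, hAL⟩ = b A := congrArg (fun u => u ⟨⟨A, hAL⟩, hA.1⟩) hg
    simp only [f]
    rw [dif_pos hAL, e]
    by_cases hAK : A ∈ K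
    · rw [h1 hAK]
      simp
    · rw [h0 A hAK, mul_zero]
  · rw [hsupp A fun h => hAL (interior_subset h), h0 A fun h => hAL (interior_subset (hKL h))]

theorem reducedNorm_cosetGroupoid_le_of_eqOn {b F : Coset G → ℂ}
    (hb : b ∈ convolutionAlgebra (cosetGroupoid x)) (hF : F ∈ convolutionAlgebra (essCover G))
    (h : Set.EqOn F b (cosetGroupoid x)) :
    reducedNorm (cosetGroupoid x) b ≤ reducedNorm (essCover G) F := by
  refine reducedNorm_le (bisectionBounded_of_mem hb) (reducedNorm_nonneg _ _)
    (((kerBound_reducedNorm (bisectionBounded_of_mem hF) (essCover G)).mono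
      fun A hA => hA.1).congr fun A hA B hB => ?_)
  by_cases e : B.csrc = A.csrc
  · rw [kern_of_eq _ e, kern_of_eq _ e, h (div_mem_cosetGroupoid hA hB e.symm)]
  · rw [kern_of_ne _ e, kern_of_ne _ e]

/-- Cosets `γ X` for `X` in the fibre over `x`. -/
theorem exists_mem_cosetGroupoid {X : Coset G} (hX : X ∈ essFibre x) (γ : Isotropy x) :
    ∃ A ∈ cosetGroupoid x, A.csrc = X ∧ γ.1 ∈ A.carrier := by
  have hX' := mem_essFibre_iff.1 hX
  have e := csrc_of_mem_essUnits hX'.1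
  have hXC : X ∈ cosetGroupoid x := mem_cosetGroupoid_iff.2
    ⟨mem_essCover_iff.2 (by rw [e]; exact hX'.1), hX'.2, by
      rw [← srcPt_crng, ← e, crng_csrc, e, hX'.2]⟩
  obtain ⟨Y, hY, q, rfl⟩ := exists_isoCoset_of_mem hXC
  refine ⟨isoCoset Y γ, isoCoset_mem_cosetGroupoid hY γ, ?_, mem_isoCoset.2 rfl⟩
  rw [← e]
  exact Coset.ext ((carrier_csrc_isoCoset Y _).trans (carrier_csrc_isoCoset Y q).symm)

/-- Near `x`, the block of the matrix of `f` on finitely many bisections through isotropy arrows at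
`x` is almost a block of the matrix of the restriction of `f` to the coset groupoid. Along an
ultrafilter of Hausdorff units tending to `x`, the units converge in the Fell topology to a
subgroup `X` and the arrows in these bisections converge to cosets of `X`. -/
theorem eventually_kerBound_block {f b : Coset G → ℂ} (hf : f ∈ convolutionAlgebra (essCover G))
    (hb : b ∈ convolutionAlgebra (cosetGroupoid x)) (hfb : Set.EqOn f b (cosetGroupoid x))
    (F : Finset (Isotropy x)) {U : Isotropy x → Set G}
    (hU : ∀ t, IsOpen (U t) ∧ t.1 ∈ U t ∧ Set.InjOn src (U t)) {ε : ℝ} (hε : 0 < ε) :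
    ∀ᶠ z : units G in 𝓝 x, (z : G) ∈ hausdorffUnits G →
      KerBound (kern fun k => f (sing k)) {a | src a = z ∧ ∃ t ∈ F, a ∈ U t}
        (reducedNorm (cosetGroupoid x) b + ε) := by
  classical
  by_contra hcon
  have hbad : ∃ᶠ z : units G in 𝓝 x, (z : G) ∈ hausdorffUnits G ∧
      ¬ KerBound (kern fun k => f (sing k)) {a | src a = z ∧ ∃ t ∈ F, a ∈ U t}
        (reducedNorm (cosetGroupoid x) b + ε) :=
    (Filter.not_eventually.1 hcon).mono fun z hz => by
      push Not at hz
      exact hz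
  obtain ⟨l, hl⟩ := @Ultrafilter.exists_le _ _ (Filter.frequently_iff_neBot.1 hbad)
  have hlx : Filter.Tendsto (fun z : units G => z) l (𝓝 x) := hl.trans inf_le_left
  have hlbad : ∀ᶠ z : units G in l, (z : G) ∈ hausdorffUnits G ∧
      ¬ KerBound (kern fun k => f (sing k)) {a | src a = z ∧ ∃ t ∈ F, a ∈ U t}
        (reducedNorm (cosetGroupoid x) b + ε) :=
    Filter.le_principal_iff.1 (hl.trans inf_le_right)
  have hlC : ∀ᶠ z : units G in l, (z : G) ∈ hausdorffUnits G := hlbad.mono fun z hz => hz.1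
  -- the units converge to a point `X` of the fibre over `x`
  have hlx' : Filter.Tendsto (fun z : units G => (z : G)) l (𝓝 (x : G)) :=
    (continuous_subtype_val.tendsto x).comp hlx
  obtain ⟨K₀, hK₀, -, hK₀c⟩ := Coset.exists_compact_nhds (x : G) Filter.univ_mem
  obtain ⟨X, -, hX⟩ := (isCompact_meets hK₀c).ultrafilter_le_nhds
    (l.map fun z : units G => sing (z : G)) (Filter.le_principal_iff.2
      (Filter.mem_map.2 (Filter.mem_of_superset (hlx' hK₀) fun z hz => ⟨(z : G), rfl, hz⟩)))
  have hz : Filter.Tendsto (fun z : units G => sing (z : G)) l (𝓝 X) := hX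
  have hu : ∀ᶠ z : units G in l, (z : G) ∈ units G := Filter.Eventually.of_forall fun z => z.2
  have hXu : X ∈ essUnits G := isClosed_essUnits.mem_of_tendsto hz
    (hlC.mono fun z hz => sing_mem_essUnits hz)
  have hXx : X ∈ essFibre x := mem_essFibre_iff.2 ⟨hXu, tendsto_nhds_unique
    ((continuous_srcPt.tendsto X).comp hz) (hlx.congr fun z => by
      rw [Function.comp_apply, srcPt_sing, srcUnit_coe])⟩
  choose A hAC hAX hAt using exists_mem_cosetGroupoid hXx
  have hsec : ∀ t : Isotropy x, ∃ p : units G → G, Filter.Tendsto p l (𝓝 t.1) ∧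
      ∀ᶠ z in l, src (p z) = z := fun t =>
    exists_section_of_tendsto_sing hz hu (hAX t ▸ src_mem_csrc (hAt t))
  choose p hp hpz using hsec
  have hpA : ∀ t, Filter.Tendsto (fun z => sing (p t z)) l (𝓝 (A t)) := fun t =>
    tendsto_sing_of_section (hAX t) (hAt t) hz hu (hp t) (hpz t)
  obtain ⟨η, hη, hηε⟩ : ∃ η : ℝ, 0 < η ∧ (F.card + 1) * η = ε :=
    ⟨ε / (F.card + 1), by positivity, by field_simp⟩
  have ev1 : ∀ᶠ z in l, ∀ t ∈ F, src (p t z) = z ∧ p t z ∈ U t :=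
    (Filter.eventually_all_finset F).2 fun t _ =>
      (hpz t).and (hp t ((hU t).1.mem_nhds (hU t).2.1))
  have ev2 : ∀ᶠ z in l, ∀ t ∈ F, ∀ s ∈ F, A t = A s → p t z = p s z := by
    refine (Filter.eventually_all_finset F).2 fun t _ =>
      (Filter.eventually_all_finset F).2 fun s _ => ?_
    by_cases hts : A t = A s
    swap
    · exact Filter.Eventually.of_forall fun z h => absurd h hts
    -- the arrows `p t z` also converge to `s`, hence lie in the bisection `U s`
    obtain ⟨ψ, h1, h2⟩ := isLimPt_of_mem (hpA t) (hts ▸ hAt s)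
    filter_upwards [h1 ((hU s).1.mem_nhds (hU s).2.1), h2, hp s ((hU s).1.mem_nhds (hU s).2.1),
      hpz t, hpz s] with z h3 h4 h5 h6 h7 _
    have h8 : ψ z = p t z := h4
    rw [Set.mem_preimage, h8] at h3
    exact (hU s).2.2 h3 h5 (h6.trans h7.symm)
  have ev3 : ∀ᶠ z in l, ∀ t ∈ F, ∀ s ∈ F,
      ‖f (sing (gmul (p t z) (ginv (p s z)))) - f (gmul (A t) (ginv (A s)))‖ ≤ η := by
    refine (Filter.eventually_all_finset F).2 fun t _ =>
      (Filter.eventually_all_finset F).2 fun s _ => ?_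
    have t1 := tendsto_sing_div (hAX t) (hAX s) (hAt t) (hAt s) hz (hp t) (hp s) (hpz t) (hpz s)
    have hmem : gmul (A t) (ginv (A s)) ∈ essCover G :=
      div_mem_essCover (hAC s).1 ((hAX t).trans (hAX s).symm)
    have t2 := (((mem_convolutionAlgebra_iff.1 hf).1 _ hmem).tendsto.comp
      (tendsto_nhdsWithin_iff.2 ⟨t1, ?_⟩))
    · filter_upwards [Metric.tendsto_nhds.1 t2 η hη] with z hz
      rw [← dist_eq_norm]
      exact hz.le
    · filter_upwards [hpz t, hpz s, hlC] with z h1 h2 h3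
      refine sing_mem_essCover ?_
      rw [src_div (by rw [h1, h2])]
      exact rng_mem_hausdorffUnits (by rwa [h2])
  obtain ⟨z, ⟨-, hzbad⟩, h1, h2, h3⟩ := (hlbad.and (ev1.and (ev2.and ev3))).exists
  refine hzbad fun F' hF' u v => ?_
  have hF'p : ∀ a ∈ F', ∃ t ∈ F, a = p t z := by
    intro a ha
    obtain ⟨hs, t, ht, hat⟩ := hF' ha
    exact ⟨t, ht, (hU t).2.2 hat (h1 t ht).2 (hs.trans (h1 t ht).1.symm)⟩
  choose! t ht hat using hF'p
  have hcard : F'.card ≤ F.card := Finset.card_le_card_of_injOn t ht fun a ha c hc e => by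
    rw [hat a ha, hat c hc, e]
  have key := (kerBound_reducedNorm (bisectionBounded_of_mem hb) (cosetGroupoid x)).block_le
    (k := kern fun k => f (sing k)) (F := F') (η := η) (fun a => A (t a)) (fun a ha c hc e => by
      rw [hat a ha, hat c hc]
      exact h2 _ (ht a ha) _ (ht c hc) e) (fun a _ => hAC _) (fun a ha c hc => by
      rw [kern_of_eq _ ((hF' hc).1.trans (hF' ha).1.symm),
        kern_of_eq b (show (A (t c)).csrc = (A (t a)).csrc by rw [hAX, hAX]),
        ← hfb (div_mem_cosetGroupoid (hAC _) (hAC _) ((hAX _).trans (hAX _).symm))]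
      have := h3 _ (ht a ha) _ (ht c hc)
      rwa [← hat a ha, ← hat c hc] at this) u v
  refine key.trans ?_
  gcongr
  calc (F'.card : ℝ) * η ≤ (F.card + 1) * η := by
        gcongr
        have : (F'.card : ℝ) ≤ F.card := by exact_mod_cast hcard
        linarith
    _ = ε := hηε

end Extension

/-! ### Følner weights -/

theorem KerBound.of_support {ι : Type*} {k : ι → ι → ℂ} {S : Set ι} {c : ℝ} (hc : 0 ≤ c)
    (p : ι → Prop) (hk : ∀ i ∈ S, ∀ j ∈ S, k i j ≠ 0 → p i ∧ p j)
    (h : KerBound k {i ∈ S | p i} c) : KerBound k S c := by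
  refine KerBound.of_fibres p (fun i hi j hj hne => ?_) hc fun t => ?_
  · by_contra hcon
    have := hk i hi j hj hcon
    exact hne (propext ⟨fun _ => this.2, fun _ => this.1⟩)
  · by_cases ht : t
    · exact h.mono fun i hi => ⟨hi.1, hi.2 ▸ ht⟩
    · refine (KerBound.zero hc).congr fun i hi j hj => ?_
      by_contra hcon
      exact ht (hi.2 ▸ (hk i hi.1 j hj.1 hcon).1)

section Weights

variable {T κ : Type*}

open Classical in
/-- The square root of the image on `κ` of the uniform probability measure on the finite set `F`:
a unit vector of `ℓ²(κ)`. -/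
def weight (F : Finset T) (β : T → κ) (p : κ) : ℝ := √((F.filter (β · = p)).card / F.card)

open Classical in
/-- The inner product of two of the unit vectors `weight F β`. -/
def overlap (F : Finset T) (β β' : T → κ) : ℝ :=
  ∑ p ∈ F.image β, weight F β p * weight F β' p

variable {F : Finset T} {β β' : T → κ}

theorem weight_ne_zero {p : κ} (h : weight F β p ≠ 0) : ∃ t ∈ F, β t = p := by
  classical
  by_contra! hcon
  refine h ?_
  rw [weight, Finset.filter_false_of_mem hcon]
  simp

theorem weight_sq (p : κ) [DecidableEq κ] :
    weight F β p ^ 2 = (F.filter (β · = p)).card / F.card := by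
  rw [weight, Real.sq_sqrt (by positivity)]
  congr!

theorem sum_weight_sq (hF : F.Nonempty) {P : Finset κ} (hP : ∀ t ∈ F, β t ∈ P) :
    ∑ p ∈ P, weight F β p ^ 2 = 1 := by
  classical
  have hn : (F.card : ℝ) ≠ 0 := by exact_mod_cast hF.card_pos.ne'
  simp_rw [weight_sq]
  rw [← Finset.sum_div, div_eq_one_iff_eq hn, ← Nat.cast_sum,
    ← Finset.card_eq_sum_card_fiberwise hP]

theorem overlap_eq_sum {P : Finset κ} (hP : ∀ t ∈ F, β t ∈ P) :
    overlap F β β' = ∑ p ∈ P, weight F β p * weight F β' p := by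
  classical
  refine Finset.sum_subset (Finset.image_subset_iff.2 hP) fun p _ hp => ?_
  have : weight F β p = 0 := by
    by_contra hcon
    obtain ⟨t, ht, e⟩ := weight_ne_zero hcon
    exact hp (Finset.mem_image.2 ⟨t, ht, e⟩)
  rw [this, zero_mul]

/-- The vectors `weight F β` and `weight F β'` are close if `β` is the translate of `β'` by an
element under which `F` is almost invariant. -/
theorem abs_one_sub_overlap_le [Group T] [DecidableEq T] (hF : F.Nonempty) (g : T)
    (hβ : ∀ t ∈ F, β t = β' (g * t)) :
    |1 - overlap F β β'| ≤ (symmDiff (F.image (g * ·)) F).card / F.card := by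
  classical
  have hn : (0 : ℝ) < F.card := by exact_mod_cast hF.card_pos
  set F' := F.image (g * ·)
  set P : Finset κ := (F ∪ F').image β'
  have hP' : ∀ t ∈ F, β' t ∈ P := fun t ht =>
    Finset.mem_image_of_mem _ (Finset.mem_union_left _ ht)
  have hP : ∀ t ∈ F, β t ∈ P := fun t ht => by
    rw [hβ t ht]
    exact Finset.mem_image_of_mem _ (Finset.mem_union_right _ (Finset.mem_image_of_mem _ ht))
  have hcount : ∀ p, (F.filter (β · = p)).card = (F'.filter (β' · = p)).card := by
    intro p
    rw [Finset.filter_image, Finset.card_image_of_injective _ (mul_right_injective g)]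
    refine congrArg Finset.card (Finset.filter_congr fun t ht => ?_)
    rw [hβ t ht]
  have hdiff : ∀ p, |((F.filter (β · = p)).card : ℝ) - (F.filter (β' · = p)).card| ≤
      ((symmDiff F' F).filter (β' · = p)).card := by
    intro p
    have key : ∀ A B : Finset T, (A.filter (β' · = p)).card ≤
        (B.filter (β' · = p)).card + ((symmDiff A B).filter (β' · = p)).card := fun A B => by
      refine (Finset.card_le_card ?_).trans (Finset.card_union_le _ _)
      intro t ht
      simp only [Finset.mem_filter, Finset.mem_union, Finset.mem_symmDiff] at ht ⊢
      tauto
    have h1 := key F' F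
    have h2 := key F F'
    rw [symmDiff_comm] at h2
    rw [hcount, abs_le]
    constructor
    · have : ((F.filter (β' · = p)).card : ℝ) ≤ (F'.filter (β' · = p)).card +
        ((symmDiff F' F).filter (β' · = p)).card := by exact_mod_cast h2
      linarith
    · have : ((F'.filter (β' · = p)).card : ℝ) ≤ (F.filter (β' · = p)).card +
        ((symmDiff F' F).filter (β' · = p)).card := by exact_mod_cast h1
      linarith
  have hsq : ∀ p, (weight F β p - weight F β' p) ^ 2 ≤
      ((symmDiff F' F).filter (β' · = p)).card / F.card := by
    intro p
    have h0 : 0 ≤ weight F β p := Real.sqrt_nonneg _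
    have h0' : 0 ≤ weight F β' p := Real.sqrt_nonneg _
    calc (weight F β p - weight F β' p) ^ 2 ≤ |weight F β p ^ 2 - weight F β' p ^ 2| := by
          rw [sq_sub_sq, abs_mul, ← sq_abs (weight F β p - _), sq]
          refine mul_le_mul_of_nonneg_right ?_ (abs_nonneg _)
          rw [abs_of_nonneg (add_nonneg h0 h0'), abs_le]
          constructor <;> linarith
      _ ≤ _ := by
          rw [weight_sq, weight_sq, ← sub_div, abs_div, abs_of_pos hn]
          gcongr
          exact hdiff p
  have e : 1 - overlap F β β' = (1 / 2) * ∑ p ∈ P, (weight F β p - weight F β' p) ^ 2 := by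
    rw [overlap_eq_sum hP]
    simp_rw [sub_sq]
    rw [Finset.sum_add_distrib, Finset.sum_sub_distrib, sum_weight_sq hF hP, sum_weight_sq hF hP']
    simp_rw [mul_assoc]
    rw [← Finset.mul_sum]
    ring
  have hnn : 0 ≤ ∑ p ∈ P, (weight F β p - weight F β' p) ^ 2 :=
    Finset.sum_nonneg fun _ _ => sq_nonneg _
  rw [e, abs_of_nonneg (by positivity)]
  calc (1 / 2) * ∑ p ∈ P, (weight F β p - weight F β' p) ^ 2
      ≤ ∑ p ∈ P, (weight F β p - weight F β' p) ^ 2 := by linarith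
    _ ≤ ∑ p ∈ P, (((symmDiff F' F).filter (β' · = p)).card : ℝ) / F.card :=
        Finset.sum_le_sum fun p _ => hsq p
    _ = _ := by
        have hm : ∀ t ∈ symmDiff F' F, β' t ∈ P := fun t ht => by
          refine Finset.mem_image_of_mem _ ?_
          rcases Finset.mem_symmDiff.1 ht with h | h
          · exact Finset.mem_union_right _ h.1
          · exact Finset.mem_union_left _ h.1
        rw [← Finset.sum_div, ← Nat.cast_sum, Finset.card_eq_sum_card_fiberwise hm]

/-- Multiplying a matrix by the overlaps of unit vectors does not increase its norm, if each of the
blocks on which a coordinate of these vectors does not vanish has that norm. -/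
theorem KerBound.overlap_mul {ι : Type*} {k : ι → ι → ℂ} {S : Set ι} {c : ℝ} (hc : 0 ≤ c)
    (hF : F.Nonempty) (β : ι → T → κ)
    (h : ∀ p, KerBound k {i ∈ S | ∃ t ∈ F, β i t = p} c) :
    KerBound (fun i j => (overlap F (β i) (β j) : ℂ) * k i j) S c := by
  classical
  refine KerBound.of_patches hc (fun i p => weight F (β i) p) (fun F' _ => ?_) fun p =>
    (h p).mono fun i hi => ⟨hi.1, weight_ne_zero hi.2⟩
  have hP : ∀ i ∈ F', ∀ t ∈ F, β i t ∈ F'.biUnion fun i => F.image (β i) := fun i hi t ht =>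
    Finset.mem_biUnion.2 ⟨i, hi, Finset.mem_image_of_mem _ ht⟩
  exact ⟨_, fun i hi => (sum_weight_sq hF (hP i hi)).le, fun i hi j _ => by
    rw [overlap_eq_sum (hP i hi)]⟩

end Weights

/-! ### Amenable isotropy: the norm on the fibre is the reduced norm -/

section Amenable

open Coset

theorem rngUnit_isotropy {G : Type*} [GroupoidArrows G] {x : units G} (t : Isotropy x) :
    rngUnit t.1 = x := Subtype.ext t.2.2

theorem srcUnit_isotropy {G : Type*} [GroupoidArrows G] {x : units G} (t : Isotropy x) :
    srcUnit t.1 = x := Subtype.ext t.2.1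

variable {G : Type*} [TopologicalSpace G] [GroupoidArrows G] [IsEtaleGroupoid G] {x : units G}

/-- Local sections through isotropy arrows multiply as the arrows do. -/
theorem eventually_section_mul {ρ σ τ : units G → G} {g s : Isotropy x}
    (hρ : Filter.Tendsto ρ (𝓝 x) (𝓝 g.1)) (hσ : Filter.Tendsto σ (𝓝 x) (𝓝 s.1))
    (hτ : Filter.Tendsto τ (𝓝 x) (𝓝 (g * s).1)) (hρr : ∀ᶠ u in 𝓝 x, rngUnit (ρ u) = u)
    (hσr : ∀ᶠ u in 𝓝 x, rngUnit (σ u) = u) (hτr : ∀ᶠ u in 𝓝 x, rngUnit (τ u) = u) :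
    ∀ᶠ u in 𝓝 x, src (ρ u) = rng (σ (srcUnit (ρ u))) ∧
      gmul (ρ u) (σ (srcUnit (ρ u))) = τ u := by
  have h1 : Filter.Tendsto (fun u => srcUnit (ρ u)) (𝓝 x) (𝓝 x) := by
    have := (continuous_srcUnit.tendsto g.1).comp hρ
    rwa [srcUnit_isotropy] at this
  have h2 : ∀ᶠ u in 𝓝 x, src (ρ u) = rng (σ (srcUnit (ρ u))) :=
    (h1.eventually hσr).mono fun u hu => (congrArg Subtype.val hu).symm
  have h3 : Filter.Tendsto (fun u => gmul (ρ u) (σ (srcUnit (ρ u)))) (𝓝 x) (𝓝 (g * s).1) :=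
    tendsto_gmul hρ (hσ.comp h1) (g.2.1.trans s.2.2.symm) h2
  obtain ⟨U, hU, hgU, -, -, hinj⟩ := exists_open_bisection (g * s).1 Filter.univ_mem
  filter_upwards [h2, h3 (hU.mem_nhds hgU), hτ (hU.mem_nhds hgU), hρr, hτr] with u h4 h5 h6 h7 h8
  refine ⟨h4, hinj h5 h6 ?_⟩
  rw [rng_mul _ _ h4]
  exact congrArg Subtype.val (h7.trans h8.symm)

/-- Finitely many bisections through isotropy arrows cover the support of a function on the
essential Hausdorff cover, after cutting off near `x`. -/
theorem exists_finset_bisections {f : Coset G → ℂ} (hf : f ∈ convolutionAlgebra (essCover G))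
    {U : Isotropy x → Set G} (hU : ∀ t, IsOpen (U t) ∧ t.1 ∈ U t) :
    ∃ E : Finset (Isotropy x), ∃ V ∈ 𝓝 x, ∀ a : G, f (sing a) ≠ 0 → srcUnit a ∈ V →
      rngUnit a ∈ V → ∃ g ∈ E, a ∈ U g := by
  obtain ⟨-, K, hKS, hK, h0⟩ := mem_convolutionAlgebra_iff.1 hf
  obtain ⟨E, hE⟩ := (hK.inter_right isClosed_cosetGroupoid).elim_finite_subcover
    (fun t : Isotropy x => {A : Coset G | (A.carrier ∩ U t).Nonempty})
    (fun t => isOpen_meets (hU t).1) (by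
      rintro A ⟨-, hA⟩
      obtain ⟨-, h1, h2⟩ := mem_cosetGroupoid_iff.1 hA
      obtain ⟨a, ha⟩ := A.nonempty
      obtain ⟨t, rfl⟩ : ∃ t : Isotropy x, t.1 = a :=
        ⟨⟨a, by rw [src_of_mem ha, h1], by rw [rng_of_mem ha, h2]⟩, rfl⟩
      exact Set.mem_iUnion.2 ⟨t, t.1, ha, (hU t).2⟩)
  obtain ⟨V, hV, hKV⟩ := exists_nhds_of_isCompact (x := x)
    (hK.diff (isOpen_biUnion fun t (_ : t ∈ E) => isOpen_meets (hU t).1)) (by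
      rintro A ⟨hA, hAE⟩ h
      exact hAE (hE ⟨hA, mem_cosetGroupoid_iff.2 ⟨hKS hA, h⟩⟩))
  refine ⟨E, V, hV, fun a ha h1 h2 => ?_⟩
  by_contra hcon
  refine hKV (sing a) ⟨by_contra fun h => ha (h0 _ h), fun h => hcon ?_⟩
    ⟨by rwa [srcPt_sing], by rwa [rngPt_sing]⟩
  obtain ⟨g, hg, c, hc, hcU⟩ := Set.mem_iUnion₂.1 h
  rw [mem_sing] at hc
  exact ⟨g, hg, hc ▸ hcU⟩

/-- The block on the arrows `i` for which `i p⁻¹` lies in given bisections through isotropy arrows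
is bounded by a block of the kind bounded in `eventually_kerBound_block`. -/
theorem kerBound_patch {f : G → ℂ} {F : Finset (Isotropy x)} {U : Isotropy x → Set G}
    {τ : Isotropy x → units G → G} {V : Set (units G)} {c : ℝ} (hc : 0 ≤ c)
    (hτ : ∀ u ∈ V, ∀ t ∈ F, rngUnit (τ t u) = u ∧ τ t u ∈ U t)
    (hV : ∀ u ∈ V, ∀ t ∈ F, src (τ t u) ∈ hausdorffUnits G →
      KerBound (kern f) {a | src a = src (τ t u) ∧ ∃ t ∈ F, a ∈ U t} c) (p : G) :
    KerBound (kern f) {i ∈ {i : G | src i ∈ hausdorffUnits G ∧ rngUnit i ∈ V} |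
      ∃ t ∈ F, gmul (ginv (τ t (rngUnit i))) i = p} c := by
  set S : Set G := {i ∈ {i : G | src i ∈ hausdorffUnits G ∧ rngUnit i ∈ V} |
    ∃ t ∈ F, gmul (ginv (τ t (rngUnit i))) i = p}
  rcases S.eq_empty_or_nonempty with hS | ⟨i₀, hi₀⟩
  · rw [hS]
    exact (KerBound.zero hc).congr fun i hi => absurd hi (Set.notMem_empty i)
  have key : ∀ i ∈ S, src i = src p ∧ ∃ t ∈ F, src (τ t (rngUnit i)) = rng p ∧
      gmul i (ginv p) = τ t (rngUnit i) := by
    rintro i ⟨⟨-, hi⟩, t, ht, rfl⟩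
    have e : rng (τ t (rngUnit i)) = rng i := congrArg Subtype.val (hτ _ hi t ht).1
    have e' : src (ginv (τ t (rngUnit i))) = rng i := by rw [src_inv, e]
    refine ⟨(src_mul _ _ e').symm, t, ht, ?_, ?_⟩
    · rw [rng_mul _ _ e', rng_inv]
    · rw [gpd_mul_inv_rev _ _ e', gpd_inv_inv, ← gmul_assoc _ _ _ (rng_inv i).symm
        (by rw [src_inv, e]), gmul_ginv, ← e, rng_gmul]
  obtain ⟨h1, t, ht, h2, -⟩ := key i₀ hi₀
  have hb := hV _ hi₀.1.2 t ht (by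
    rw [h2]
    exact rng_mem_hausdorffUnits (h1 ▸ hi₀.1.1))
  refine hb.of_embedding (fun i => gmul i (ginv p)) (fun i hi j hj e => ?_) (fun i hi => ?_)
    fun i hi j hj => ?_
  · refine gpd_mul_right_cancel (k := ginv p) ?_ ?_ e
    · rw [rng_inv, (key i hi).1]
    · rw [rng_inv, (key j hj).1]
  · obtain ⟨h3, s, hs, h4, h5⟩ := key i hi
    refine ⟨?_, s, hs, ?_⟩
    · rw [src_div h3.symm, h2]
    · beta_reduce
      rw [h5]
      exact (hτ _ hi.1.2 s hs).2
  · have hi' := (key i hi).1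
    have hj' := (key j hj).1
    rw [kern_of_eq _ (hj'.trans hi'.symm), kern_of_eq _ (by
      rw [src_div hi'.symm, src_div hj'.symm]), div_div_div (hj'.trans hi'.symm) hi'.symm]

/-- The norm on the fibre over `x` is bounded by the norm of the matrix on the arrows that start at
Hausdorff units and have range near `x`. -/
theorem restrictedNorm_le_of_kerBound {f b : Coset G → ℂ}
    (hf : f ∈ convolutionAlgebra (essCover G)) (hfb : Set.EqOn f b (cosetGroupoid x))
    {V : Set (units G)} (hV : V ∈ 𝓝 x) {c : ℝ} (hc : 0 ≤ c)
    (hloc : KerBound (kern fun k => f (sing k))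
      {i : G | src i ∈ hausdorffUnits G ∧ rngUnit i ∈ V} c) :
    restrictedNorm (essCover G) (essFibre x) b ≤ c := by
  obtain ⟨φ, hφ⟩ := exists_isCutoff hV
  obtain ⟨hfc, K, hKS, hK, h0⟩ := mem_convolutionAlgebra_iff.1 hf
  have hcut : cutCosets φ f ∈ convolutionAlgebra (essCover G) :=
    mem_convolutionAlgebra_iff.2 ⟨continuousOn_cutCosets hφ.continuous hfc, K, hKS, hK,
      fun A hA => by rw [cutCosets_apply, h0 A hA]; simp⟩
  refine (restrictedNorm_le_of_eqOn hcut ((cutCosets_eqOn hφ).trans hfb)).trans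
    (reducedNorm_le (bisectionBounded_of_mem hcut) (hc)
      (kerBound_essCover hcut (hc) ?_))
  have hk : ∀ i j : G, kern (cutCosets φ f) (sing i) (sing j) =
      φ (rngUnit i) * kern (fun k => f (sing k)) i j * φ (rngUnit j) := by
    intro i j
    rw [cutCosets, kern_cut, kern_sing]
    change ((φ (sing i).crng.srcPt : ℝ) : ℂ) * _ * ((φ (sing j).crng.srcPt : ℝ) : ℂ) = _
    rw [srcPt_crng, srcPt_crng, rngPt_sing, rngPt_sing]
  refine KerBound.of_support (hc) (fun i => rngUnit i ∈ V) (fun i _ j _ hne => ?_)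
    ((hloc.mul_diag (hc) (a := fun i => (φ (rngUnit i) : ℂ))
      (b := fun i => (φ (rngUnit i) : ℂ)) (fun i => hφ.norm_le _) fun i => hφ.norm_le _).congr
      fun i _ j _ => hk i j)
  rw [hk] at hne
  constructor
  · by_contra hcon
    exact hne (by rw [hφ.eq_zero _ hcon]; simp)
  · by_contra hcon
    exact hne (by rw [hφ.eq_zero _ hcon]; simp)

/-- If the isotropy group at `x` is amenable, the matrix of an extension `f` of `b` has, on the
arrows with range near `x`, norm at most slightly above the reduced norm of `b`. With a Følner set
`F` of the isotropy group, local sections `τ t` through the arrows `t ∈ F` turn every arrow `i` with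
range near `x` into a probability measure on the groupoid, the distribution of `τ t (r(i))⁻¹ i`.
Multiplying the matrix of `f` by the overlaps of these measures gives a matrix assembled from blocks
that are almost blocks of the matrix of `b`, and changes it only slightly, as `F` is almost
invariant. -/
theorem exists_nhds_kerBound_of_isAmenable (hΓ : IsAmenableGroup (Isotropy x)) {f b : Coset G → ℂ}
    (hf : f ∈ convolutionAlgebra (essCover G)) (hb : b ∈ convolutionAlgebra (cosetGroupoid x))
    (hfb : Set.EqOn f b (cosetGroupoid x)) {δ : ℝ} (hδ : 0 < δ) :
    ∃ V ∈ 𝓝 x, KerBound (kern fun k => f (sing k))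
      {i : G | src i ∈ hausdorffUnits G ∧ rngUnit i ∈ V}
      (reducedNorm (cosetGroupoid x) b + δ + δ) := by
  classical
  set c := reducedNorm (cosetGroupoid x) b
  have hc : 0 ≤ c := reducedNorm_nonneg _ _
  choose U hUo hUm _ hUs hUr using
    fun t : Isotropy x => exists_open_bisection t.1 Filter.univ_mem
  choose τ hτt _ hτr using fun t : Isotropy x => exists_rng_section t.1
  simp_rw [rngUnit_isotropy] at hτt hτr
  obtain ⟨M, hM, hfM⟩ : ∃ M, 0 ≤ M ∧ ∀ A, ‖f A‖ ≤ M := by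
    obtain ⟨-, -, M, hM, -, -, h⟩ := bisectionBounded_of_mem hf
    exact ⟨M, hM, h⟩
  obtain ⟨E, V₁, hV₁, hE⟩ := exists_finset_bisections hf fun t => ⟨hUo t, hUm t⟩
  obtain ⟨ε, hε, hεδ⟩ : ∃ ε : ℝ, 0 < ε ∧ ε * (E.card * M + 1) = δ :=
    ⟨δ / (E.card * M + 1), by positivity, by field_simp⟩
  obtain ⟨F, hF, hFE⟩ := hΓ (E.image (·⁻¹)) ε hε
  have hFcard : (0 : ℝ) < F.card := by exact_mod_cast hF.card_pos
  -- near `x`, the sections lie in the bisections and multiply as the isotropy arrows do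
  have ev1 : ∀ᶠ u in 𝓝 x, ∀ t ∈ F, rngUnit (τ t u) = u ∧ τ t u ∈ U t :=
    (Filter.eventually_all_finset F).2 fun t _ =>
      (hτr t).and (hτt t ((hUo t).mem_nhds (hUm t)))
  have ev2 : ∀ᶠ u in 𝓝 x, ∀ t ∈ F, src (τ t u) ∈ hausdorffUnits G →
      KerBound (kern fun k => f (sing k)) {a | src a = src (τ t u) ∧ ∃ t ∈ F, a ∈ U t}
        (c + δ) := by
    refine (Filter.eventually_all_finset F).2 fun t _ => ?_
    have h1 : Filter.Tendsto (fun u => srcUnit (τ t u)) (𝓝 x) (𝓝 x) := by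
      have := (continuous_srcUnit.tendsto t.1).comp (hτt t)
      rwa [srcUnit_isotropy] at this
    exact h1.eventually (eventually_kerBound_block hf hb hfb F
      (fun t => ⟨hUo t, hUm t, hUs t⟩) hδ)
  have ev3 : ∀ᶠ u in 𝓝 x, ∀ g ∈ E, ∀ t ∈ F, (rngUnit (τ g u) = u ∧ τ g u ∈ U g) ∧
      src (τ g u) = rng (τ (g⁻¹ * t) (srcUnit (τ g u))) ∧
      gmul (τ g u) (τ (g⁻¹ * t) (srcUnit (τ g u))) = τ t u :=
    (Filter.eventually_all_finset E).2 fun g _ => (Filter.eventually_all_finset F).2 fun t _ =>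
      ((hτr g).and (hτt g ((hUo g).mem_nhds (hUm g)))).and
        (eventually_section_mul (hτt g) (hτt _) (by rw [mul_inv_cancel_left]; exact hτt t)
          (hτr g) (hτr _) (hτr t))
  set V : Set (units G) := V₁ ∩ {u | (∀ t ∈ F, rngUnit (τ t u) = u ∧ τ t u ∈ U t) ∧
    (∀ t ∈ F, src (τ t u) ∈ hausdorffUnits G →
      KerBound (kern fun k => f (sing k)) {a | src a = src (τ t u) ∧ ∃ t ∈ F, a ∈ U t}
        (c + δ)) ∧ ∀ g ∈ E, ∀ t ∈ F, (rngUnit (τ g u) = u ∧ τ g u ∈ U g) ∧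
      src (τ g u) = rng (τ (g⁻¹ * t) (srcUnit (τ g u))) ∧
      gmul (τ g u) (τ (g⁻¹ * t) (srcUnit (τ g u))) = τ t u}
  have hV : V ∈ 𝓝 x := Filter.inter_mem hV₁ (ev1.and (ev2.and ev3))
  let S : Set G := {i : G | src i ∈ hausdorffUnits G ∧ rngUnit i ∈ V}
  let β : G → Isotropy x → G := fun i t => gmul (ginv (τ t (rngUnit i))) i
  have hmain : KerBound (fun i j => (overlap F (β i) (β j) : ℂ) * kern (fun k => f (sing k)) i j) S
      (c + δ) :=
    KerBound.overlap_mul (by positivity) hF β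
      (kerBound_patch (by positivity) (fun u hu => hu.2.1) fun u hu => hu.2.2.1)
  -- the arrows `i j⁻¹` in the support of `f` lie in finitely many bisections
  have hsupp : ∀ i ∈ S, ∀ j ∈ S, kern (fun k => f (sing k)) i j ≠ 0 →
      src j = src i ∧ ∃ g ∈ E, gmul i (ginv j) ∈ U g := by
    intro i hi j hj hne
    have e : src j = src i := by
      by_contra hcon
      exact hne (kern_of_ne _ hcon)
    rw [kern_of_eq _ e] at hne
    refine ⟨e, hE _ hne ?_ ?_⟩
    · rw [show srcUnit (gmul i (ginv j)) = rngUnit j from Subtype.ext (src_div e)]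
      exact hj.2.1
    · rw [show rngUnit (gmul i (ginv j)) = rngUnit i from Subtype.ext (rng_div e)]
      exact hi.2.1
  have hsmall : ∀ i ∈ S, ∀ j ∈ S, kern (fun k => f (sing k)) i j ≠ 0 →
      |1 - overlap F (β i) (β j)| ≤ ε := by
    intro i hi j hj hne
    obtain ⟨e, g, hg, hgU⟩ := hsupp i hi j hj hne
    have hβ : ∀ t ∈ F, β i t = β j (g⁻¹ * t) := by
      intro t ht
      obtain ⟨⟨h1, h2⟩, h3, h4⟩ := hi.2.2.2.2 g hg t ht
      have h5 : τ g (rngUnit i) = gmul i (ginv j) :=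
        hUr g h2 hgU ((congrArg Subtype.val h1).trans (rng_div e).symm)
      have h6 : srcUnit (gmul i (ginv j)) = rngUnit j := Subtype.ext (src_div e)
      rw [h5, h6] at h3 h4
      have h7 : src (ginv (gmul i (ginv j))) = rng i := by rw [src_inv, rng_div e]
      simp only [β]
      rw [← h4, gpd_mul_inv_rev _ _ h3, gmul_assoc _ _ _ (by rw [src_inv, rng_inv, h3]) h7,
        gpd_mul_inv_rev _ _ (by rw [rng_inv, e]), gpd_inv_inv,
        gmul_assoc _ _ _ (by rw [rng_inv, e]) (src_inv i), ginv_gmul, ← e, gmul_src]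
    refine (abs_one_sub_overlap_le hF g⁻¹ hβ).trans ?_
    rw [div_le_iff₀ hFcard]
    convert hFE g⁻¹ (Finset.mem_image_of_mem _ hg)
  have hrest : KerBound (fun i j => (1 - (overlap F (β i) (β j) : ℂ)) *
      kern (fun k => f (sing k)) i j) S (E.card * (ε * M)) := by
    refine kerBound_of_bisection_cover (U := fun m => U (E.equivFin.symm m)) (by positivity)
      (fun m => ⟨hUs _, hUr _⟩) (fun i hi j hj hne => ?_) fun i hi j hj => ?_
    · obtain ⟨e, g, hg, hgU⟩ := hsupp i hi j hj (right_ne_zero_of_mul hne)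
      refine ⟨e, E.equivFin ⟨g, hg⟩, ?_⟩
      rwa [Equiv.symm_apply_apply]
    · by_cases hne : kern (fun k => f (sing k)) i j = 0
      · rw [hne, mul_zero, norm_zero]
        positivity
      · rw [norm_mul, ← Complex.ofReal_one, ← Complex.ofReal_sub, Complex.norm_real]
        gcongr
        · exact hsmall i hi j hj hne
        · rw [kern_of_eq _ (hsupp i hi j hj hne).1]
          exact hfM _
  refine ⟨V, hV, ((hmain.add hrest).congr fun i _ j _ => by ring).mono_const ?_⟩
  have : E.card * (ε * M) ≤ δ := by
    calc E.card * (ε * M) = ε * (E.card * M) := by ring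
      _ ≤ ε * (E.card * M + 1) := by gcongr; linarith
      _ = δ := hεδ
  linarith

theorem fibreNormIsReduced_of_isAmenable (hΓ : IsAmenableGroup (Isotropy x)) :
    FibreNormIsReduced x := by
  intro b hb
  obtain ⟨f, hf, hfb⟩ := exists_extension_of_isClosed isClosed_cosetGroupoid
    (isClosed_essCover (G := G)) hb
  rw [Set.inter_eq_left.2 fun A (hA : A ∈ cosetGroupoid x) => hA.1] at hfb
  refine le_antisymm (le_of_forall_pos_le_add fun δ hδ => ?_) ?_
  · obtain ⟨V, hV, h⟩ := exists_nhds_kerBound_of_isAmenable hΓ hf hb hfb (half_pos hδ)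
    have hc := reducedNorm_nonneg (cosetGroupoid x) b
    have := restrictedNorm_le_of_kerBound hf hfb hV (by positivity) h
    linarith
  · exact le_restrictedNorm hf hfb fun F hF e => reducedNorm_cosetGroupoid_le_of_eqOn hb hF e

end Amenable

end

theorem theoremA {G : Type*} [TopologicalSpace G] [GroupoidArrows G] [IsEtaleGroupoid G]
    (hcover : ∃ U : ℕ → Set G, (∀ n, IsOpenBisection Set.univ (U n)) ∧ ⋃ n, U n = Set.univ) :
    ((∀ x ∈ extremelyDangerous G, FibreNormIsReduced x) →
      (singularIdeal G = {0} ↔ ∀ x ∈ extremelyDangerous G, groupIdeal (essSubgroups x) = {0}) ∧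
      (singularIdeal G = {0} ↔
        ∀ x ∈ extremelyDangerous G, WeaklyContained (regularRep (Isotropy x)) (fibreRep x)) ∧
      (∀ x ∈ extremelyDangerous G, groupIdeal (essSubgroups x) = {0} ↔
        WeaklyContained (regularRep (Isotropy x)) (fibreRep x))) ∧
    (∀ x : units G, IsAmenableGroup (Isotropy x) → FibreNormIsReduced x) ∧
    (singularIdeal G = {0} ↔ ∀ x ∈ extremelyDangerous G, fibreKernel x = {0}) := by
  refine ⟨fun h => ⟨?_, ?_, ?_⟩, fun x hx => fibreNormIsReduced_of_isAmenable hx,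
    singularIdeal_eq_iff_fibreKernel hcover⟩
  · rw [singularIdeal_eq_iff_fibreKernel hcover]
    exact forall₂_congr fun x hx => fibreKernel_eq_iff_groupIdeal (h x hx)
  · rw [singularIdeal_eq_iff_fibreKernel hcover]
    exact forall₂_congr fun x hx => (fibreKernel_eq_iff_groupIdeal (h x hx)).trans
      (groupIdeal_eq_iff_weaklyContained (essSubgroups x))
  · exact fun x _ => groupIdeal_eq_iff_weaklyContained (essSubgroups x)
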